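/- **Setting.** Let $T:X\to X$ be a measurable map, $Y\subset X$, $\varphi:Y\to\{1,2,\dots\}$ a measurable return time (not necessarily the first return time) with $T^{\varphi(y)}y\in Y$ for all $y\in Y$, and $F=T^{\varphi}:Y\to Y$ the induced map. Let $\mu$ be an ergodic $F$-invariant probability measure on $Y$ with $\varphi\in L^1(\mu)$. Let $\Delta=\{(y,\ell):y\in Y,\ 0\le\ell<\varphi(y)\}$, $\mu_\Delta=(\mu\times\text{counting})/\int_Y\varphi\,d\mu$, $\pi(y,\ell)=T^\ell y$ and $\mu_X=\pi_*\mu_\Delta$. For $v,w\in L^\infty(X,\mu_X)$ real-valued put $$\rho_{v,w}(n)=\int_X v\cdot w\circ T^n\,d\mu_X-\int_X v\,d\mu_X\int_X w\,d\mu_X .$$ Let $\mathcal B(Y)\subset L^1(Y,\mu;\mathbb C)$ be a complex Banach space with norm $\|\cdot\|\ge|\cdot|_1$ containing the constants. Let $R$ be the transfer operator of $F$ on $L^1(Y,\mu)$, and suppose that each $R_n=R1_{\{\varphi=n\}}$, $n\ge1$, restricts to a bounded operator on $\mathcal B(Y)$, with operator norm $\|R_n\|$. Put $R(z)=\sum_{n\ge1}R_nz^n$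 for $|z|\le1$. Assume that the inducing scheme is *good*: $\sum_{n\ge1}\sum_{j>n}\|R_j\|<\infty$; $1$ is a simple eigenvalue of $R(1)$ that is isolated in the spectrum of $R(1)$ (the spectral projection of $R(1)$ at $1$ has rank one); and for $|z|\le1$, $z\ne1$, the spectrum of $R(z)$ does not contain $1$ (operators and spectra on $\mathcal B(Y)$). For $v:X\to\mathbb R$ let $\mathcal D_v$ be the set of functions consisting of the restriction $v|_Y$ and of all $\hat v:Y\to\mathbb R$ such that $\hat v=v$ on $\{\varphi=1\}$ and, for every $n\ge2$, there is $j\in\{1,\dots,n-1\}$ with $\hat v=v\circ T^j$ on $\{\varphi=n\}$. Call $v$ *exchangeable* if $\mathcal D_v$ is a bounded subset of $\mathcal B(Y)$, and put $\|v\|=\sup_{\hat v\in\mathcal D_v}\|\hat v\|$. Write $|\cdot|_\infty$ for the norm of $L^\infty(X,\mu_X)$. **Statement (polynomially decreasing sequences).** Suppose that $\sum_{j>n}\|R_j\|=O(1/n^{1+\epsilon})$ for some $\epsilon>0$. Let $(u_n)_{n\ge1}$ be a sequence of positive reals for which there is a constant $C_0$ with $u_j\le C_0u_n$ for all $n\ge1$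 and $j\ge n/2$, and suppose that there is a constant $C_1$ with $\mu(\varphi>n)\le C_1u_n$ for all $n\ge1$. Then there is a constant $C>0$ such that $$|\rho_{v,w}(n)|\le C\,\bigl(|v|_\infty+\|v\|\bigr)\,|w|_\infty\sum_{j>n}u_j$$ for all exchangeable $v\in L^\infty(X,\mu_X)$, all $w\in L^\infty(X,\mu_X)$ and all $n\ge1$. (If $\sum_j u_j=\infty$, the right-hand side is read as an element of $[0,\infty]$ with $0\cdot\infty=0$.) -/

import Mathlib

open MeasureTheory Set

noncomputable section

namespace Decay

/-- The Perron–Frobenius (transfer) operator of `F : Y → Y` on `L¹(μ)`: `transfer μ F f` is the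
Radon–Nikodym derivative with respect to `μ` of the image under `F` of the complex measure
`f dμ`. -/
def transfer {Y : Type*} [MeasurableSpace Y] (μ : Measure Y) (F : Y → Y) (f : Y → ℂ) : Y → ℂ :=
  ComplexMeasure.rnDeriv ((μ.withDensityᵥ f).map F) μ

/-- The spectral (Riesz) projection `(2πi)⁻¹ ∮ (ξ - A)⁻¹ dξ` over the circle `|ξ - lam| = r`. -/
def rieszProjection {B : Type*} [NormedAddCommGroup B] [NormedSpace ℂ B]
    (A : B →L[ℂ] B) (lam : ℂ) (r : ℝ) : B →L[ℂ] B :=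
  (2 * Real.pi * Complex.I : ℂ)⁻¹ • ∮ ξ in C(lam, r), resolvent A ξ

/-- `lam` is an eigenvalue of `A`, isolated in the spectrum of `A`, and simple: the spectral
projection onto the part of the spectrum `{lam}` has rank one. -/
def IsSimpleIsolatedEigenvalue {B : Type*} [NormedAddCommGroup B] [NormedSpace ℂ B]
    (A : B →L[ℂ] B) (lam : ℂ) : Prop :=
  Module.End.HasEigenvalue (A : B →ₗ[ℂ] B) lam ∧
  ∃ r : ℝ, 0 < r ∧ spectrum ℂ A ∩ Metric.closedBall lam r = {lam} ∧
    Module.finrank ℂ (LinearMap.range (rieszProjection A lam r : B →ₗ[ℂ] B)) = 1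

/-- A space of observables `B ⊂ L¹(μ)`: the complex normed space `B` is realised inside
`L¹(μ)` (injectively), with `|b|₁ ≤ ‖b‖`, and contains the constant functions. -/
structure FunctionSpace {Y : Type*} [MeasurableSpace Y] (μ : Measure Y)
    (B : Type*) [NormedAddCommGroup B] [NormedSpace ℂ B] where
  toL1 : B →ₗ[ℂ] Lp ℂ 1 μ
  injective : Function.Injective toL1
  norm_toL1_le : ∀ b, ‖toL1 b‖ ≤ ‖b‖
  const_mem : ∀ c : ℂ, ∃ b, toL1 b =ᵐ[μ] fun _ => c

/-- `b ∈ B` is (the class of) the real observable `g : Y → ℝ`. -/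
def FunctionSpace.Represents {Y : Type*} [MeasurableSpace Y] {μ : Measure Y}
    {B : Type*} [NormedAddCommGroup B] [NormedSpace ℂ B] (ι : FunctionSpace μ B)
    (b : B) (g : Y → ℝ) : Prop :=
  ι.toL1 b =ᵐ[μ] fun y => (g y : ℂ)

/-- A map `T : X → X`, a subset `Y` with an integrable return time `φ : Y → {1, 2, …}` (not
necessarily the first return time), and an ergodic invariant probability measure `μ` on `Y` for
the induced map `y ↦ T^{φ(y)} y`. -/
structure InducingScheme (X : Type*) [MeasurableSpace X] where
  T : X → X
  measurable_T : Measurable T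
  Y : Set X
  φ : Y → ℕ
  measurable_φ : Measurable φ
  one_le_φ : ∀ y, 1 ≤ φ y
  return_mem : ∀ y : Y, T^[φ y] y ∈ Y
  μ : Measure Y
  isProbabilityMeasure : IsProbabilityMeasure μ
  ergodic : Ergodic (fun y : Y => (⟨T^[φ y] y, return_mem y⟩ : Y)) μ
  integrable_φ : Integrable (fun y => (φ y : ℝ)) μ

namespace InducingScheme

variable {X : Type*} [MeasurableSpace X] (S : InducingScheme X)

/-- The induced map `F = T^φ : Y → Y`. -/
def F (y : S.Y) : S.Y := ⟨S.T^[S.φ y] y, S.return_mem y⟩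

/-- The tower measure `(μ × counting) / ∫ φ dμ` on `{(y, ℓ) : 0 ≤ ℓ < φ(y)}`, as a measure on
`Y × ℕ` carried by the tower. -/
def towerMeasure : Measure (S.Y × ℕ) :=
  (∫⁻ y, (S.φ y : ENNReal) ∂S.μ)⁻¹ •
    (S.μ.prod Measure.count).restrict {p | p.2 < S.φ p.1}

/-- The measure `μ_X = π_* μ_Δ` on `X`, where `π(y, ℓ) = T^ℓ y`. -/
def μX : Measure X := S.towerMeasure.map fun p => S.T^[p.2] p.1

/-- The correlation function `ρ_{v,w}(n)`. -/
def corr (v w : X → ℝ) (n : ℕ) : ℝ :=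
  (∫ x, v x * w (S.T^[n] x) ∂S.μX) - (∫ x, v x ∂S.μX) * ∫ x, w x ∂S.μX

/-- The essential supremum norm with respect to `μ_X` (for `v ∈ L^∞(μ_X)`). -/
def supNorm (v : X → ℝ) : ℝ := (eLpNorm v ⊤ S.μX).toReal

variable {B : Type*} [NormedAddCommGroup B] [NormedSpace ℂ B]

/-- `R n` is the bounded operator on `B` given by `R_n = R 1_{φ = n}`, where `R` is the transfer
operator of `F` on `L¹(Y)`. (As `φ ≥ 1`, this entails `R 0 = 0`.) -/
def IsRenewalSequence (ι : FunctionSpace S.μ B) (R : ℕ → B →L[ℂ] B) : Prop :=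
  ∀ n b, ι.toL1 (R n b) =ᵐ[S.μ]
    transfer S.μ S.F ({y | S.φ y = n}.indicator (ι.toL1 b))

/-- The observables on `Y` derived from `v : X → ℝ`: the restriction of `v` to `Y`, and all
functions which agree on each set `{φ = n}`, `n ≥ 2`, with `v ∘ T^j` for some
`j ∈ {1, …, n - 1}`, and with `v` on `{φ = 1}`. -/
def derivedSet (v : X → ℝ) : Set (S.Y → ℝ) :=
  {g | (∀ y, g y = v y) ∨
    ((∀ y, S.φ y = 1 → g y = v y) ∧
      ∀ n, 2 ≤ n → ∃ j, 1 ≤ j ∧ j ≤ n - 1 ∧ ∀ y, S.φ y = n → g y = v (S.T^[j] y))}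

/-- `v` is exchangeable: its derived observables form a bounded subset of `B`. -/
def Exchangeable (ι : FunctionSpace S.μ B) (v : X → ℝ) : Prop :=
  ∃ M : ℝ, ∀ g ∈ S.derivedSet v, ∃ b, ι.Represents b g ∧ ‖b‖ ≤ M

/-- The norm of an exchangeable observable: the supremum of the norms of its derived
observables. -/
def exchNorm (ι : FunctionSpace S.μ B) (v : X → ℝ) : ℝ :=
  sSup {t | ∃ g ∈ S.derivedSet v, ∃ b, ι.Represents b g ∧ t = ‖b‖}

end InducingScheme

variable {B : Type*} [NormedAddCommGroup B] [NormedSpace ℂ B]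

/-- `R(z) = ∑_{n ≥ 1} R_n zⁿ` (with `R 0 = 0`). -/
def renewalSeries (R : ℕ → B →L[ℂ] B) (z : ℂ) : B →L[ℂ] B := ∑' n, z ^ n • R n

/-- The tail `∑_{j > n} ‖R_j‖`. -/
def normTail (R : ℕ → B →L[ℂ] B) (n : ℕ) : ℝ := ∑' j, ‖R (n + 1 + j)‖

/-- The conditions on the renewal operators that make an inducing scheme good:
`∑_{n ≥ 1} ∑_{j > n} ‖R_j‖ < ∞`; `1` is a simple eigenvalue of `R(1)`, isolated in its spectrum;
and `1` is not in the spectrum of `R(z)` for `|z| ≤ 1`, `z ≠ 1`. -/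
structure IsGood (R : ℕ → B →L[ℂ] B) : Prop where
  summable_norm : Summable fun n => ‖R n‖
  summable_normTail : Summable fun n => normTail R n
  simple_isolated : IsSimpleIsolatedEigenvalue (renewalSeries R 1) 1
  aperiodic : ∀ z : ℂ, ‖z‖ ≤ 1 → z ≠ 1 → (1 : ℂ) ∉ spectrum ℂ (renewalSeries R z)

end Decay

end

noncomputable section

namespace Decay

open Filter Topology
open scoped ENNReal

/-! The proof truncates the return time. Replacing `φ` by `min φ k` gives a lower tower, whose map
climbs one level or drops from the truncated top over `y` to `F y`. Its renewal operators `truncSeq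
R k j` vanish for `j > k`, so its renewal series is a polynomial and can be studied outside the unit
disc.

Analytic part. The inverse of `1 - R(z)` is singular only at `z = 1`, and only along the constants.
Dividing the component along the constants by `1 - z` gives `regularized`, which is boundedly
invertible on the whole closed disc; at `z = 1` this rests on simplicity of the eigenvalue and `∫ φ
dμ ≠ 0`. The tail hypothesis yields `∑ n ^ (1 + c) ‖R n‖ < ∞` for some `c > 0`. This is enough for
the truncated `regularized` operators to stay invertible, with inverses bounded uniformly in `k`, on
discs of radius `r = k ^ (c / k)` (`exists_norm_inverse_regularized_truncSeq_le`). Cauchy's estimate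
on such a disc bounds solutions of the truncated renewal equation with mean-zero source by a power
of `k` times `r ^ (-n)` (`exists_renewal_solution`). Exchangeability is what places the source in
`B` (`exists_truncated_source`), and `tower_correlation` converts the renewal sequence into
correlations.

Comparison part. For bounded observables, truncation costs at most a constant times `∫ (φ - min φ k)
+ n μ(φ > k)` (`abs_towerIntegral_corr_le`). With `k` about `n / 2 ^ Q` the doubling property of `u`
makes both terms `O(∑_{j > n} u_j)`. Since `r ^ k = k ^ c`, the factor `r ^ (-(n - k))` is then at
most `k ^ (-c (2 ^ Q - 1))`. The sequence `u` decreases at most polynomially, so a large fixed `Q`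
makes the truncated correlation `O(∑_{j > n} u_j)` as well (`exists_abs_corr_le`). -/

theorem circleIntegral_clm_comp {E F : Type*} [NormedAddCommGroup E] [NormedSpace ℂ E]
    [NormedAddCommGroup F] [NormedSpace ℂ F] [CompleteSpace E] [CompleteSpace F]
    (L : E →L[ℂ] F) {f : ℂ → E} {c : ℂ} {r : ℝ} (hf : CircleIntegrable f c r) :
    (∮ z in C(c, r), L (f z)) = L (∮ z in C(c, r), f z) := by
  simp only [circleIntegral]
  rw [← L.intervalIntegral_comp_comm hf.out]
  simp only [map_smul]

/-! ### The reduced resolvent at a simple isolated eigenvalue. -/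

section Spectral

variable {B : Type*} [NormedAddCommGroup B] [NormedSpace ℂ B] [CompleteSpace B]

/-- If `1` is a simple isolated eigenvalue of `A` with right and left eigenvectors `e` and `l`,
then `1 - A` is invertible modulo the rank-one projection `b ↦ l b • e`. -/
theorem exists_reduced_resolvent (A : B →L[ℂ] B) (e : B) (l : B →L[ℂ] ℂ) (hAe : A e = e)
    (hlA : ∀ b, l (A b) = l b) (hle : l e = 1) (h : IsSimpleIsolatedEigenvalue A 1) :
    ∃ Q : B →L[ℂ] B, (1 - A) * Q = 1 - l.smulRight e ∧ Q * (1 - A) = 1 - l.smulRight e := by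
  obtain ⟨-, r, hr, hsp, hfin⟩ := h
  have he : e ≠ 0 := by
    rintro rfl
    simp at hle
  have hunit : ∀ ξ ∈ Metric.sphere (1 : ℂ) r, ξ ∈ resolventSet ℂ A := by
    intro ξ hξ
    by_contra hcon
    have h1 : ξ ∈ spectrum ℂ A ∩ Metric.closedBall 1 r :=
      ⟨hcon, Metric.sphere_subset_closedBall hξ⟩
    rw [hsp, mem_singleton_iff] at h1
    subst h1
    simp at hξ
    exact hr.ne hξ
  have hne : ∀ ξ ∈ Metric.sphere (1 : ℂ) r, ξ - 1 ≠ 0 := by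
    intro ξ hξ h0
    rw [mem_sphere_iff_norm, h0, norm_zero] at hξ
    exact hr.ne hξ
  have hcont : ContinuousOn (resolvent A) (Metric.sphere (1 : ℂ) r) := fun ξ hξ =>
    (spectrum.hasDerivAt_resolvent_const_left (hunit ξ hξ)).continuousAt.continuousWithinAt
  have hint : CircleIntegrable (resolvent A) 1 r := hcont.circleIntegrable hr.le
  have hmul1 : ∀ ξ ∈ Metric.sphere (1 : ℂ) r,
      (algebraMap ℂ (B →L[ℂ] B) ξ - A) * resolvent A ξ = 1 := fun ξ hξ =>
    Ring.mul_inverse_cancel _ (hunit ξ hξ)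
  have hmul2 : ∀ ξ ∈ Metric.sphere (1 : ℂ) r,
      resolvent A ξ * (algebraMap ℂ (B →L[ℂ] B) ξ - A) = 1 := fun ξ hξ =>
    Ring.inverse_mul_cancel _ (hunit ξ hξ)
  have hpi : (2 * Real.pi * Complex.I : ℂ) ≠ 0 := by simp [Real.pi_ne_zero]
  -- On the eigenvector the resolvent acts as multiplication by `(ξ - 1)⁻¹`, whose contour integral
  -- is `2πi`. Dually for `l` below.
  have hPe : rieszProjection A 1 r e = e := by
    have h1 : (∮ ξ in C(1, r), resolvent A ξ) e = ∮ ξ in C(1, r), resolvent A ξ e :=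
      (circleIntegral_clm_comp (ContinuousLinearMap.apply ℂ B e) hint).symm
    have h2 : (∮ ξ in C(1, r), resolvent A ξ e) = ∮ ξ in C(1, r), (ξ - 1)⁻¹ • e := by
      refine circleIntegral.integral_congr hr.le fun ξ hξ => ?_
      have h3 := congrArg (fun L : B →L[ℂ] B => L e) (hmul2 ξ hξ)
      simp only [mul_apply_eq_comp, sub_apply,
        one_apply_eq_self, Algebra.algebraMap_eq_smul_one,
        smul_apply, hAe] at h3
      have h4 : ξ • e - e = (ξ - 1) • e := by rw [sub_smul, one_smul]
      rw [h4, map_smul] at h3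
      rw [eq_inv_smul_iff₀ (hne ξ hξ), h3]
    rw [rieszProjection, smul_apply, h1, h2, circleIntegral.integral_smul_const,
      circleIntegral.integral_sub_center_inv _ hr.ne', inv_smul_smul₀ hpi]
  have hlP : ∀ b, l (rieszProjection A 1 r b) = l b := by
    intro b
    have h1 : l ((∮ ξ in C(1, r), resolvent A ξ) b) = ∮ ξ in C(1, r), l (resolvent A ξ b) :=
      (circleIntegral_clm_comp (l ∘L ContinuousLinearMap.apply ℂ B b) hint).symm
    have h2 : (∮ ξ in C(1, r), l (resolvent A ξ b)) = ∮ ξ in C(1, r), (ξ - 1)⁻¹ • l b := by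
      refine circleIntegral.integral_congr hr.le fun ξ hξ => ?_
      have h3 := congrArg (fun L : B →L[ℂ] B => l (L b)) (hmul1 ξ hξ)
      simp only [mul_apply_eq_comp, sub_apply,
        one_apply_eq_self, Algebra.algebraMap_eq_smul_one,
        smul_apply, map_sub, hlA, map_smul] at h3
      rw [eq_inv_smul_iff₀ (hne ξ hξ), ← h3, sub_smul, one_smul]
    rw [rieszProjection, smul_apply, map_smul, h1, h2,
      circleIntegral.integral_smul_const,
      circleIntegral.integral_sub_center_inv _ hr.ne', inv_smul_smul₀ hpi]
  -- The rank-one range is spanned by `e`, and `l` reads off the coefficient because it is invariant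
  -- under the projection.
  have hP : rieszProjection A 1 r = l.smulRight e := by
    ext b
    let e' : LinearMap.range (rieszProjection A 1 r : B →ₗ[ℂ] B) := ⟨e, e, hPe⟩
    have he' : e' ≠ 0 := fun h0 => he (congrArg Subtype.val h0)
    obtain ⟨c, hc⟩ := (finrank_eq_one_iff_of_nonzero' e' he').1 hfin
      ⟨rieszProjection A 1 r b, b, rfl⟩
    have hc' : c • e = rieszProjection A 1 r b := congrArg Subtype.val hc
    have hl := hlP b
    rw [← hc', map_smul, hle, smul_eq_mul, mul_one] at hl
    rw [← hc', hl]
    rfl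
  have hscal : ContinuousOn (fun ξ : ℂ => (ξ - 1)⁻¹) (Metric.sphere (1 : ℂ) r) :=
    (continuousOn_id.sub continuousOn_const).inv₀ hne
  have hint' : CircleIntegrable (fun ξ => (ξ - 1)⁻¹ • resolvent A ξ) 1 r :=
    (hscal.smul hcont).circleIntegrable hr.le
  have hint1 : CircleIntegrable (fun ξ : ℂ => (ξ - 1)⁻¹ • (1 : B →L[ℂ] B)) 1 r :=
    (hscal.smul continuousOn_const).circleIntegrable hr.le
  -- The operator `Q` is the contour integral of `(ξ - 1)⁻¹ (ξ - A)⁻¹`. Multiplying it by `1 - A`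
  -- turns the integrand into `(ξ - 1)⁻¹ - (ξ - A)⁻¹`, which integrates to `1` minus the spectral
  -- projection. The map `g` stands for left or right multiplication.
  have key : ∀ g : (B →L[ℂ] B) →L[ℂ] (B →L[ℂ] B),
      (∀ ξ ∈ Metric.sphere (1 : ℂ) r, g (resolvent A ξ) = 1 - (ξ - 1) • resolvent A ξ) →
      g ((2 * Real.pi * Complex.I : ℂ)⁻¹ • ∮ ξ in C(1, r), (ξ - 1)⁻¹ • resolvent A ξ)
        = 1 - l.smulRight e := by
    intro g hg
    have h2 : (∮ ξ in C(1, r), g ((ξ - 1)⁻¹ • resolvent A ξ))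
        = ∮ ξ in C(1, r), ((ξ - 1)⁻¹ • (1 : B →L[ℂ] B) - resolvent A ξ) := by
      refine circleIntegral.integral_congr hr.le fun ξ hξ => ?_
      rw [map_smul, hg ξ hξ, smul_sub, inv_smul_smul₀ (hne ξ hξ)]
    rw [map_smul, ← circleIntegral_clm_comp g hint', h2, circleIntegral.integral_sub hint1 hint,
      circleIntegral.integral_smul_const, circleIntegral.integral_sub_center_inv _ hr.ne', smul_sub,
      inv_smul_smul₀ hpi, ← hP]
    rfl
  refine ⟨(2 * Real.pi * Complex.I : ℂ)⁻¹ • ∮ ξ in C(1, r), (ξ - 1)⁻¹ • resolvent A ξ,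
    key (ContinuousLinearMap.mul ℂ (B →L[ℂ] B) (1 - A)) fun ξ hξ => ?_,
    key ((ContinuousLinearMap.mul ℂ (B →L[ℂ] B)).flip (1 - A)) fun ξ hξ => ?_⟩
  · have h1 := hmul1 ξ hξ
    rw [Algebra.algebraMap_eq_smul_one] at h1
    have h2 : 1 - A = (ξ • 1 - A) - (ξ - 1) • 1 := by
      rw [sub_smul, one_smul]
      abel
    rw [ContinuousLinearMap.mul_apply', h2, sub_mul, h1, smul_one_mul]
  · have h1 := hmul2 ξ hξ
    rw [Algebra.algebraMap_eq_smul_one] at h1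
    have h2 : 1 - A = (ξ • 1 - A) - (ξ - 1) • 1 := by
      rw [sub_smul, one_smul]
      abel
    rw [ContinuousLinearMap.flip_apply, ContinuousLinearMap.mul_apply', h2, mul_sub, h1,
      mul_smul_one]

end Spectral

/-- Neumann series: `b = a (1 - a⁻¹ (a - b))` with a perturbation of norm at most `1 / 2`. The norm
bound comes from `b⁻¹ = a⁻¹ + a⁻¹ (a - b) b⁻¹` by absorbing half of `‖b⁻¹‖`. -/
theorem isUnit_and_norm_inverse_le_of_near {A : Type*} [NormedRing A] [CompleteSpace A]
    {a b : A} {M : ℝ} (ha : IsUnit a) (hM : ‖Ring.inverse a‖ ≤ M) (hab : ‖b - a‖ * M ≤ 1 / 2) :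
    IsUnit b ∧ ‖Ring.inverse b‖ ≤ 2 * M := by
  have h1 : ‖Ring.inverse a * (a - b)‖ ≤ 1 / 2 := by
    refine (norm_mul_le _ _).trans (le_trans ?_ hab)
    rw [mul_comm, norm_sub_rev]
    gcongr
  have hb : b = a * (1 - Ring.inverse a * (a - b)) := by
    rw [mul_sub, ← mul_assoc, Ring.mul_inverse_cancel _ ha]
    simp
  have hu : IsUnit b := by
    rw [hb]
    exact ha.mul (isUnit_one_sub_of_norm_lt_one (h1.trans_lt (by norm_num)))
  refine ⟨hu, ?_⟩
  have h2 : Ring.inverse b = Ring.inverse a + Ring.inverse a * (a - b) * Ring.inverse b := by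
    rw [mul_sub, Ring.inverse_mul_cancel _ ha, sub_mul, one_mul, mul_assoc,
      Ring.mul_inverse_cancel _ hu]
    simp
  have h3 : ‖Ring.inverse b‖ ≤ M + 1 / 2 * ‖Ring.inverse b‖ := by
    calc ‖Ring.inverse b‖ = ‖Ring.inverse a + Ring.inverse a * (a - b) * Ring.inverse b‖ :=
          congrArg _ h2
      _ ≤ ‖Ring.inverse a‖ + ‖Ring.inverse a * (a - b)‖ * ‖Ring.inverse b‖ :=
          (norm_add_le _ _).trans (by gcongr; exact norm_mul_le _ _)
      _ ≤ _ := by gcongr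
  linarith

/-- The polynomial `1 + z + ⋯ + z ^ (m - 1)`. -/
def geomPoly (m : ℕ) (z : ℂ) : ℂ := ∑ i ∈ Finset.range m, z ^ i

theorem geomPoly_one (m : ℕ) : geomPoly m 1 = m := by simp [geomPoly]

theorem one_sub_mul_geomPoly (m : ℕ) (z : ℂ) : (1 - z) * geomPoly m z = 1 - z ^ m :=
  mul_neg_geom_sum z m

theorem norm_geomPoly_le (m : ℕ) {z : ℂ} {r : ℝ} (hr : 1 ≤ r) (hz : ‖z‖ ≤ r) :
    ‖geomPoly m z‖ ≤ m * r ^ m := by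
  refine (norm_sum_le _ _).trans ?_
  refine (Finset.sum_le_card_nsmul _ _ (r ^ m) fun i hi => ?_).trans (by simp)
  rw [norm_pow]
  exact (pow_le_pow_left₀ (norm_nonneg _) hz i).trans
    (pow_le_pow_right₀ hr (Finset.mem_range.1 hi).le)

theorem norm_geomPoly_le_of_norm_le_one (m : ℕ) {z : ℂ} (hz : ‖z‖ ≤ 1) : ‖geomPoly m z‖ ≤ m := by
  simpa using norm_geomPoly_le m le_rfl hz

theorem differentiable_geomPoly (m : ℕ) : Differentiable ℂ (geomPoly m) := by
  unfold geomPoly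
  fun_prop

/-! ### Removing the singularity of the inverse of `1 - R(z)` at `z = 1`. -/

section Spectral

variable {B : Type*} [NormedAddCommGroup B] [NormedSpace ℂ B]

/-- The difference quotient `∑ (1 + z + ⋯ + z ^ (n - 1)) R_n` of the renewal series between `1`
and `z`. -/
def renewalQuotient (R : ℕ → B →L[ℂ] B) (z : ℂ) : B →L[ℂ] B := ∑' n, geomPoly n z • R n

/-- The operator `1 - R(z)` with its component along the eigenvector `e` divided by `1 - z`. -/
def regularized (R : ℕ → B →L[ℂ] B) (e : B) (l : B →L[ℂ] ℂ) (z : ℂ) : B →L[ℂ] B :=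
  (1 - l.smulRight e) * (1 - renewalSeries R z) + l.smulRight e * renewalQuotient R z

theorem renewalSeries_one (R : ℕ → B →L[ℂ] B) : renewalSeries R 1 = ∑' n, R n := by
  simp [renewalSeries]

theorem renewalSeries_one_sub {R : ℕ → B →L[ℂ] B} {z : ℂ} (h1 : Summable R)
    (hz : Summable fun n => z ^ n • R n) :
    renewalSeries R 1 - renewalSeries R z = (1 - z) • renewalQuotient R z := by
  rw [renewalSeries_one, renewalSeries, renewalQuotient, ← h1.tsum_sub hz, ← tsum_const_smul'']
  refine tsum_congr fun n => ?_
  rw [smul_smul, one_sub_mul_geomPoly, sub_smul, one_smul]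

theorem map_one_sub_renewalSeries {R : ℕ → B →L[ℂ] B} {z : ℂ} (h1 : Summable R)
    (hz : Summable fun n => z ^ n • R n) {l : B →L[ℂ] ℂ}
    (hl : ∀ b, l (renewalSeries R 1 b) = l b) (b : B) :
    l ((1 - renewalSeries R z) b) = (1 - z) * l (renewalQuotient R z b) := by
  have h := congrArg (fun L : B →L[ℂ] B => l (L b)) (renewalSeries_one_sub h1 hz)
  simp only [sub_apply, smul_apply, map_sub, map_smul, hl, smul_eq_mul] at h
  simpa using h

/-- Because `l` annihilates the range of `1 - R(1)`, the functional `l ∘ (1 - R(z))` is divisible by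
`1 - z`, with quotient `l` of the difference quotient. Away from `1` the regularization is therefore
an invertible left factor. -/
theorem regularized_eq_mul {R : ℕ → B →L[ℂ] B} {z : ℂ} (h1 : Summable R)
    (hz : Summable fun n => z ^ n • R n) {e : B} {l : B →L[ℂ] ℂ}
    (hl : ∀ b, l (renewalSeries R 1 b) = l b) (hz1 : z ≠ 1) :
    regularized R e l z =
      (1 - l.smulRight e + (1 - z)⁻¹ • l.smulRight e) * (1 - renewalSeries R z) := by
  have hz' : 1 - z ≠ 0 := sub_ne_zero.2 hz1.symm
  rw [regularized, add_mul]
  congr 1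
  ext b
  have h := map_one_sub_renewalSeries h1 hz hl b
  simp only [mul_apply_eq_comp, smul_apply, ContinuousLinearMap.smulRight_apply] at h ⊢
  rw [h, smul_smul, inv_mul_cancel_left₀ hz']

theorem isUnit_one_sub_add_smul_smulRight {e : B} {l : B →L[ℂ] ℂ} (hle : l e = 1) {c : ℂ}
    (hc : c ≠ 0) : IsUnit (1 - l.smulRight e + c • l.smulRight e : B →L[ℂ] B) := by
  have key : ∀ c d : ℂ, c * d = 1 →
      (1 - l.smulRight e + c • l.smulRight e : B →L[ℂ] B) *
        (1 - l.smulRight e + d • l.smulRight e) = 1 := by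
    intro c d hcd
    ext b
    simp only [mul_apply_eq_comp, add_apply, sub_apply, one_apply_eq_self,
      smul_apply, ContinuousLinearMap.smulRight_apply, map_add, map_sub,
      map_smul, hle, one_smul, sub_self, zero_add, smul_smul]
    rw [show d * l b * c = l b by linear_combination l b * hcd]
    module
  exact ⟨⟨_, _, key c c⁻¹ (mul_inv_cancel₀ hc), key c⁻¹ c (inv_mul_cancel₀ hc)⟩, rfl⟩

variable {R : ℕ → B →L[ℂ] B}

theorem summable_pow_smul (hR : Summable fun n => ‖R n‖) {z : ℂ} (hz : ‖z‖ ≤ 1) :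
    Summable fun n => ‖z ^ n • R n‖ := by
  refine hR.of_nonneg_of_le (fun _ => norm_nonneg _) fun n => ?_
  rw [norm_smul, norm_pow]
  exact mul_le_of_le_one_left (norm_nonneg _) (pow_le_one₀ (norm_nonneg _) hz)

variable [CompleteSpace B]

theorem continuousOn_renewalSeries (hR : Summable fun n => ‖R n‖) :
    ContinuousOn (renewalSeries R) (Metric.closedBall 0 1) := by
  refine continuousOn_tsum (fun n => by fun_prop) hR fun n z hz => ?_
  rw [norm_smul, norm_pow]
  exact mul_le_of_le_one_left (norm_nonneg _)
    (pow_le_one₀ (norm_nonneg _) (mem_closedBall_zero_iff.1 hz))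

theorem continuousOn_renewalQuotient (hR : Summable fun n : ℕ => (n : ℝ) * ‖R n‖) :
    ContinuousOn (renewalQuotient R) (Metric.closedBall 0 1) := by
  refine continuousOn_tsum (fun n => ?_) hR fun n z hz => ?_
  · exact ((differentiable_geomPoly n).continuous.smul continuous_const).continuousOn
  · rw [norm_smul]
    gcongr
    exact norm_geomPoly_le_of_norm_le_one n (mem_closedBall_zero_iff.1 hz)

/-- At `z = 1` the operator is `b ↦ b - R(1) b + l (R'(1) b) • e`. The first part is invertible off
the line of `e` by simplicity of the eigenvalue; on that line the last term is multiplication by the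
nonzero number `l (R'(1) e)`. -/
theorem isUnit_regularized_one {e : B} {l : B →L[ℂ] ℂ} (hRe : renewalSeries R 1 e = e)
    (hl : ∀ b, l (renewalSeries R 1 b) = l b) (hle : l e = 1)
    (hsimple : IsSimpleIsolatedEigenvalue (renewalSeries R 1) 1)
    (hmean : l (renewalQuotient R 1 e) ≠ 0) : IsUnit (regularized R e l 1) := by
  obtain ⟨Q, hQ1, hQ2⟩ := exists_reduced_resolvent _ e l hRe hl hle hsimple
  have hQ1' : ∀ b, Q b - renewalSeries R 1 (Q b) = b - l b • e := fun b => by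
    simpa using congrArg (fun L : B →L[ℂ] B => L b) hQ1
  have hQ2' : ∀ b, Q (b - renewalSeries R 1 b) = b - l b • e := fun b => by
    simpa using congrArg (fun L : B →L[ℂ] B => L b) hQ2
  have happ : ∀ b, regularized R e l 1 b
      = b - renewalSeries R 1 b + l (renewalQuotient R 1 b) • e := fun b => by
    simp [regularized, hl]
  rw [ContinuousLinearMap.isUnit_iff_bijective]
  constructor
  · rw [injective_iff_map_eq_zero]
    intro x hx
    rw [happ] at hx
    have h1 := congrArg l hx
    simp only [map_add, map_sub, hl, sub_self, map_smul, hle, smul_eq_mul, mul_one, zero_add,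
      map_zero] at h1
    rw [h1, zero_smul, add_zero] at hx
    have h2 := hQ2' x
    rw [hx, map_zero] at h2
    have h3 : x = l x • e := (sub_eq_zero.1 h2.symm)
    rw [h3, map_smul, map_smul, smul_eq_mul] at h1
    rw [h3, (mul_eq_zero.1 h1).resolve_right hmean, zero_smul]
  · intro y
    -- `Q y` produces `y` up to its `e`-component; the multiple of `e` is chosen so that the image
    -- has `e`-component `l y`.
    refine ⟨Q y + ((l y - l (renewalQuotient R 1 (Q y))) / l (renewalQuotient R 1 e)) • e, ?_⟩
    rw [happ]
    simp only [map_add, map_smul, hRe, smul_eq_mul]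
    rw [div_mul_cancel₀ _ hmean, add_sub_add_right_eq_sub, hQ1', add_sub_cancel, sub_add_cancel]

theorem isUnit_regularized (hR : Summable fun n => ‖R n‖) {e : B} {l : B →L[ℂ] ℂ}
    (hl : ∀ b, l (renewalSeries R 1 b) = l b) (hle : l e = 1) {z : ℂ} (hz : ‖z‖ ≤ 1) (hz1 : z ≠ 1)
    (hspec : (1 : ℂ) ∉ spectrum ℂ (renewalSeries R z)) : IsUnit (regularized R e l z) := by
  rw [regularized_eq_mul hR.of_norm (summable_pow_smul hR hz).of_norm hl hz1]
  refine (isUnit_one_sub_add_smul_smulRight hle (inv_ne_zero (sub_ne_zero.2 hz1.symm))).mul ?_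
  simpa [spectrum.notMem_iff] using hspec

/-- Inversion is continuous on units and the closed disc is compact. Continuity of the difference
quotient up to the boundary is where `∑ n ‖R n‖ < ∞` enters. -/
theorem exists_norm_inverse_regularized_le (hR : Summable fun n => ‖R n‖)
    (hR' : Summable fun n : ℕ => (n : ℝ) * ‖R n‖) {e : B} {l : B →L[ℂ] ℂ}
    (hRe : renewalSeries R 1 e = e) (hl : ∀ b, l (renewalSeries R 1 b) = l b) (hle : l e = 1)
    (hsimple : IsSimpleIsolatedEigenvalue (renewalSeries R 1) 1)
    (hspec : ∀ z : ℂ, ‖z‖ ≤ 1 → z ≠ 1 → (1 : ℂ) ∉ spectrum ℂ (renewalSeries R z))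
    (hmean : l (renewalQuotient R 1 e) ≠ 0) :
    ∃ M : ℝ, 0 < M ∧ ∀ z : ℂ, ‖z‖ ≤ 1 →
      IsUnit (regularized R e l z) ∧ ‖Ring.inverse (regularized R e l z)‖ ≤ M := by
  have hu : ∀ z : ℂ, ‖z‖ ≤ 1 → IsUnit (regularized R e l z) := by
    intro z hz
    by_cases hz1 : z = 1
    · rw [hz1]
      exact isUnit_regularized_one hRe hl hle hsimple hmean
    · exact isUnit_regularized hR hl hle hz hz1 (hspec z hz hz1)
  have hc : ContinuousOn (regularized R e l) (Metric.closedBall 0 1) :=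
    (continuousOn_const.mul (continuousOn_const.sub (continuousOn_renewalSeries hR))).add
      (continuousOn_const.mul (continuousOn_renewalQuotient hR'))
  have hc' : ContinuousOn (fun z => Ring.inverse (regularized R e l z))
      (Metric.closedBall 0 1) := by
    intro z hz
    obtain ⟨a, ha⟩ := hu z (mem_closedBall_zero_iff.1 hz)
    have := NormedRing.inverse_continuousAt a
    rw [ha] at this
    exact this.comp_continuousWithinAt (hc z hz)
  obtain ⟨M, hM⟩ := (isCompact_closedBall (0 : ℂ) 1).exists_bound_of_continuousOn hc'
  refine ⟨max M 1, by positivity, fun z hz => ⟨hu z hz, ?_⟩⟩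
  exact (hM z (mem_closedBall_zero_iff.2 hz)).trans (le_max_left _ _)

end Spectral

/-! ### Moments of the renewal operators and the slightly enlarged discs. -/

/-- Summation by parts: the increments of `n ^ (1 + c)` are `O(n ^ c)`, and `∑ n ^ c / n ^ (1 + ε)`
converges because `c < ε`. -/
theorem summable_rpow_mul_of_tail_le {a : ℕ → ℝ} (ha : ∀ n, 0 ≤ a n) (hs : Summable a)
    {ε c C : ℝ} (hc : 0 < c) (hcε : c < ε)
    (htail : ∀ n : ℕ, 1 ≤ n → ∑' j, a (n + 1 + j) ≤ C / (n : ℝ) ^ (1 + ε)) :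
    Summable fun n : ℕ => (n : ℝ) ^ (1 + c) * a n := by
  set w : ℕ → ℝ := fun n => ((n + 1 : ℕ) : ℝ) ^ (1 + c) - (n : ℝ) ^ (1 + c) with hw
  have hw0 : ∀ n, 0 ≤ w n := fun n =>
    sub_nonneg.2 (Real.rpow_le_rpow (by positivity) (by push_cast; linarith) (by positivity))
  have hwle : ∀ n : ℕ, w n ≤ (1 + c) * ((n : ℝ) + 1) ^ c := by
    intro n
    have hn : (0 : ℝ) < (n : ℝ) + 1 := by positivity
    -- Bernoulli's inequality for `(n / (n + 1)) ^ (1 + c)`; multiplying by `(n + 1) ^ (1 + c)`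
    -- bounds the increment.
    have h1 := one_add_mul_self_le_rpow_one_add (s := -1 / ((n : ℝ) + 1))
      (by rw [le_div_iff₀ hn]; linarith [(n.cast_nonneg : (0 : ℝ) ≤ n)])
      (show 1 ≤ 1 + c by linarith)
    have h2 : 1 + -1 / ((n : ℝ) + 1) = n / (n + 1) := by field_simp; ring
    rw [h2, Real.div_rpow (by positivity) hn.le, le_div_iff₀ (by positivity)] at h1
    have h3 : ((n : ℝ) + 1) ^ (1 + c) = (n + 1) * ((n : ℝ) + 1) ^ c := by
      rw [Real.rpow_add hn, Real.rpow_one]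
    simp only [hw]
    push_cast
    rw [h3] at h1 ⊢
    have h4 : (1 + (1 + c) * (-1 / ((n : ℝ) + 1))) * ((n + 1) * ((n : ℝ) + 1) ^ c)
        = (n + 1) * ((n : ℝ) + 1) ^ c - (1 + c) * ((n : ℝ) + 1) ^ c := by
      field_simp
      ring
    linarith
  have htel : ∀ n : ℕ, (n : ℝ) ^ (1 + c) = ∑ i ∈ Finset.range n, w i := by
    intro n
    rw [hw, Finset.sum_range_sub (fun n : ℕ => (n : ℝ) ^ (1 + c))]
    simp [Real.zero_rpow (by linarith : 1 + c ≠ 0)]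
  have ht0 : ∀ n, 0 ≤ ∑' j, a (n + 1 + j) := fun n => tsum_nonneg fun _ => ha _
  have hsw : Summable fun n => w n * ∑' j, a (n + 1 + j) := by
    rw [← summable_nat_add_iff 1]
    have hb : Summable fun n : ℕ => ((1 + c) * 2 ^ c * C) * (1 / ((n + 1 : ℕ) : ℝ) ^ (1 + ε - c)) :=
      ((summable_nat_add_iff 1).2
        (Real.summable_one_div_nat_rpow.2 (by linarith : 1 < 1 + ε - c))).mul_left _
    refine hb.of_nonneg_of_le (fun n => mul_nonneg (hw0 _) (ht0 _)) fun n => ?_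
    have hn : (0 : ℝ) < ((n + 1 : ℕ) : ℝ) := by positivity
    have h1 : (((n + 1 : ℕ) : ℝ) + 1) ^ c ≤ 2 ^ c * ((n + 1 : ℕ) : ℝ) ^ c := by
      rw [← Real.mul_rpow (by norm_num) hn.le]
      refine Real.rpow_le_rpow (by positivity) ?_ hc.le
      push_cast
      linarith [(n.cast_nonneg : (0 : ℝ) ≤ n)]
    calc w (n + 1) * ∑' j, a (n + 1 + 1 + j)
        ≤ ((1 + c) * (2 ^ c * ((n + 1 : ℕ) : ℝ) ^ c)) * (C / ((n + 1 : ℕ) : ℝ) ^ (1 + ε)) := by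
          refine mul_le_mul ((hwle _).trans ?_) (htail _ (by omega)) (ht0 _) (by positivity)
          gcongr
      _ = _ := by
          rw [Real.rpow_sub hn]
          field_simp
  refine summable_of_sum_range_le (c := ∑' n, w n * ∑' j, a (n + 1 + j))
    (fun n => mul_nonneg (by positivity) (ha n)) fun N => ?_
  calc ∑ i ∈ Finset.range N, (i : ℝ) ^ (1 + c) * a i
      = ∑ i ∈ Finset.range N, ∑ n ∈ Finset.range i, w n * a i := by
        simp only [htel, Finset.sum_mul]
    _ = ∑ n ∈ Finset.range N, ∑ i ∈ Finset.Ico (n + 1) N, w n * a i := by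
        refine Finset.sum_comm' fun i n => ?_
        simp only [Finset.mem_range, Finset.mem_Ico]
        omega
    _ ≤ ∑ n ∈ Finset.range N, w n * ∑' j, a (n + 1 + j) := by
        refine Finset.sum_le_sum fun n _ => ?_
        rw [← Finset.mul_sum, Finset.sum_Ico_eq_sum_range]
        gcongr
        · exact hw0 n
        · refine Summable.sum_le_tsum _ (fun _ _ => ha _) ?_
          simp only [add_comm (n + 1)]
          exact (summable_nat_add_iff (n + 1)).2 hs
    _ ≤ _ := hsw.sum_le_tsum _ fun n _ => mul_nonneg (hw0 n) (ht0 n)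

/-- The radius `k ^ (c / k)` of the discs on which the renewal series truncated at `k` are
controlled. -/
def radius (c : ℝ) (k : ℕ) : ℝ := (k : ℝ) ^ (c / k)

theorem one_le_radius {c : ℝ} (hc : 0 ≤ c) {k : ℕ} (hk : 1 ≤ k) : 1 ≤ radius c k :=
  Real.one_le_rpow (by exact_mod_cast hk) (by positivity)

theorem radius_pow (c : ℝ) (k i : ℕ) : radius c k ^ i = (k : ℝ) ^ (c * i / k) := by
  rw [radius, ← Real.rpow_natCast, ← Real.rpow_mul (by positivity)]
  congr 1
  ring

theorem radius_pow_self (c : ℝ) {k : ℕ} (hk : 1 ≤ k) : radius c k ^ k = (k : ℝ) ^ c := by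
  have : (k : ℝ) ≠ 0 := by positivity
  rw [radius_pow, mul_div_cancel_right₀ _ this]

/-- For `3 ≤ i ≤ k`, monotonicity of `log x / x` beyond `e` gives `k ^ (1 / k) ≤ i ^ (1 / i)`. For
`i = 1, 2` the bound `k ≤ 2 ^ k` gives `2 ^ i ≤ 4 i`, which explains the constant. -/
theorem rpow_div_self_le {i k : ℕ} (hi : 1 ≤ i) (hik : i ≤ k) :
    (k : ℝ) ^ ((i : ℝ) / k) ≤ 4 * i := by
  have hk : (0 : ℝ) < k := by exact_mod_cast hi.trans hik
  have hi' : (0 : ℝ) < i := by exact_mod_cast hi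
  by_cases h3 : 3 ≤ i
  · have he : Real.exp 1 ≤ i := Real.exp_one_lt_three.le.trans (by exact_mod_cast h3)
    have hik' : (i : ℝ) ≤ k := by exact_mod_cast hik
    have h := Real.log_div_self_antitoneOn (mem_Ici.2 he) (mem_Ici.2 (he.trans hik')) hik'
    simp only at h
    have : (k : ℝ) ^ ((i : ℝ) / k) ≤ i := by
      rw [Real.rpow_def_of_pos hk, ← Real.le_log_iff_exp_le hi']
      rw [div_le_div_iff₀ hk hi'] at h
      rw [mul_div_assoc', div_le_iff₀ hk]
      exact h
    linarith
  · have h2 : (k : ℝ) ^ ((i : ℝ) / k) ≤ 2 ^ i := by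
      calc (k : ℝ) ^ ((i : ℝ) / k) ≤ ((2 : ℝ) ^ k) ^ ((i : ℝ) / k) := by
            refine Real.rpow_le_rpow hk.le ?_ (by positivity)
            exact_mod_cast (Nat.lt_two_pow_self).le
        _ = 2 ^ i := by
            rw [← Real.rpow_natCast, ← Real.rpow_mul (by norm_num), mul_div_cancel₀ _ hk.ne',
              Real.rpow_natCast]
    refine h2.trans ?_
    have : i = 1 ∨ i = 2 := by omega
    rcases this with rfl | rfl <;> norm_num

/-- The bound does not depend on `k`; it supplies the majorant for dominated convergence as `k → ∞`.
-/
theorem radius_pow_le {c : ℝ} (hc : 0 ≤ c) (hc1 : c ≤ 1) {i k : ℕ} (hi : 1 ≤ i) (hik : i ≤ k) :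
    radius c k ^ i ≤ 4 * (i : ℝ) ^ c := by
  rw [radius_pow, show c * i / k = (i : ℝ) / k * c by ring, Real.rpow_mul (by positivity)]
  refine (Real.rpow_le_rpow (by positivity) (rpow_div_self_le hi hik) hc).trans ?_
  rw [Real.mul_rpow (by norm_num) (by positivity)]
  gcongr
  exact (Real.rpow_le_rpow_of_exponent_le (by norm_num) hc1).trans_eq (Real.rpow_one 4)

theorem tendsto_radius (c : ℝ) : Tendsto (radius c) atTop (𝓝 1) := by
  have h := (tendsto_rpow_div.comp tendsto_natCast_atTop_atTop).rpow_const (p := c)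
    (Or.inl one_ne_zero)
  rw [Real.one_rpow] at h
  refine h.congr fun k => ?_
  simp only [Function.comp, radius]
  rw [← Real.rpow_mul (by positivity)]
  congr 1
  ring

/-- A bound for `|z ^ min i k - z' ^ i|`, when `|z| ≤ r` and `z'` is the nearest point to `z` in
the unit disc. -/
def excess (r : ℝ) (k i : ℕ) : ℝ := if i ≤ k then r ^ i - 1 else r ^ k + 1

theorem excess_nonneg {r : ℝ} (hr : 1 ≤ r) (k i : ℕ) : 0 ≤ excess r k i := by
  unfold excess
  split_ifs
  · exact sub_nonneg.2 (one_le_pow₀ hr)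
  · positivity

theorem excess_le {r : ℝ} (hr : 1 ≤ r) (k i : ℕ) : excess r k i ≤ r ^ k + 1 := by
  unfold excess
  split_ifs with h
  · linarith [pow_le_pow_right₀ hr h]
  · exact le_rfl

/-- Dominated convergence. For fixed `i`, eventually `i ≤ k` and the excess is `r ^ i - 1 → 0`,
since the radii tend to `1`; for all `k ≥ 1` the terms are at most `8 i ^ (1 + c) a i`. -/
theorem tendsto_tsum_excess {a : ℕ → ℝ} (ha : ∀ n, 0 ≤ a n) {c : ℝ} (hc : 0 < c) (hc1 : c ≤ 1)
    (hs : Summable fun n : ℕ => (n : ℝ) ^ (1 + c) * a n) :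
    Tendsto (fun k => ∑' i : ℕ, ((i : ℝ) + 1) * excess (radius c k) k i * a i) atTop (𝓝 0) := by
  have h0 : (0 : ℝ) = ∑' _ : ℕ, (0 : ℝ) := by simp
  rw [h0]
  refine tendsto_tsum_of_dominated_convergence (hs.mul_left 8) (fun i => ?_) ?_
  · have h1 : Tendsto (fun k => excess (radius c k) k i) atTop (𝓝 0) := by
      have h2 := ((tendsto_radius c).pow i).sub_const 1
      rw [one_pow, sub_self] at h2
      refine h2.congr' ?_
      filter_upwards [eventually_ge_atTop i] with k hk
      simp [excess, hk]
    simpa using (h1.const_mul ((i : ℝ) + 1)).mul_const (a i)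
  · filter_upwards [eventually_ge_atTop 1] with k hk i
    have hr := one_le_radius hc.le hk
    rw [Real.norm_of_nonneg (by have := ha i; have := excess_nonneg hr k i; positivity),
      ← mul_assoc]
    refine mul_le_mul_of_nonneg_right ?_ (ha i)
    rcases Nat.eq_zero_or_pos i with rfl | hi
    · simp [excess, Real.zero_rpow (by linarith : 1 + c ≠ 0)]
    have hi' : (1 : ℝ) ≤ i := by exact_mod_cast hi
    have hex : excess (radius c k) k i ≤ 4 * (i : ℝ) ^ c := by
      unfold excess
      split_ifs with hik
      · linarith [radius_pow_le hc.le hc1 hi hik]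
      · rw [radius_pow_self c hk]
        have h1 : (k : ℝ) ^ c ≤ (i : ℝ) ^ c :=
          Real.rpow_le_rpow (by positivity) (by exact_mod_cast (not_le.1 hik).le) hc.le
        have h2 : 1 ≤ (i : ℝ) ^ c := Real.one_le_rpow hi' hc.le
        linarith
    calc ((i : ℝ) + 1) * excess (radius c k) k i ≤ (2 * i) * (4 * (i : ℝ) ^ c) := by
          refine mul_le_mul (by linarith) hex (excess_nonneg hr k i) (by positivity)
      _ = 8 * (i : ℝ) ^ (1 + c) := by
          rw [Real.rpow_add (by positivity), Real.rpow_one]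
          ring

/-- Take `z` itself inside the disc and `z / |z|` outside; then the powers differ by exactly `|z| ^
j - 1` in modulus. -/
theorem exists_near_unit_disc {z : ℂ} {r : ℝ} (hr : 1 ≤ r) (hz : ‖z‖ ≤ r) :
    ∃ w : ℂ, ‖w‖ ≤ 1 ∧ ∀ j : ℕ, ‖z ^ j - w ^ j‖ ≤ r ^ j - 1 := by
  by_cases h1 : ‖z‖ ≤ 1
  · exact ⟨z, h1, fun j => by simpa using one_le_pow₀ hr⟩
  · rw [not_le] at h1
    have h0 : (‖z‖ : ℂ) ≠ 0 := by
      rw [Complex.ofReal_ne_zero]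
      linarith
    refine ⟨z / ‖z‖, ?_, fun j => ?_⟩
    · rw [norm_div, Complex.norm_real, norm_norm, div_self (by linarith)]
    · have h2 : z ^ j - (z / ‖z‖) ^ j = (z / ‖z‖) ^ j * ((‖z‖ ^ j - 1 : ℝ) : ℂ) := by
        push_cast
        rw [div_pow]
        field_simp
      have h3 : 1 ≤ ‖z‖ ^ j := one_le_pow₀ h1.le
      rw [h2, norm_mul, norm_pow, norm_div, Complex.norm_real, norm_norm, div_self (by linarith),
        one_pow, one_mul, Complex.norm_real, Real.norm_of_nonneg (by linarith)]
      gcongr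

/-- The factor `i + 1` is wasteful here; it lets the series and its difference quotient share one
majorant. -/
theorem norm_pow_min_sub_le {z w : ℂ} {r : ℝ} (hr : 1 ≤ r) (hz : ‖z‖ ≤ r) (hw : ‖w‖ ≤ 1)
    (h : ∀ j : ℕ, ‖z ^ j - w ^ j‖ ≤ r ^ j - 1) (k i : ℕ) :
    ‖z ^ min i k - w ^ i‖ ≤ (i + 1) * excess r k i := by
  have : ‖z ^ min i k - w ^ i‖ ≤ excess r k i := by
    unfold excess
    split_ifs with hik
    · rw [min_eq_left hik]
      exact h i
    · rw [min_eq_right (not_le.1 hik).le]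
      refine (norm_sub_le _ _).trans ?_
      rw [norm_pow, norm_pow]
      gcongr
      exact pow_le_one₀ (norm_nonneg _) hw
  have h0 := excess_nonneg hr k i
  nlinarith [(i.cast_nonneg : (0 : ℝ) ≤ i)]

theorem norm_geomPoly_min_sub_le {z w : ℂ} {r : ℝ} (hr : 1 ≤ r) (hz : ‖z‖ ≤ r) (hw : ‖w‖ ≤ 1)
    (h : ∀ j : ℕ, ‖z ^ j - w ^ j‖ ≤ r ^ j - 1) (k i : ℕ) :
    ‖geomPoly (min i k) z - geomPoly i w‖ ≤ (i + 1) * excess r k i := by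
  have : ‖geomPoly (min i k) z - geomPoly i w‖ ≤ i * excess r k i := by
    unfold excess
    split_ifs with hik
    · rw [min_eq_left hik, geomPoly, geomPoly, ← Finset.sum_sub_distrib]
      refine (norm_sum_le _ _).trans
        ((Finset.sum_le_card_nsmul _ _ (r ^ i - 1) fun j hj => (h j).trans ?_).trans (by simp))
      gcongr
      exact (Finset.mem_range.1 hj).le
    · have hki := (not_le.1 hik).le
      rw [min_eq_right hki]
      refine (norm_sub_le _ _).trans ?_
      have h1 := norm_geomPoly_le k hr hz
      have h2 := norm_geomPoly_le_of_norm_le_one i hw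
      have h3 : (k : ℝ) * r ^ k ≤ i * r ^ k := by gcongr
      linarith
  have h0 := excess_nonneg hr k i
  linarith

/-! ### Truncated renewal operators and their uniform invertibility. -/

section Operators

variable {B : Type*} [NormedAddCommGroup B] [NormedSpace ℂ B]

/-- The sum of the operators `R i` over `i ∈ A`. -/
def opSum (R : ℕ → B →L[ℂ] B) (A : Set ℕ) : B →L[ℂ] B := ∑' i, A.indicator R i

/-- The renewal operators of the scheme whose return time is truncated at `k`. -/
def truncSeq (R : ℕ → B →L[ℂ] B) (k j : ℕ) : B →L[ℂ] B := opSum R {i | min i k = j}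

theorem truncSeq_of_lt (R : ℕ → B →L[ℂ] B) {k j : ℕ} (h : k < j) : truncSeq R k j = 0 := by
  have : {i : ℕ | min i k = j} = ∅ := by
    ext i
    simp only [mem_ofPred_eq, mem_empty_iff_false, iff_false]
    omega
  simp [truncSeq, opSum, this]

theorem opSum_singleton (R : ℕ → B →L[ℂ] B) (j : ℕ) : opSum R {j} = R j := by
  rw [opSum, tsum_eq_single j fun i hi => by simp [hi]]
  simp

theorem truncSeq_zero (R : ℕ → B →L[ℂ] B) (h0 : R 0 = 0) {k : ℕ} (hk : 1 ≤ k) :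
    truncSeq R k 0 = 0 := by
  have : {i : ℕ | min i k = 0} = {0} := by
    ext i
    simp only [mem_ofPred_eq, mem_singleton_iff]
    omega
  rw [truncSeq, this, opSum_singleton, h0]

variable {R : ℕ → B →L[ℂ] B}

theorem summable_norm_indicator (hR : Summable fun n => ‖R n‖) (A : Set ℕ) :
    Summable fun n => ‖A.indicator R n‖ :=
  hR.of_nonneg_of_le (fun _ => norm_nonneg _) fun n => norm_indicator_le_norm_self R n

theorem norm_opSum_le (hR : Summable fun n => ‖R n‖) (A : Set ℕ) :
    ‖opSum R A‖ ≤ ∑' n, ‖R n‖ :=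
  (norm_tsum_le_tsum_norm (summable_norm_indicator hR A)).trans
    ((summable_norm_indicator hR A).tsum_le_tsum (fun n => norm_indicator_le_norm_self R n) hR)

theorem summable_smul_truncSeq (f : ℕ → ℂ) (k : ℕ) :
    Summable fun j => f j • truncSeq R k j :=
  summable_of_ne_finset_zero (s := Finset.range (k + 1)) fun j hj => by
    rw [truncSeq_of_lt R (by simpa using hj), smul_zero]

variable [CompleteSpace B]

theorem hasSum_opSum (hR : Summable fun n => ‖R n‖) (A : Set ℕ) :
    HasSum (A.indicator R) (opSum R A) :=
  (summable_norm_indicator hR A).of_norm.hasSum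

/-- Grouping the indices `i` by the value of `min i k`. In particular truncation leaves `R(1)`
unchanged, hence also the eigenvectors `e` and `l`. -/
theorem tsum_smul_truncSeq (hR : Summable fun n => ‖R n‖) (f : ℕ → ℂ) (k : ℕ) :
    ∑' j, f j • truncSeq R k j = ∑' i, f (min i k) • R i := by
  rw [tsum_eq_sum (s := Finset.range (k + 1)) fun j hj => by
    rw [truncSeq_of_lt R (by simpa using hj), smul_zero]]
  have h1 : ∀ j, f j • truncSeq R k j = ∑' i, f j • {i | min i k = j}.indicator R i := fun j => by
    rw [truncSeq, opSum, tsum_const_smul'']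
  simp only [h1]
  rw [← Summable.tsum_finsetSum fun j _ =>
    (hasSum_opSum hR {i | min i k = j}).summable.const_smul (f j)]
  refine tsum_congr fun i => ?_
  rw [Finset.sum_eq_single (min i k)]
  · simp
  · intro j _ hj
    rw [indicator_of_notMem (by simpa using hj.symm), smul_zero]
  · intro h
    simp at h

theorem norm_tsum_smul_truncSeq_sub_le (hR : Summable fun n => ‖R n‖) {f g : ℕ → ℂ} {k : ℕ}
    {a : ℕ → ℝ} (hfg : ∀ i, ‖f (min i k) - g i‖ ≤ a i) (ha : Summable fun i => a i * ‖R i‖)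
    (hg : Summable fun i => g i • R i) :
    ‖∑' j, f j • truncSeq R k j - ∑' i, g i • R i‖ ≤ ∑' i, a i * ‖R i‖ := by
  have hle : ∀ i, ‖(f (min i k) - g i) • R i‖ ≤ a i * ‖R i‖ := fun i => by
    rw [norm_smul]
    gcongr
    exact hfg i
  have hsn : Summable fun i => ‖(f (min i k) - g i) • R i‖ :=
    ha.of_nonneg_of_le (fun _ => norm_nonneg _) hle
  have hf : Summable fun i => f (min i k) • R i := by
    have := hsn.of_norm.add hg
    simpa [← add_smul] using this
  rw [tsum_smul_truncSeq hR, ← hf.tsum_sub hg]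
  simp only [← sub_smul]
  exact (norm_tsum_le_tsum_norm hsn).trans (hsn.tsum_le_tsum hle ha)

theorem norm_regularized_truncSeq_sub_le (hR : Summable fun n => ‖R n‖)
    (hR' : Summable fun n : ℕ => (n : ℝ) * ‖R n‖) (e : B) (l : B →L[ℂ] ℂ) {z w : ℂ} {r : ℝ}
    (hr : 1 ≤ r) (hz : ‖z‖ ≤ r) (hw : ‖w‖ ≤ 1) (h : ∀ j : ℕ, ‖z ^ j - w ^ j‖ ≤ r ^ j - 1) (k : ℕ) :
    ‖regularized (truncSeq R k) e l z - regularized R e l w‖ ≤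
      (‖1 - l.smulRight e‖ + ‖l.smulRight e‖) *
        ∑' i : ℕ, ((i : ℝ) + 1) * excess r k i * ‖R i‖ := by
  have ha : Summable fun i : ℕ => ((i : ℝ) + 1) * excess r k i * ‖R i‖ := by
    refine ((hR'.add hR).mul_left (r ^ k + 1)).of_nonneg_of_le (fun i => ?_) fun i => ?_
    · have := excess_nonneg hr k i
      positivity
    · have := excess_le hr k i
      calc ((i : ℝ) + 1) * excess r k i * ‖R i‖ ≤ ((i : ℝ) + 1) * (r ^ k + 1) * ‖R i‖ := by gcongr
        _ = _ := by ring
  have h1 := norm_tsum_smul_truncSeq_sub_le hR (f := fun j => z ^ j) (g := fun i => w ^ i)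
    (norm_pow_min_sub_le hr hz hw h k) ha (summable_pow_smul hR hw).of_norm
  have h2 := norm_tsum_smul_truncSeq_sub_le hR (f := fun j => geomPoly j z)
    (g := fun i => geomPoly i w) (norm_geomPoly_min_sub_le hr hz hw h k) ha
    (hR'.of_norm_bounded fun i => by
      rw [norm_smul]
      gcongr
      exact norm_geomPoly_le_of_norm_le_one i hw)
  have h3 : regularized (truncSeq R k) e l z - regularized R e l w =
      -((1 - l.smulRight e) * (renewalSeries (truncSeq R k) z - renewalSeries R w)) +
        l.smulRight e * (renewalQuotient (truncSeq R k) z - renewalQuotient R w) := by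
    unfold regularized
    noncomm_ring
  rw [h3, add_mul]
  refine (norm_add_le _ _).trans (add_le_add ?_ ?_)
  · rw [norm_neg]
    exact (norm_mul_le _ _).trans (mul_le_mul_of_nonneg_left h1 (norm_nonneg _))
  · exact (norm_mul_le _ _).trans (mul_le_mul_of_nonneg_left h2 (norm_nonneg _))

/-- Each `z` in the enlarged disc is compared with a nearby `w` in the unit disc: the truncated
operator at `z` differs from the original one at `w` by a quantity that tends to `0` with `k`,
uniformly in `z`. Once this is below `1 / (2 M)`, the perturbation lemma applies. -/
theorem exists_norm_inverse_regularized_truncSeq_le {c : ℝ} (hc : 0 < c) (hc1 : c ≤ 1)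
    (hR : Summable fun n => ‖R n‖) (hRc : Summable fun n : ℕ => (n : ℝ) ^ (1 + c) * ‖R n‖)
    {e : B} {l : B →L[ℂ] ℂ} {M : ℝ} (hM : 0 < M)
    (h : ∀ z : ℂ, ‖z‖ ≤ 1 →
      IsUnit (regularized R e l z) ∧ ‖Ring.inverse (regularized R e l z)‖ ≤ M) :
    ∃ K : ℕ, 1 ≤ K ∧ ∀ k, K ≤ k → ∀ z : ℂ, ‖z‖ ≤ radius c k →
      IsUnit (regularized (truncSeq R k) e l z) ∧
        ‖Ring.inverse (regularized (truncSeq R k) e l z)‖ ≤ 2 * M := by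
  have hR' : Summable fun n : ℕ => (n : ℝ) * ‖R n‖ := by
    refine hRc.of_nonneg_of_le (fun n => by positivity) fun n => ?_
    gcongr
    rcases Nat.eq_zero_or_pos n with rfl | hn
    · simp [Real.zero_rpow (by linarith : 1 + c ≠ 0)]
    · exact Real.self_le_rpow_of_one_le (by exact_mod_cast hn) (by linarith)
  have ht := (tendsto_tsum_excess (fun n => norm_nonneg (R n)) hc hc1 hRc).const_mul
    (‖1 - l.smulRight e‖ + ‖l.smulRight e‖)
  rw [mul_zero] at ht
  obtain ⟨K, hK⟩ := eventually_atTop.1 (ht.eventually (ge_mem_nhds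
    (show (0 : ℝ) < 1 / (2 * M) by positivity)))
  refine ⟨max K 1, le_max_right _ _, fun k hk z hz => ?_⟩
  have hr := one_le_radius hc.le ((le_max_right _ _).trans hk)
  obtain ⟨w, hw, hzw⟩ := exists_near_unit_disc hr hz
  obtain ⟨hu, hn⟩ := h w hw
  refine isUnit_and_norm_inverse_le_of_near hu hn ?_
  have := (norm_regularized_truncSeq_sub_le hR hR' e l hr hz hw hzw k).trans
    (hK k ((le_max_left _ _).trans hk))
  calc _ ≤ 1 / (2 * M) * M := by gcongr
    _ = 1 / 2 := by field_simp

end Operators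

/-! ### Laurent coefficients and the truncated renewal equation. -/

section Operators

variable {B : Type*} [NormedAddCommGroup B] [NormedSpace ℂ B]

/-- The `m`-th Laurent coefficient of `G` on the circle of radius `r` around `0`. -/
def laurentCoeff (r : ℝ) (G : ℂ → B) (m : ℤ) : B :=
  (2 * Real.pi * Complex.I : ℂ)⁻¹ • ∮ z in C(0, r), z ^ (-m - 1) • G z

theorem norm_laurentCoeff_le {r : ℝ} (hr : 0 < r) {G : ℂ → B} {D : ℝ}
    (hG : ∀ z ∈ Metric.sphere (0 : ℂ) r, ‖G z‖ ≤ D) (m : ℤ) :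
    ‖laurentCoeff r G m‖ ≤ D * r ^ (-m) := by
  have h := circleIntegral.norm_two_pi_i_inv_smul_integral_le_of_norm_le_const hr.le
    (f := fun z => z ^ (-m - 1) • G z) (C := r ^ (-m - 1) * D) fun z hz => by
      rw [norm_smul, norm_zpow, mem_sphere_zero_iff_norm.1 hz]
      gcongr
      exact hG z hz
  refine h.trans_eq ?_
  rw [zpow_sub_one₀ hr.ne']
  field_simp

theorem laurentCoeff_of_neg [CompleteSpace B] {r : ℝ} (hr : 0 < r) {G : ℂ → B}
    (hG : ∀ z ∈ Metric.closedBall (0 : ℂ) r, DifferentiableAt ℂ G z) {m : ℤ} (hm : m < 0) :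
    laurentCoeff r G m = 0 := by
  obtain ⟨p, hp⟩ : ∃ p : ℕ, -m - 1 = p := ⟨(-m - 1).toNat, by omega⟩
  have hd : ∀ z ∈ Metric.closedBall (0 : ℂ) r,
      DifferentiableAt ℂ (fun z => z ^ (-m - 1) • G z) z := fun z hz => by
    simp only [hp, zpow_natCast]
    exact (differentiableAt_id.pow p).smul (hG z hz)
  rw [laurentCoeff, Complex.circleIntegral_eq_zero_of_differentiable_on_off_countable hr.le
    countable_empty (fun z hz => (hd z hz).continuousAt.continuousWithinAt)
    (fun z hz => hd z (Metric.ball_subset_closedBall hz.1)), smul_zero]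

theorem continuousOn_zpow_smul {r : ℝ} (hr : 0 < r) {G : ℂ → B}
    (hG : ContinuousOn G (Metric.sphere 0 r)) (m : ℤ) :
    ContinuousOn (fun z => z ^ m • G z) (Metric.sphere (0 : ℂ) r) := by
  refine ContinuousOn.smul (fun z hz => ?_) hG
  refine (continuousAt_zpow₀ z m (Or.inl ?_)).continuousWithinAt
  rintro rfl
  simp at hz
  exact hr.ne hz

theorem laurentCoeff_pow_smul_const [CompleteSpace B] {r : ℝ} (hr : 0 < r) (j : ℕ) (b : B)
    (m : ℤ) : laurentCoeff r (fun z => z ^ j • b) m = if m = j then b else 0 := by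
  have hpi : (2 * Real.pi * Complex.I : ℂ) ≠ 0 := by simp [Real.pi_ne_zero]
  have h1 : (∮ z in C(0, r), z ^ (-m - 1) • z ^ j • b)
      = ∮ z in C(0, r), (z - 0) ^ ((j : ℤ) - m - 1) • b := by
    refine circleIntegral.integral_congr hr.le fun z hz => ?_
    have hz0 : z ≠ 0 := by
      rintro rfl
      simp at hz
      exact hr.ne hz
    rw [smul_smul, ← zpow_natCast, ← zpow_add₀ hz0, sub_zero]
    congr 2
    ring
  rw [laurentCoeff, h1, circleIntegral.integral_smul_const]
  split_ifs with h
  · subst h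
    have h2 : ∀ z : ℂ, (z - 0) ^ ((j : ℤ) - j - 1) = (z - 0)⁻¹ := fun z => by simp
    simp only [h2]
    rw [circleIntegral.integral_sub_center_inv _ hr.ne', inv_smul_smul₀ hpi]
  · rw [circleIntegral.integral_sub_zpow_of_ne (by omega), zero_smul, smul_zero]

theorem laurentCoeff_pow_smul_apply [CompleteSpace B] {r : ℝ} (hr : 0 < r) {G : ℂ → B}
    (hG : ContinuousOn G (Metric.sphere 0 r)) (j : ℕ) (L : B →L[ℂ] B) (m : ℤ) :
    laurentCoeff r (fun z => z ^ j • L (G z)) m = L (laurentCoeff r G (m - j)) := by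
  have h1 : (∮ z in C(0, r), z ^ (-m - 1) • z ^ j • L (G z))
      = ∮ z in C(0, r), L (z ^ (-(m - j) - 1) • G z) := by
    refine circleIntegral.integral_congr hr.le fun z hz => ?_
    have hz0 : z ≠ 0 := by
      rintro rfl
      simp at hz
      exact hr.ne hz
    rw [smul_smul, ← zpow_natCast, ← zpow_add₀ hz0, map_smul]
    congr 2
    ring
  rw [laurentCoeff, h1, circleIntegral_clm_comp, laurentCoeff, map_smul]
  exact (continuousOn_zpow_smul hr hG _).circleIntegrable hr.le

theorem laurentCoeff_congr {r : ℝ} (hr : 0 < r) {G H : ℂ → B}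
    (h : ∀ z ∈ Metric.sphere (0 : ℂ) r, G z = H z) (m : ℤ) :
    laurentCoeff r G m = laurentCoeff r H m := by
  rw [laurentCoeff, laurentCoeff]
  congr 1
  refine circleIntegral.integral_congr hr.le fun z hz => ?_
  rw [h z hz]

theorem laurentCoeff_add {r : ℝ} (hr : 0 < r) {G H : ℂ → B}
    (hG : ContinuousOn G (Metric.sphere 0 r)) (hH : ContinuousOn H (Metric.sphere 0 r)) (m : ℤ) :
    laurentCoeff r (fun z => G z + H z) m = laurentCoeff r G m + laurentCoeff r H m := by
  simp only [laurentCoeff, smul_add]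
  rw [circleIntegral.integral_add ((continuousOn_zpow_smul hr hG _).circleIntegrable hr.le)
    ((continuousOn_zpow_smul hr hH _).circleIntegrable hr.le), smul_add]

theorem laurentCoeff_sum {r : ℝ} (hr : 0 < r) {s : Finset ℕ} {G : ℕ → ℂ → B}
    (hG : ∀ j, ContinuousOn (G j) (Metric.sphere 0 r)) (m : ℤ) :
    laurentCoeff r (fun z => ∑ j ∈ s, G j z) m = ∑ j ∈ s, laurentCoeff r (G j) m := by
  simp only [laurentCoeff, Finset.smul_sum]
  rw [circleIntegral.integral_fun_sum fun j _ =>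
    (continuousOn_zpow_smul hr (hG j) _).circleIntegrable hr.le, Finset.smul_sum]

variable {R : ℕ → B →L[ℂ] B}

theorem renewalSeries_truncSeq (R : ℕ → B →L[ℂ] B) {k N : ℕ} (hN : k < N) (z : ℂ) :
    renewalSeries (truncSeq R k) z = ∑ j ∈ Finset.range N, z ^ j • truncSeq R k j :=
  tsum_eq_sum fun j hj => by
    rw [truncSeq_of_lt R (by simp at hj; omega), smul_zero]

theorem differentiable_regularized_truncSeq (R : ℕ → B →L[ℂ] B) (k : ℕ) (e : B) (l : B →L[ℂ] ℂ) :
    Differentiable ℂ (regularized (truncSeq R k) e l) := by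
  have h1 : renewalSeries (truncSeq R k) =
      fun z => ∑ j ∈ Finset.range (k + 1), z ^ j • truncSeq R k j :=
    funext fun z => renewalSeries_truncSeq R k.lt_succ_self z
  have h2 : renewalQuotient (truncSeq R k) =
      fun z => ∑ j ∈ Finset.range (k + 1), geomPoly j z • truncSeq R k j :=
    funext fun z => tsum_eq_sum fun j hj => by
      rw [truncSeq_of_lt R (by simpa using hj), smul_zero]
  have h3 : Differentiable ℂ (renewalSeries (truncSeq R k)) := by
    rw [h1]
    fun_prop
  have h4 : Differentiable ℂ (renewalQuotient (truncSeq R k)) := by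
    rw [h2]
    refine Differentiable.fun_sum fun j _ => ?_
    exact (differentiable_geomPoly j).smul_const _
  unfold regularized
  exact ((differentiable_const _).mul ((differentiable_const _).sub h3)).add
    ((differentiable_const _).mul h4)

/-- The polynomial `∑ V_m z ^ m` with its component along `e` divided by `1 - z`. -/
def regularizedPoly (e : B) (l : B →L[ℂ] ℂ) (V : ℕ → B) (k : ℕ) (z : ℂ) : B :=
  (1 - l.smulRight e : B →L[ℂ] B) (∑ m ∈ Finset.range k, z ^ m • V m) -
    (l.smulRight e : B →L[ℂ] B) (∑ m ∈ Finset.range k, geomPoly m z • V m)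

theorem norm_regularizedPoly_le (e : B) (l : B →L[ℂ] ℂ) {V : ℕ → B} {k : ℕ} {D : ℝ}
    (hD : ∀ m, ‖V m‖ ≤ D) {z : ℂ} {r : ℝ} (hr : 1 ≤ r) (hz : ‖z‖ ≤ r) :
    ‖regularizedPoly e l V k z‖ ≤
      (‖(1 - l.smulRight e : B →L[ℂ] B)‖ + ‖(l.smulRight e : B →L[ℂ] B)‖) *
        (k ^ 2 * r ^ k * D) := by
  have hD0 : 0 ≤ D := (norm_nonneg _).trans (hD 0)
  have key : ∀ f : ℕ → ℂ, (∀ m < k, ‖f m‖ ≤ k * r ^ k) →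
      ‖∑ m ∈ Finset.range k, f m • V m‖ ≤ k ^ 2 * r ^ k * D := by
    intro f hf
    refine (norm_sum_le _ _).trans ((Finset.sum_le_card_nsmul _ _ (k * r ^ k * D)
      fun m hm => ?_).trans_eq (by simp; ring))
    rw [norm_smul]
    exact mul_le_mul (hf m (Finset.mem_range.1 hm)) (hD m) (norm_nonneg _) (by positivity)
  rw [regularizedPoly, add_mul]
  refine (norm_sub_le _ _).trans (add_le_add ?_ ?_)
  · refine (ContinuousLinearMap.le_opNorm _ _).trans
      (mul_le_mul_of_nonneg_left (key _ fun m hm => ?_) (norm_nonneg _))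
    rw [norm_pow]
    have hk : (1 : ℝ) ≤ k := by exact_mod_cast (Nat.zero_le m).trans_lt hm
    calc ‖z‖ ^ m ≤ r ^ m := by gcongr
      _ ≤ r ^ k := pow_le_pow_right₀ hr hm.le
      _ ≤ k * r ^ k := le_mul_of_one_le_left (by positivity) hk
  · refine (ContinuousLinearMap.le_opNorm _ _).trans
      (mul_le_mul_of_nonneg_left (key _ fun m hm => ?_) (norm_nonneg _))
    refine (norm_geomPoly_le m hr hz).trans ?_
    have hmk : (m : ℝ) ≤ k := by exact_mod_cast hm.le
    have := pow_le_pow_right₀ hr hm.le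
    gcongr

/-- As the coefficients have total mean zero, `∑ z ^ m l (V m) = ∑ (z ^ m - 1) l (V m)`, which is
divisible by `1 - z`; the sign of `z ^ m - 1` is the origin of the minus in `regularizedPoly`. -/
theorem regularizedPoly_eq (e : B) {l : B →L[ℂ] ℂ} {V : ℕ → B} {k : ℕ}
    (hV : ∑ m ∈ Finset.range k, l (V m) = 0) {z : ℂ} (hz : z ≠ 1) :
    regularizedPoly e l V k z = (1 - l.smulRight e + (1 - z)⁻¹ • l.smulRight e : B →L[ℂ] B)
      (∑ m ∈ Finset.range k, z ^ m • V m) := by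
  have hz' : 1 - z ≠ 0 := sub_ne_zero.2 hz.symm
  have h : l (∑ m ∈ Finset.range k, z ^ m • V m)
      = -((1 - z) * l (∑ m ∈ Finset.range k, geomPoly m z • V m)) := by
    simp only [map_sum, map_smul, smul_eq_mul]
    rw [Finset.mul_sum, ← sub_zero (∑ m ∈ Finset.range k, z ^ m * l (V m)), ← hV,
      ← Finset.sum_sub_distrib, ← Finset.sum_neg_distrib]
    refine Finset.sum_congr rfl fun m _ => ?_
    rw [← mul_assoc, one_sub_mul_geomPoly]
    ring
  rw [regularizedPoly, add_apply, sub_eq_add_neg]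
  congr 1
  rw [smul_apply, ContinuousLinearMap.smulRight_apply, ContinuousLinearMap.smulRight_apply, h,
    neg_smul, smul_neg, smul_smul, inv_mul_cancel_left₀ hz']

variable [CompleteSpace B]

/-- The generating function of the solution is `(1 - R_k(z))⁻¹ ∑ V_m z ^ m`. Regularizing both
factors cancels the singularity at `1`, so it is holomorphic on the disc of radius `r > 1`. Its
coefficients solve the equation and obey Cauchy's estimate. -/
theorem exists_renewal_solution (hR : Summable fun n => ‖R n‖) {e : B} {l : B →L[ℂ] ℂ}
    (hl : ∀ b, l (renewalSeries R 1 b) = l b) (hle : l e = 1) {k : ℕ} {r M D : ℝ} (hr : 1 < r)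
    (hinv : ∀ z : ℂ, ‖z‖ ≤ r → IsUnit (regularized (truncSeq R k) e l z) ∧
      ‖Ring.inverse (regularized (truncSeq R k) e l z)‖ ≤ M)
    {V : ℕ → B} (hV : ∑ m ∈ Finset.range k, l (V m) = 0) (hVk : ∀ m, k ≤ m → V m = 0)
    (hD : ∀ m, ‖V m‖ ≤ D) :
    ∃ y : ℕ → B,
      (∀ n, y n = V n + ∑ j ∈ Finset.range (n + 1), truncSeq R k j (y (n - j))) ∧
      ∀ n, ‖y n‖ ≤ M * ((‖(1 - l.smulRight e : B →L[ℂ] B)‖ + ‖(l.smulRight e : B →L[ℂ] B)‖) *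
        (k ^ 2 * r ^ k * D)) * (r ^ n)⁻¹ := by
  have hr0 : 0 < r := one_pos.trans hr
  set G : ℂ → B := fun z =>
    Ring.inverse (regularized (truncSeq R k) e l z) (regularizedPoly e l V k z) with hGdef
  have hGd : ∀ z ∈ Metric.closedBall (0 : ℂ) r, DifferentiableAt ℂ G z := by
    intro z hz
    have h1 : DifferentiableAt ℂ
        (fun z => Ring.inverse (regularized (truncSeq R k) e l z)) z :=
      (differentiableAt_inverse (hinv z (mem_closedBall_zero_iff.1 hz)).1).comp z
        (differentiable_regularized_truncSeq R k e l z)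
    refine h1.clm_apply ?_
    unfold regularizedPoly
    refine DifferentiableAt.sub ?_ ?_
    · fun_prop
    · refine (ContinuousLinearMap.differentiableAt _).comp z
        (DifferentiableAt.fun_sum fun m _ => ?_)
      exact (differentiable_geomPoly m z).smul_const _
  have hGc : ContinuousOn G (Metric.sphere 0 r) := fun z hz =>
    (hGd z (Metric.sphere_subset_closedBall hz)).continuousAt.continuousWithinAt
  have hGb : ∀ z ∈ Metric.sphere (0 : ℂ) r, ‖G z‖ ≤
      M * ((‖(1 - l.smulRight e : B →L[ℂ] B)‖ + ‖(l.smulRight e : B →L[ℂ] B)‖) *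
        (k ^ 2 * r ^ k * D)) := by
    intro z hz
    have hz' : ‖z‖ ≤ r := (mem_sphere_zero_iff_norm.1 hz).le
    refine (ContinuousLinearMap.le_opNorm _ _).trans ?_
    have h1 := (hinv z hz').2
    exact mul_le_mul h1 (norm_regularizedPoly_le e l hD hr.le hz') (norm_nonneg _)
      ((norm_nonneg _).trans h1)
  have hl' : ∀ b, l (renewalSeries (truncSeq R k) 1 b) = l b := by
    intro b
    have : renewalSeries (truncSeq R k) 1 = renewalSeries R 1 := by
      rw [renewalSeries, tsum_smul_truncSeq hR]
      simp [renewalSeries]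
    rw [this, hl]
  -- On the circle `z ≠ 1`, so the regularizing factor, common to both sides and injective, can be
  -- cancelled. The cutoff `N` is free because all coefficients from `k + 1` on vanish; it is later
  -- taken large enough to include `n`.
  have hGV : ∀ N, k < N → ∀ z ∈ Metric.sphere (0 : ℂ) r,
      G z = (∑ m ∈ Finset.range N, z ^ m • V m) +
        ∑ j ∈ Finset.range N, z ^ j • truncSeq R k j (G z) := by
    intro N hN z hz
    have hz' : ‖z‖ = r := mem_sphere_zero_iff_norm.1 hz
    have hz1 : z ≠ 1 := by
      rintro rfl
      simp at hz'
      exact hr.ne hz'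
    have hs1 : Summable (truncSeq R k) := by
      simpa using summable_smul_truncSeq (R := R) (fun _ => 1) k
    have h1 : regularized (truncSeq R k) e l z (G z) = regularizedPoly e l V k z := by
      rw [hGdef]
      simp only
      rw [← mul_apply_eq_comp, Ring.mul_inverse_cancel _ (hinv z hz'.le).1, one_apply_eq_self]
    rw [regularizedPoly_eq e hV hz1,
      regularized_eq_mul hs1 (summable_smul_truncSeq _ k) hl' hz1, mul_apply_eq_comp] at h1
    have hu := isUnit_one_sub_add_smul_smulRight (e := e) hle
      (inv_ne_zero (sub_ne_zero.2 hz1.symm))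
    have h2 := ((ContinuousLinearMap.isUnit_iff_bijective).1 hu).1 h1
    rw [renewalSeries_truncSeq R hN, sub_apply, one_apply_eq_self, sub_eq_iff_eq_add] at h2
    have h3 : ∑ m ∈ Finset.range N, z ^ m • V m = ∑ m ∈ Finset.range k, z ^ m • V m := by
      refine (Finset.sum_subset (Finset.range_subset_range.2 hN.le) fun m _ hm => ?_).symm
      rw [hVk m (by simpa using hm), smul_zero]
    rw [h3]
    refine h2.trans ?_
    simp
  refine ⟨fun n => laurentCoeff r G n, fun n => ?_, fun n => ?_⟩
  · simp only
    have hN : k < n + k + 1 := by omega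
    have hc1 : ∀ m : ℕ, ContinuousOn (fun z : ℂ => z ^ m • V m) (Metric.sphere 0 r) :=
      fun m => by fun_prop
    have hc2 : ∀ j : ℕ, ContinuousOn (fun z : ℂ => z ^ j • truncSeq R k j (G z))
        (Metric.sphere 0 r) := fun j =>
      (continuousOn_id.pow j).smul ((ContinuousLinearMap.continuous _).comp_continuousOn hGc)
    rw [laurentCoeff_congr hr0 (hGV _ hN),
      laurentCoeff_add hr0 (continuousOn_finsetSum _ fun m _ => hc1 m)
        (continuousOn_finsetSum _ fun m _ => hc2 m),
      laurentCoeff_sum hr0 hc1, laurentCoeff_sum hr0 hc2]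
    congr 1
    · rw [Finset.sum_eq_single n]
      · rw [laurentCoeff_pow_smul_const hr0, if_pos rfl]
      · intro m _ hm
        rw [laurentCoeff_pow_smul_const hr0, if_neg (by exact_mod_cast hm.symm)]
      · intro h
        exact absurd (Finset.mem_range.2 (by omega)) h
    · rw [← Finset.sum_subset (Finset.range_subset_range.2 (by omega : n + 1 ≤ n + k + 1))]
      · refine Finset.sum_congr rfl fun j hj => ?_
        rw [laurentCoeff_pow_smul_apply hr0 hGc]
        congr 2
        have := Finset.mem_range.1 hj
        omega
      -- For `j > n` the shifted coefficient has negative index and vanishes by holomorphy.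
      · intro j _ hj
        rw [laurentCoeff_pow_smul_apply hr0 hGc, laurentCoeff_of_neg hr0 hGd, map_zero]
        simp at hj
        omega
  · refine (norm_laurentCoeff_le hr0 hGb n).trans_eq ?_
    rw [zpow_neg, zpow_natCast]

end Operators

/-! ### Duality for the transfer operator. -/

section Transfer

variable {Y : Type*} [MeasurableSpace Y] {μ : Measure Y}

theorem integrable_transfer (μ : Measure Y) (F : Y → Y) (f : Y → ℂ) :
    Integrable (transfer μ F f) μ :=
  ComplexMeasure.integrable_rnDeriv _ _

/-- Since `F` preserves `μ`, the image of `f dμ` is absolutely continuous, so its Radon–Nikodym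
derivative recovers it. Real and imaginary parts are treated as signed measures. -/
theorem setIntegral_transfer [IsFiniteMeasure μ] {F : Y → Y} (hF : MeasurePreserving F μ μ)
    {f : Y → ℂ} (hf : Integrable f μ) {s : Set Y} (hs : MeasurableSet s) :
    ∫ y in s, transfer μ F f y ∂μ = ∫ y in F ⁻¹' s, f y ∂μ := by
  set c : ComplexMeasure Y := (μ.withDensityᵥ f).map F with hc
  have happ : ∀ t, MeasurableSet t → c t = ∫ y in F ⁻¹' t, f y ∂μ := fun t ht => by
    rw [hc, VectorMeasure.map_apply _ hF.measurable ht,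
      withDensityᵥ_apply hf (hF.measurable ht)]
  have hac : c ≪ᵥ μ.toENNRealVectorMeasure := by
    refine VectorMeasure.AbsolutelyContinuous.mk fun t ht h0 => ?_
    rw [Measure.toENNRealVectorMeasure_apply_measurable ht] at h0
    rw [happ t ht]
    exact setIntegral_measure_zero _ ((hF.measure_preimage ht.nullMeasurableSet).trans h0)
  rw [ComplexMeasure.absolutelyContinuous_ennreal_iff] at hac
  have hre := (SignedMeasure.absolutelyContinuous_iff_withDensityᵥ_rnDeriv_eq _ μ).1 hac.1
  have him := (SignedMeasure.absolutelyContinuous_iff_withDensityᵥ_rnDeriv_eq _ μ).1 hac.2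
  have hint : Integrable (c.rnDeriv μ) μ := c.integrable_rnDeriv μ
  rw [← happ s hs]
  change ∫ y in s, c.rnDeriv μ y ∂μ = c s
  apply Complex.ext
  · have h1 := congrArg (fun m : SignedMeasure Y => m s) hre
    simp only [withDensityᵥ_apply (SignedMeasure.integrable_rnDeriv _ _) hs] at h1
    have h2 := integral_re hint.integrableOn (μ := μ.restrict s)
    exact h2.symm.trans h1
  · have h1 := congrArg (fun m : SignedMeasure Y => m s) him
    simp only [withDensityᵥ_apply (SignedMeasure.integrable_rnDeriv _ _) hs] at h1
    have h2 := integral_im hint.integrableOn (μ := μ.restrict s)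
    exact h2.symm.trans h1

theorem integrable_mul_of_bounded {f g : Y → ℂ} (hf : Integrable f μ) (hg : Measurable g) {c : ℝ}
    (hc : ∀ y, ‖g y‖ ≤ c) : Integrable (fun y => f y * g y) μ :=
  hf.mul_bdd hg.aestronglyMeasurable (ae_of_all _ hc)

/-- From indicators to simple functions by linearity, then to bounded measurable functions by
dominated convergence. -/
theorem integral_mul_eq_of_setIntegral_eq {F : Y → Y} (hF : Measurable F) {f h : Y → ℂ}
    (hf : Integrable f μ) (hh : Integrable h μ)
    (hfh : ∀ s, MeasurableSet s → ∫ y in s, h y ∂μ = ∫ y in F ⁻¹' s, f y ∂μ)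
    {g : Y → ℂ} (hg : Measurable g) {c : ℝ} (hc : ∀ y, ‖g y‖ ≤ c) :
    ∫ y, h y * g y ∂μ = ∫ y, f y * g (F y) ∂μ := by
  have hsimple : ∀ g : SimpleFunc Y ℂ, ∫ y, h y * g y ∂μ = ∫ y, f y * g (F y) ∂μ := by
    intro g
    induction g using SimpleFunc.induction with
    | const a hs =>
      rename_i s
      have h1 : ∀ y, h y * (SimpleFunc.piecewise s hs (SimpleFunc.const Y a)
          (SimpleFunc.const Y 0)) y = s.indicator (fun y => h y * a) y := fun y => by
        by_cases hy : y ∈ s <;> simp [hy]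
      have h2 : ∀ y, f y * (SimpleFunc.piecewise s hs (SimpleFunc.const Y a)
          (SimpleFunc.const Y 0)) (F y) = (F ⁻¹' s).indicator (fun y => f y * a) y := fun y => by
        by_cases hy : F y ∈ s <;> simp [hy]
      rw [integral_congr_ae (ae_of_all _ h1), integral_congr_ae (ae_of_all _ h2),
        integral_indicator hs, integral_indicator (hF hs), integral_mul_const,
        integral_mul_const, hfh s hs]
    | add hdisj h1 h2 =>
      rename_i g1 g2
      obtain ⟨c1, hc1⟩ := g1.exists_forall_norm_le
      obtain ⟨c2, hc2⟩ := g2.exists_forall_norm_le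
      simp only [SimpleFunc.coe_add, Pi.add_apply, mul_add]
      have h3 : Integrable (fun y => f y * g1 (F y)) μ :=
        integrable_mul_of_bounded hf (g1.measurable.comp hF) fun y => hc1 (F y)
      have h4 : Integrable (fun y => f y * g2 (F y)) μ :=
        integrable_mul_of_bounded hf (g2.measurable.comp hF) fun y => hc2 (F y)
      rw [integral_add (integrable_mul_of_bounded hh g1.measurable hc1)
        (integrable_mul_of_bounded hh g2.measurable hc2), h1, h2, ← integral_add h3 h4]
  have hgs := hg.stronglyMeasurable
  by_cases hY : Nonempty Y
  swap
  · rw [not_nonempty_iff] at hY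
    simp [Measure.eq_zero_of_isEmpty μ]
  have hc0 : 0 ≤ c := (norm_nonneg _).trans (hc hY.some)
  have hlim : ∀ (f' : Y → ℂ) (G : Y → Y), Integrable f' μ → Measurable G →
      Tendsto (fun n => ∫ y, f' y * hgs.approxBounded c n (G y) ∂μ) atTop
        (𝓝 (∫ y, f' y * g (G y) ∂μ)) := by
    intro f' G hf' hG
    refine tendsto_integral_of_dominated_convergence (fun y => ‖f' y‖ * c) (fun n => ?_)
      (hf'.norm.mul_const c) (fun n => ae_of_all _ fun y => ?_) (ae_of_all _ fun y => ?_)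
    · exact hf'.aestronglyMeasurable.mul
        ((hgs.approxBounded c n).measurable.comp hG).aestronglyMeasurable
    · rw [norm_mul]
      gcongr
      exact hgs.norm_approxBounded_le hc0 n _
    · exact (hgs.tendsto_approxBounded_of_norm_le (hc (G y))).const_mul _
  refine tendsto_nhds_unique (hlim h id hh measurable_id) ?_
  simpa only [id, hsimple] using hlim f F hf hF

end Transfer

/-! ### Integration against bounded functions as continuous functionals on `B`. -/

namespace FunctionSpace

variable {Y : Type*} [MeasurableSpace Y] {μ : Measure Y}
  {B : Type*} [NormedAddCommGroup B] [NormedSpace ℂ B] (ι : FunctionSpace μ B)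

theorem integrable_toL1 (b : B) : Integrable (ι.toL1 b) μ := L1.integrable_coeFn _

/-- The continuous functional `b ↦ ∫ b g dμ` for a bounded measurable function `g`. -/
def pairing {g : Y → ℂ} (hg : Measurable g) {c : ℝ} (hc : ∀ y, ‖g y‖ ≤ c) : B →L[ℂ] ℂ :=
  LinearMap.mkContinuous
    { toFun := fun b => ∫ y, ι.toL1 b y * g y ∂μ
      map_add' := fun a b => by
        rw [← integral_add (integrable_mul_of_bounded (ι.integrable_toL1 a) hg hc)
          (integrable_mul_of_bounded (ι.integrable_toL1 b) hg hc), map_add]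
        refine integral_congr_ae ?_
        filter_upwards [Lp.coeFn_add (ι.toL1 a) (ι.toL1 b)] with y hy
        rw [hy, Pi.add_apply, add_mul]
      map_smul' := fun a b => by
        rw [RingHom.id_apply, smul_eq_mul, ← integral_const_mul, map_smul]
        refine integral_congr_ae ?_
        filter_upwards [Lp.coeFn_smul a (ι.toL1 b)] with y hy
        rw [hy, Pi.smul_apply, smul_eq_mul, mul_assoc] } c fun b => by
    by_cases hY : Nonempty Y
    swap
    · rw [not_nonempty_iff] at hY
      have hb : b = 0 := ι.injective
        (Lp.ext (Filter.Eventually.of_forall fun y => isEmptyElim y))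
      simp [hb, Measure.eq_zero_of_isEmpty μ]
    have hc0 : 0 ≤ c := (norm_nonneg _).trans (hc hY.some)
    calc ‖∫ y, ι.toL1 b y * g y ∂μ‖ ≤ ∫ y, c * ‖ι.toL1 b y‖ ∂μ := by
          refine norm_integral_le_of_norm_le ((ι.integrable_toL1 b).norm.const_mul c)
            (ae_of_all _ fun y => ?_)
          rw [norm_mul, mul_comm]
          gcongr
          exact hc y
      _ = c * ‖ι.toL1 b‖ := by rw [integral_const_mul, ← L1.norm_eq_integral_norm]
      _ ≤ c * ‖b‖ := by
          gcongr
          exact ι.norm_toL1_le b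

theorem pairing_apply {g : Y → ℂ} (hg : Measurable g) {c : ℝ} (hc : ∀ y, ‖g y‖ ≤ c) (b : B) :
    ι.pairing hg hc b = ∫ y, ι.toL1 b y * g y ∂μ := rfl

theorem norm_setIntegral_mul_le (b : B) {g : Y → ℂ} {c : ℝ} (hc0 : 0 ≤ c) (hc : ∀ y, ‖g y‖ ≤ c)
    (s : Set Y) : ‖∫ y in s, ι.toL1 b y * g y ∂μ‖ ≤ c * ‖b‖ := by
  calc ‖∫ y in s, ι.toL1 b y * g y ∂μ‖ ≤ ∫ y in s, c * ‖ι.toL1 b y‖ ∂μ := by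
        refine norm_integral_le_of_norm_le ((ι.integrable_toL1 b).norm.const_mul c).integrableOn
          (ae_of_all _ fun y => ?_)
        rw [norm_mul, mul_comm]
        gcongr
        exact hc y
    _ ≤ ∫ y, c * ‖ι.toL1 b y‖ ∂μ :=
        setIntegral_le_integral ((ι.integrable_toL1 b).norm.const_mul c)
          (ae_of_all _ fun y => by positivity)
    _ = c * ‖ι.toL1 b‖ := by rw [integral_const_mul, ← L1.norm_eq_integral_norm]
    _ ≤ c * ‖b‖ := by
        gcongr
        exact ι.norm_toL1_le b

/-- The functional `b ↦ ∫ b dμ`. -/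
def mean : B →L[ℂ] ℂ := ι.pairing (g := fun _ => 1) (c := 1) measurable_const (by simp)

theorem mean_apply (b : B) : ι.mean b = ∫ y, ι.toL1 b y ∂μ := by
  simp [mean, pairing_apply]

end FunctionSpace

/-! ### Eigenvectors of `R(1)` and the mean return time. -/

namespace InducingScheme

variable {X : Type*} [MeasurableSpace X] (S : InducingScheme X)

instance instIsProbabilityMeasure : IsProbabilityMeasure S.μ := S.isProbabilityMeasure

theorem measurePreserving_F : MeasurePreserving S.F S.μ S.μ := S.ergodic.toMeasurePreserving

theorem measurableSet_φ (A : Set ℕ) : MeasurableSet {y | S.φ y ∈ A} :=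
  S.measurable_φ MeasurableSet.of_discrete

variable {S}
variable {B : Type*} [NormedAddCommGroup B] [NormedSpace ℂ B] {ι : FunctionSpace S.μ B}
  {R : ℕ → B →L[ℂ] B}

theorem IsRenewalSequence.integral_mul (hR : S.IsRenewalSequence ι R) (n : ℕ) (b : B) {g : S.Y → ℂ}
    (hg : Measurable g) {c : ℝ} (hc : ∀ y, ‖g y‖ ≤ c) :
    ∫ y, ι.toL1 (R n b) y * g y ∂S.μ = ∫ y in {y | S.φ y = n}, ι.toL1 b y * g (S.F y) ∂S.μ := by
  have hs : MeasurableSet {y | S.φ y = n} := S.measurableSet_φ {n}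
  have hi := (ι.integrable_toL1 b).indicator hs
  have h1 : ∫ y, ι.toL1 (R n b) y * g y ∂S.μ =
      ∫ y, transfer S.μ S.F ({y | S.φ y = n}.indicator (ι.toL1 b)) y * g y ∂S.μ := by
    refine integral_congr_ae ?_
    filter_upwards [hR n b] with y hy
    rw [hy]
  rw [h1, integral_mul_eq_of_setIntegral_eq S.measurePreserving_F.measurable hi
    (integrable_transfer _ _ _) (fun s hs' => setIntegral_transfer S.measurePreserving_F hi hs')
    hg hc, ← integral_indicator hs]
  congr 1
  ext y
  by_cases hy : S.φ y = n <;> simp [hy]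

theorem IsRenewalSequence.apply_zero (hR : S.IsRenewalSequence ι R) : R 0 = 0 := by
  ext b
  apply ι.injective
  rw [zero_apply, map_zero]
  refine Lp.ext ?_
  refine Integrable.ae_eq_of_forall_setIntegral_eq _ _ (ι.integrable_toL1 _)
    (L1.integrable_coeFn _) fun s hs _ => ?_
  have h0 : {y | S.φ y = 0} = ∅ := by
    ext y
    have := S.one_le_φ y
    simp only [mem_ofPred_eq, mem_empty_iff_false, iff_false]
    omega
  have h := hR.integral_mul 0 b (g := s.indicator fun _ => 1) (c := 1)
    (measurable_const.indicator hs) fun y => by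
      by_cases hy : y ∈ s <;> simp [hy]
  have h1 : ∀ y, ι.toL1 (R 0 b) y * s.indicator (fun _ => 1) y
      = s.indicator (ι.toL1 (R 0 b)) y := fun y => by
    by_cases hy : y ∈ s <;> simp [hy]
  simp only [h1] at h
  rw [integral_indicator hs, h0, Measure.restrict_empty, integral_zero_measure] at h
  rw [h]
  refine (setIntegral_eq_zero_of_ae_eq_zero ?_).symm
  filter_upwards [Lp.coeFn_zero ℂ 1 S.μ] with y hy _
  rw [hy, Pi.zero_apply]

theorem opSum_univ (R : ℕ → B →L[ℂ] B) : opSum R univ = renewalSeries R 1 := by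
  simp [opSum, renewalSeries]

variable [CompleteSpace B]

/-- The defining relation of each `R n` is an identity in `L¹`; tested against `g` it becomes
numerical, and countable additivity over the sets `{φ = n}` sums it. -/
theorem IsRenewalSequence.integral_opSum_mul (hR : S.IsRenewalSequence ι R)
    (hs : Summable fun n => ‖R n‖) (A : Set ℕ) (b : B) {g : S.Y → ℂ}
    (hg : Measurable g) {c : ℝ} (hc : ∀ y, ‖g y‖ ≤ c) :
    ∫ y, ι.toL1 (opSum R A b) y * g y ∂S.μ
      = ∫ y in {y | S.φ y ∈ A}, ι.toL1 b y * g (S.F y) ∂S.μ := by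
  have h1 := ((hasSum_opSum hs A).mapL (ContinuousLinearMap.apply ℂ B b)).mapL (ι.pairing hg hc)
  have h2 : ∀ n, ι.pairing hg hc (ContinuousLinearMap.apply ℂ B b (A.indicator R n))
      = ∫ y in {y | S.φ y = n ∧ n ∈ A}, ι.toL1 b y * g (S.F y) ∂S.μ := by
    intro n
    by_cases hn : n ∈ A
    · simp only [indicator_of_mem hn, hn, and_true]
      exact hR.integral_mul n b hg hc
    · simp [hn]
  simp only [h2] at h1
  have h3 : {y | S.φ y ∈ A} = ⋃ n, {y | S.φ y = n ∧ n ∈ A} := by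
    ext y
    simp
  have h4 : HasSum (fun n => ∫ y in {y | S.φ y = n ∧ n ∈ A}, ι.toL1 b y * g (S.F y) ∂S.μ)
      (∫ y in {y | S.φ y ∈ A}, ι.toL1 b y * g (S.F y) ∂S.μ) := by
    rw [h3]
    refine hasSum_integral_iUnion (fun n => ?_) (fun m n hmn => ?_) ?_
    · exact S.measurableSet_φ {m | m = n ∧ n ∈ A}
    · rw [Function.onFun, Set.disjoint_left]
      rintro y ⟨h, -⟩ ⟨h', -⟩
      exact hmn (h.symm.trans h')
    · exact (integrable_mul_of_bounded (ι.integrable_toL1 b)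
        (hg.comp S.measurePreserving_F.measurable) fun y => hc _).integrableOn
  exact h1.unique h4

theorem IsRenewalSequence.mean_opSum (hR : S.IsRenewalSequence ι R)
    (hs : Summable fun n => ‖R n‖) (A : Set ℕ) (b : B) :
    ι.mean (opSum R A b) = ∫ y in {y | S.φ y ∈ A}, ι.toL1 b y ∂S.μ := by
  have := hR.integral_opSum_mul hs A b (g := fun _ => 1) (c := 1) measurable_const (by simp)
  simpa [ι.mean_apply] using this

theorem IsRenewalSequence.mean_renewalSeries_one (hR : S.IsRenewalSequence ι R)
    (hs : Summable fun n => ‖R n‖) (b : B) : ι.mean (renewalSeries R 1 b) = ι.mean b := by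
  rw [← opSum_univ, hR.mean_opSum hs, ι.mean_apply]
  simp

/-- Tested on a set `s`, the claim is `μ(F⁻¹ s) = μ(s)`. Equality holds first in `L¹` and passes to
`B` by injectivity. -/
theorem IsRenewalSequence.renewalSeries_one_const (hR : S.IsRenewalSequence ι R)
    (hs : Summable fun n => ‖R n‖) {e : B} (he : ι.toL1 e =ᵐ[S.μ] fun _ => 1) :
    renewalSeries R 1 e = e := by
  apply ι.injective
  refine Lp.ext ?_
  refine Integrable.ae_eq_of_forall_setIntegral_eq _ _ (ι.integrable_toL1 _)
    (ι.integrable_toL1 _) fun s hsm _ => ?_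
  have h := hR.integral_opSum_mul hs univ e (g := s.indicator fun _ => 1) (c := 1)
    (measurable_const.indicator hsm) fun y => by
      by_cases hy : y ∈ s <;> simp [hy]
  rw [opSum_univ] at h
  have h1 : ∀ y, ι.toL1 (renewalSeries R 1 e) y * s.indicator (fun _ => 1) y
      = s.indicator (ι.toL1 (renewalSeries R 1 e)) y := fun y => by
    by_cases hy : y ∈ s <;> simp [hy]
  simp only [h1, mem_univ, ofPred_true, Measure.restrict_univ] at h
  rw [integral_indicator hsm] at h
  rw [h]
  have h2 : ∫ y, ι.toL1 e y * s.indicator (fun _ => 1) (S.F y) ∂S.μ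
      = ∫ y, s.indicator (fun _ => (1 : ℂ)) (S.F y) ∂S.μ := by
    refine integral_congr_ae ?_
    filter_upwards [he] with y hy
    rw [hy, one_mul]
  have h3 : ∫ y in s, ι.toL1 e y ∂S.μ = ∫ y in s, (1 : ℂ) ∂S.μ :=
    setIntegral_congr_ae hsm (by filter_upwards [he] with y hy _ using hy)
  have h4 : ∀ y, s.indicator (fun _ => (1 : ℂ)) (S.F y)
      = (S.F ⁻¹' s).indicator (fun _ => (1 : ℂ)) y := fun y => rfl
  rw [h2, h3]
  simp only [h4]
  rw [integral_indicator (S.measurePreserving_F.measurable hsm), setIntegral_const,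
    setIntegral_const, S.measurePreserving_F.measureReal_preimage hsm.nullMeasurableSet]

/-- The number is `∑ n μ(φ = n)`, the mean return time. If it vanished, every `{φ = n}` with `n ≥ 1`
would be null, contradicting `φ ≥ 1` and `μ(Y) = 1`. -/
theorem IsRenewalSequence.mean_renewalQuotient_ne_zero (hR : S.IsRenewalSequence ι R)
    (hs : Summable fun n => ‖R n‖) (hs' : Summable fun n : ℕ => (n : ℝ) * ‖R n‖)
    {e : B} (he : ι.toL1 e =ᵐ[S.μ] fun _ => 1) :
    ι.mean (renewalQuotient R 1 e) ≠ 0 := by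
  have hterm : ∀ n, ι.mean (R n e) = S.μ.real {y | S.φ y = n} := by
    intro n
    have h1 := hR.mean_opSum hs {n} e
    rw [opSum_singleton] at h1
    have hsm : MeasurableSet {y | S.φ y = n} := S.measurableSet_φ {n}
    have h2 : ∫ y in {y | S.φ y = n}, ι.toL1 e y ∂S.μ = ∫ y in {y | S.φ y = n}, (1 : ℂ) ∂S.μ :=
      setIntegral_congr_ae hsm (by filter_upwards [he] with y hy _ using hy)
    rw [h1]
    simp only [mem_singleton_iff]
    rw [h2, setIntegral_const]
    simp
  have hsum : Summable fun n : ℕ => geomPoly n 1 • R n := by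
    refine Summable.of_norm ?_
    simpa [geomPoly_one, norm_smul] using hs'
  have h1 : HasSum (fun n : ℕ => ι.mean ((geomPoly n 1 • R n) e))
      (ι.mean (renewalQuotient R 1 e)) :=
    (hsum.hasSum.mapL (ContinuousLinearMap.apply ℂ B e)).mapL ι.mean
  simp only [smul_apply, map_smul, hterm, geomPoly_one, smul_eq_mul] at h1
  intro h0
  rw [h0] at h1
  have h2 : HasSum (fun n : ℕ => (n : ℝ) * S.μ.real {y | S.φ y = n}) 0 := by
    have := Complex.hasSum_re h1
    simpa using this
  have h3 := (hasSum_zero_iff_of_nonneg (fun n => by positivity)).1 h2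
  have h4 : ∀ n, S.μ {y | S.φ y = n} = 0 := by
    intro n
    rcases Nat.eq_zero_or_pos n with rfl | hn
    · have : {y | S.φ y = 0} = ∅ := by
        ext y
        have := S.one_le_φ y
        simp only [mem_ofPred_eq, mem_empty_iff_false, iff_false]
        omega
      rw [this, measure_empty]
    · have h5 := congrFun h3 n
      have hn' : (n : ℝ) ≠ 0 := by positivity
      simp only [Pi.zero_apply, mul_eq_zero, hn', false_or] at h5
      exact (measureReal_eq_zero_iff).1 h5
  have h5 : (univ : Set S.Y) = ⋃ n, {y | S.φ y = n} := by
    ext y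
    simp
  have h6 : S.μ univ = 0 := by
    rw [h5]
    exact measure_iUnion_null h4
  simp at h6

end InducingScheme

/-! ### Dynamics on the truncated tower and the renewal sequence on its base. -/

namespace InducingScheme

variable {X : Type*} [MeasurableSpace X] (S : InducingScheme X)

/-- Composition of a function on the tower `{(y, ℓ) : ℓ < min (φ y) k}` with the tower map, which
goes one level up, or from the top level over `y` to the base point `F y`. -/
def towerShift {E : Type*} (k : ℕ) (w : ℕ → S.Y → E) : ℕ → S.Y → E := fun b y =>
  if b + 1 < min (S.φ y) k then w (b + 1) y else w 0 (S.F y)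

theorem measurableSet_min_φ (k : ℕ) (A : Set ℕ) : MeasurableSet {y | min (S.φ y) k ∈ A} :=
  S.measurableSet_φ {n | min n k ∈ A}

theorem measurableSet_lt_min_φ (k b : ℕ) : MeasurableSet {y | b < min (S.φ y) k} :=
  S.measurableSet_min_φ k {n | b < n}

theorem measurable_towerShift {E : Type*} [MeasurableSpace E] (k : ℕ) {w : ℕ → S.Y → E}
    (hw : ∀ b, Measurable (w b)) (b : ℕ) : Measurable (S.towerShift k w b) :=
  Measurable.ite (S.measurableSet_lt_min_φ k (b + 1)) (hw _)
    ((hw 0).comp S.measurePreserving_F.measurable)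

theorem towerShift_mem {E : Type*} (k : ℕ) {w : ℕ → S.Y → E} {p : E → Prop}
    (hw : ∀ b y, p (w b y)) (b : ℕ) (y : S.Y) : p (S.towerShift k w b y) := by
  unfold towerShift
  split_ifs
  · exact hw _ _
  · exact hw _ _

theorem measurable_iterate_towerShift {E : Type*} [MeasurableSpace E] (k : ℕ) {w : ℕ → S.Y → E}
    (hw : ∀ b, Measurable (w b)) (n b : ℕ) : Measurable ((S.towerShift k)^[n] w b) := by
  induction n generalizing w with
  | zero => exact hw b
  | succ n ih => exact ih (S.measurable_towerShift k hw)

theorem iterate_towerShift_mem {E : Type*} (k : ℕ) {w : ℕ → S.Y → E} {p : E → Prop}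
    (hw : ∀ b y, p (w b y)) (n b : ℕ) (y : S.Y) : p ((S.towerShift k)^[n] w b y) := by
  induction n generalizing w with
  | zero => exact hw b y
  | succ n ih => exact ih (S.towerShift_mem k hw)

theorem setIntegral_mul_towerShift (k b : ℕ) {f : S.Y → ℂ} (hf : Integrable f S.μ)
    {w : ℕ → S.Y → ℂ} (hw : ∀ b, Measurable (w b)) {c : ℝ} (hc : ∀ b y, ‖w b y‖ ≤ c) :
    ∫ y in {y | b < min (S.φ y) k}, f y * S.towerShift k w b y ∂S.μ =
      (∫ y in {y | b + 1 < min (S.φ y) k}, f y * w (b + 1) y ∂S.μ) +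
        ∫ y in {y | min (S.φ y) k = b + 1}, f y * w 0 (S.F y) ∂S.μ := by
  have hm1 := S.measurableSet_lt_min_φ k (b + 1)
  have hm2 : MeasurableSet {y | min (S.φ y) k = b + 1} := S.measurableSet_min_φ k {b + 1}
  have hint : Integrable (fun y => f y * S.towerShift k w b y) S.μ :=
    integrable_mul_of_bounded hf (S.measurable_towerShift k hw b)
      (S.towerShift_mem k (p := fun x => ‖x‖ ≤ c) hc b)
  have h1 : {y | b < min (S.φ y) k} =
      {y | b + 1 < min (S.φ y) k} ∪ {y | min (S.φ y) k = b + 1} := by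
    ext y
    simp only [mem_ofPred_eq, mem_union]
    omega
  rw [h1, setIntegral_union _ hm2 hint.integrableOn hint.integrableOn]
  · congr 1
    · refine setIntegral_congr_fun hm1 fun y hy => ?_
      simp only [mem_ofPred_eq] at hy
      simp only [towerShift, if_pos hy]
    · refine setIntegral_congr_fun hm2 fun y hy => ?_
      simp only [mem_ofPred_eq] at hy
      simp only [towerShift, hy, lt_irrefl, if_false]
  · rw [Set.disjoint_left]
    intro y hy hy'
    simp only [mem_ofPred_eq] at hy hy'
    omega

variable {S}
variable {B : Type*} [NormedAddCommGroup B] [NormedSpace ℂ B] [CompleteSpace B]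
  {ι : FunctionSpace S.μ B} {R : ℕ → B →L[ℂ] B}

theorem IsRenewalSequence.integral_truncSeq_mul (hR : S.IsRenewalSequence ι R)
    (hs : Summable fun n => ‖R n‖) (k j : ℕ) (b : B) {g : S.Y → ℂ}
    (hg : Measurable g) {c : ℝ} (hc : ∀ y, ‖g y‖ ≤ c) :
    ∫ y, ι.toL1 (truncSeq R k j b) y * g y ∂S.μ
      = ∫ y in {y | min (S.φ y) k = j}, ι.toL1 b y * g (S.F y) ∂S.μ :=
  hR.integral_opSum_mul hs _ b hg hc

/-- These are the points starting at a level `l ≥ 1` that reach the base at time `n + 1` exactly;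
their level is determined by the column height, `l = min φ k - (n + 1)`. -/
theorem sum_setIntegral_mul_top (k n : ℕ) {v : ℕ → S.Y → ℂ}
    (hv : ∀ l, Integrable (v l) S.μ) {g : S.Y → ℂ} (hg : Measurable g) {c : ℝ}
    (hc : ∀ y, ‖g y‖ ≤ c) :
    ∑ l ∈ Finset.Ico 1 k, ∫ y in {y | min (S.φ y) k = l + n + 1}, v l y * g (S.F y) ∂S.μ =
      ∫ y in {y | n + 1 < min (S.φ y) k}, v (min (S.φ y) k - (n + 1)) y * g (S.F y) ∂S.μ := by
  have hm : ∀ l, MeasurableSet {y | min (S.φ y) k = l + n + 1} := fun l =>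
    S.measurableSet_min_φ k {l + n + 1}
  have h1 : {y | n + 1 < min (S.φ y) k}
      = ⋃ l ∈ Finset.Ico 1 k, {y | min (S.φ y) k = l + n + 1} := by
    ext y
    simp only [mem_ofPred_eq, mem_iUnion, Finset.mem_Ico, exists_prop]
    constructor
    · intro h
      exact ⟨min (S.φ y) k - (n + 1), by omega, by omega⟩
    · rintro ⟨l, hl, h⟩
      omega
  have hcongr : ∀ l, EqOn (fun y => v l y * g (S.F y))
      (fun y => v (min (S.φ y) k - (n + 1)) y * g (S.F y))
      {y | min (S.φ y) k = l + n + 1} := fun l y hy => by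
    simp only [mem_ofPred_eq] at hy
    simp only [hy]
    rw [show l + n + 1 - (n + 1) = l by omega]
  rw [h1, integral_biUnion_finset _ fun l _ => hm l]
  · exact Finset.sum_congr rfl fun l _ => setIntegral_congr_fun (hm l) (hcongr l)
  · intro l _ l' _ hll
    rw [Function.onFun, Set.disjoint_left]
    intro y hy hy'
    simp only [mem_ofPred_eq] at hy hy'
    omega
  · intro l _
    have : Integrable (fun y => v l y * g (S.F y)) S.μ := integrable_mul_of_bounded (hv l)
      (hg.comp S.measurePreserving_F.measurable) fun y => hc _
    exact this.integrableOn.congr_fun (hcongr l) (hm l)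

/-- Correlations on the truncated tower in terms of the renewal sequence on the base. -/
theorem IsRenewalSequence.tower_correlation (hR : S.IsRenewalSequence ι R)
    (hs : Summable fun n => ‖R n‖) {k : ℕ} (hk : 1 ≤ k) {v : ℕ → S.Y → ℂ}
    (hv : ∀ l, Integrable (v l) S.μ) {V x : ℕ → B}
    (hV0 : ∀ (g : S.Y → ℂ) (c : ℝ), Measurable g → (∀ y, ‖g y‖ ≤ c) →
      ∫ y, ι.toL1 (V 0) y * g y ∂S.μ = ∫ y, v 0 y * g y ∂S.μ)
    (hV : ∀ m, 1 ≤ m → ∀ (g : S.Y → ℂ) (c : ℝ), Measurable g → (∀ y, ‖g y‖ ≤ c) →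
      ∫ y, ι.toL1 (V m) y * g y ∂S.μ =
        ∫ y in {y | m < min (S.φ y) k}, v (min (S.φ y) k - m) y * g (S.F y) ∂S.μ)
    (hx : ∀ n, x n = V n + ∑ j ∈ Finset.range (n + 1), truncSeq R k j (x (n - j))) (n : ℕ)
    {w : ℕ → S.Y → ℂ} (hw : ∀ b, Measurable (w b)) {c : ℝ} (hc : ∀ b y, ‖w b y‖ ≤ c) :
    ∑ l ∈ Finset.range k, ∫ y in {y | l < min (S.φ y) k}, v l y * (S.towerShift k)^[n] w l y ∂S.μ =
      (∑ l ∈ Finset.Ico 1 k, ∫ y in {y | l + n < min (S.φ y) k}, v l y * w (l + n) y ∂S.μ) +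
        ∑ b ∈ Finset.range (n + 1),
          ∫ y in {y | b < min (S.φ y) k}, ι.toL1 (x (n - b)) y * w b y ∂S.μ := by
  have h0 : truncSeq R k 0 = 0 := truncSeq_zero R hR.apply_zero hk
  have huniv : {y : S.Y | 0 < min (S.φ y) k} = univ := by
    ext y
    have := S.one_le_φ y
    simp only [mem_ofPred_eq, mem_univ, iff_true]
    omega
  -- On the right-hand side, the first sum is the mass still in its initial excursion; in the
  -- second, `x (n - b)` is the density that was on the base at time `n - b` and now sits at level
  -- `b`. One more step moves each level up and collects all the tops on the base, which is the
  -- renewal equation for `x (n + 1)`.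
  induction n generalizing w with
  | zero =>
    have hx0 : x 0 = V 0 := by simpa [h0] using hx 0
    simp only [Function.iterate_zero, id, add_zero, zero_add, Finset.range_one,
      Finset.sum_singleton, huniv, Measure.restrict_univ, Nat.sub_zero, hx0, hV0 _ c (hw 0) (hc 0)]
    rw [Finset.range_eq_Ico, Finset.sum_eq_sum_Ico_succ_bot hk, huniv, Measure.restrict_univ,
      add_comm]
  | succ n ih =>
    have hsplit : ∀ l, ∫ y in {y | l + n < min (S.φ y) k}, v l y * S.towerShift k w (l + n) y ∂S.μ =
        (∫ y in {y | l + (n + 1) < min (S.φ y) k}, v l y * w (l + (n + 1)) y ∂S.μ) +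
        ∫ y in {y | min (S.φ y) k = l + n + 1}, v l y * w 0 (S.F y) ∂S.μ := fun l =>
      S.setIntegral_mul_towerShift k (l + n) (hv l) hw hc
    have hsplit' : ∀ b, ∫ y in {y | b < min (S.φ y) k},
          ι.toL1 (x (n - b)) y * S.towerShift k w b y ∂S.μ =
        (∫ y in {y | b + 1 < min (S.φ y) k}, ι.toL1 (x (n - b)) y * w (b + 1) y ∂S.μ) +
          ι.pairing (hw 0) (hc 0) (truncSeq R k (b + 1) (x (n - b))) := fun b => by
      rw [S.setIntegral_mul_towerShift k b (ι.integrable_toL1 _) hw hc, ι.pairing_apply,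
        hR.integral_truncSeq_mul hs k (b + 1) _ (hw 0) (hc 0)]
    have hxn : x (n + 1) = V (n + 1) +
        ∑ j ∈ Finset.range (n + 1), truncSeq R k (j + 1) (x (n - j)) := by
      rw [hx (n + 1), Finset.sum_range_succ']
      simp [h0]
    rw [Function.iterate_succ_apply, ih (S.measurable_towerShift k hw)
      (S.towerShift_mem k (p := fun x => ‖x‖ ≤ c) hc)]
    simp only [hsplit, hsplit']
    rw [Finset.sum_add_distrib, Finset.sum_add_distrib, sum_setIntegral_mul_top k n hv (hw 0) (hc 0),
      ← hV (n + 1) (by omega) _ c (hw 0) (hc 0), Finset.sum_range_succ' _ (n + 1), huniv,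
      Measure.restrict_univ, Nat.sub_zero, ← map_sum, ← ι.pairing_apply (hw 0) (hc 0),
      ← ι.pairing_apply (hw 0) (hc 0), hxn, map_add]
    simp only [Nat.add_sub_add_right]
    ring

/-- For `n ≥ k` every initial excursion has ended, and only the levels `b < k` carry mass. -/
theorem IsRenewalSequence.norm_tower_correlation_le (hR : S.IsRenewalSequence ι R)
    (hs : Summable fun n => ‖R n‖) {k : ℕ} (hk : 1 ≤ k) {v : ℕ → S.Y → ℂ}
    (hv : ∀ l, Integrable (v l) S.μ) {V x : ℕ → B}
    (hV0 : ∀ (g : S.Y → ℂ) (c : ℝ), Measurable g → (∀ y, ‖g y‖ ≤ c) →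
      ∫ y, ι.toL1 (V 0) y * g y ∂S.μ = ∫ y, v 0 y * g y ∂S.μ)
    (hV : ∀ m, 1 ≤ m → ∀ (g : S.Y → ℂ) (c : ℝ), Measurable g → (∀ y, ‖g y‖ ≤ c) →
      ∫ y, ι.toL1 (V m) y * g y ∂S.μ =
        ∫ y in {y | m < min (S.φ y) k}, v (min (S.φ y) k - m) y * g (S.F y) ∂S.μ)
    (hx : ∀ n, x n = V n + ∑ j ∈ Finset.range (n + 1), truncSeq R k j (x (n - j))) {n : ℕ}
    (hkn : k ≤ n) {w : ℕ → S.Y → ℂ} (hw : ∀ b, Measurable (w b)) {c : ℝ} (hc0 : 0 ≤ c)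
    (hc : ∀ b y, ‖w b y‖ ≤ c) {D : ℝ} (hD : ∀ b, b < k → ‖x (n - b)‖ ≤ D) :
    ‖∑ l ∈ Finset.range k,
      ∫ y in {y | l < min (S.φ y) k}, v l y * (S.towerShift k)^[n] w l y ∂S.μ‖ ≤ k * (c * D) := by
  have hempty : ∀ b, k ≤ b → {y : S.Y | b < min (S.φ y) k} = ∅ := fun b hb => by
    ext y
    simp only [mem_ofPred_eq, mem_empty_iff_false, iff_false]
    omega
  rw [hR.tower_correlation hs hk hv hV0 hV hx n hw hc, Finset.sum_eq_zero fun l _ => by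
      rw [hempty _ (by omega), Measure.restrict_empty, integral_zero_measure], zero_add,
    ← Finset.sum_subset (Finset.range_subset_range.2 (by omega : k ≤ n + 1)) fun b _ hb => by
      rw [hempty b (by simpa using hb), Measure.restrict_empty, integral_zero_measure]]
  refine (norm_sum_le _ _).trans
    ((Finset.sum_le_card_nsmul _ _ (c * D) fun b hb => ?_).trans_eq (by simp))
  refine (ι.norm_setIntegral_mul_le _ hc0 (hc b) _).trans ?_
  gcongr
  exact hD b (Finset.mem_range.1 hb)

end InducingScheme

/-! ### The source term and decay of correlations on the truncated tower. -/

namespace InducingScheme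

variable {X : Type*} [MeasurableSpace X] (S : InducingScheme X)

theorem sum_setIntegral_lt_eq {E : Type*} [NormedAddCommGroup E] [NormedSpace ℝ E] (k : ℕ)
    {f : ℕ → S.Y → E} (hf : ∀ l, Integrable (f l) S.μ) :
    ∑ l ∈ Finset.range k, ∫ y in {y | l < min (S.φ y) k}, f l y ∂S.μ =
      ∫ y, ∑ l ∈ Finset.range (min (S.φ y) k), f l y ∂S.μ := by
  have h1 : ∀ l, ∫ y in {y | l < min (S.φ y) k}, f l y ∂S.μ =
      ∫ y, {y | l < min (S.φ y) k}.indicator (f l) y ∂S.μ := fun l =>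
    (integral_indicator (S.measurableSet_lt_min_φ k l)).symm
  simp only [h1]
  rw [← integral_finsetSum _ fun l _ => (hf l).indicator (S.measurableSet_lt_min_φ k l)]
  congr 1
  ext y
  rw [← Finset.sum_subset (Finset.range_subset_range.2 (min_le_right (S.φ y) k))]
  · exact Finset.sum_congr rfl fun l hl => by
      rw [indicator_of_mem]
      exact Finset.mem_range.1 hl
  · intro l _ hl
    rw [indicator_of_notMem]
    exact fun h => hl (Finset.mem_range.2 h)

theorem towerShift_ofReal (k : ℕ) (w : ℕ → S.Y → ℝ) :
    S.towerShift k (fun b y => (w b y : ℂ)) = fun b y => ((S.towerShift k w b y : ℝ) : ℂ) := by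
  ext b y
  unfold towerShift
  split_ifs <;> rfl

theorem iterate_towerShift_ofReal (k n : ℕ) (w : ℕ → S.Y → ℝ) :
    (S.towerShift k)^[n] (fun b y => (w b y : ℂ)) =
      fun b y => (((S.towerShift k)^[n] w b y : ℝ) : ℂ) := by
  induction n generalizing w with
  | zero => rfl
  | succ n ih => rw [Function.iterate_succ_apply, towerShift_ofReal, ih]; rfl

theorem measurable_comp_iterate {v : X → ℝ} (hv : Measurable v) (l : ℕ) :
    Measurable fun y : S.Y => v (S.T^[l] y) :=
  hv.comp ((S.measurable_T.iterate l).comp measurable_subtype_coe)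

variable {S}
variable {B : Type*} [NormedAddCommGroup B] [NormedSpace ℂ B]

/-- The observables on `Y` which agree with `v ∘ T^(j n)` on each `{φ = n}`, where either `j = 0` or
`1 ≤ j n < n` for `n ≥ 2`, are represented by elements of norm at most `D`. -/
def HasDerivedBound (ι : FunctionSpace S.μ B) (v : X → ℝ) (D : ℝ) : Prop :=
  ∀ j : ℕ → ℕ, (∀ n, 1 ≤ n → j n < n) → ((∀ n, j n = 0) ∨ ∀ n, 2 ≤ n → 1 ≤ j n) →
    ∃ b, ι.Represents b (fun y => v (S.T^[j (S.φ y)] y)) ∧ ‖b‖ ≤ D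

variable {ι : FunctionSpace S.μ B}

theorem HasDerivedBound.sub_const {v : X → ℝ} {D : ℝ} (h : HasDerivedBound ι v D) {e : B}
    (he : ι.toL1 e =ᵐ[S.μ] fun _ => 1) (a : ℝ) :
    HasDerivedBound ι (fun x => v x - a) (D + |a| * ‖e‖) := by
  intro j hj hj'
  obtain ⟨b, hb, hbD⟩ := h j hj hj'
  refine ⟨b - (a : ℂ) • e, ?_, ?_⟩
  · unfold FunctionSpace.Represents at hb ⊢
    rw [map_sub, map_smul]
    filter_upwards [hb, he, Lp.coeFn_sub (ι.toL1 b) ((a : ℂ) • ι.toL1 e),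
      Lp.coeFn_smul (a : ℂ) (ι.toL1 e)] with y h1 h2 h3 h4
    rw [h3, Pi.sub_apply, h4, Pi.smul_apply, h1, h2, smul_eq_mul, mul_one, Complex.ofReal_sub]
  · refine (norm_sub_le _ _).trans (add_le_add hbD ?_)
    rw [norm_smul, Complex.norm_real, Real.norm_eq_abs]

variable [CompleteSpace B] {R : ℕ → B →L[ℂ] B}

/-- `V m` is the density on the base of the mass of `v` that first arrives there at time `m`. For `1
≤ m < k` it is the image, under the sum of the `R i` with `i > m`, of an observable equal to `v ∘
T^(min φ k - m)` on `{φ > m}`. This is a derived observable, so exchangeability bounds it in `B`.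
Summing the means over `m` counts every point of the tower once. -/
theorem exists_truncated_source (hR : S.IsRenewalSequence ι R) (hs : Summable fun n => ‖R n‖)
    {k : ℕ} (hk : 1 ≤ k) {v : X → ℝ} (hv : Measurable v) {a : ℝ} (ha : ∀ x, |v x| ≤ a) {D : ℝ}
    (hD : HasDerivedBound ι v D) :
    ∃ V : ℕ → B, (∀ (g : S.Y → ℂ) (c : ℝ), Measurable g → (∀ y, ‖g y‖ ≤ c) →
        ∫ y, ι.toL1 (V 0) y * g y ∂S.μ = ∫ y, (v y : ℂ) * g y ∂S.μ) ∧
      (∀ m, 1 ≤ m → ∀ (g : S.Y → ℂ) (c : ℝ), Measurable g → (∀ y, ‖g y‖ ≤ c) →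
        ∫ y, ι.toL1 (V m) y * g y ∂S.μ = ∫ y in {y | m < min (S.φ y) k},
          (v (S.T^[min (S.φ y) k - m] y) : ℂ) * g (S.F y) ∂S.μ) ∧
      (∀ m, k ≤ m → V m = 0) ∧
      (∀ m, ‖V m‖ ≤ (1 + ∑' n, ‖R n‖) * D) ∧
      ∑ m ∈ Finset.range k, ι.mean (V m) =
        ∑ l ∈ Finset.range k, ∫ y in {y | l < min (S.φ y) k}, (v (S.T^[l] y) : ℂ) ∂S.μ := by
  obtain ⟨b₀, hb₀, hb₀D⟩ := hD (fun _ => 0) (fun n hn => by omega) (Or.inl fun _ => rfl)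
  have hD0 : 0 ≤ D := (norm_nonneg _).trans hb₀D
  have hRs : 0 ≤ ∑' n, ‖R n‖ := tsum_nonneg fun _ => norm_nonneg _
  -- On `{φ ≤ m}` the exponent is only a default admissible for a derived observable (`0` when `φ =
  -- 1`, otherwise `1`); the operators `R i` with `i > m` do not see that set.
  have hex : ∀ m, 1 ≤ m → m < k → ∃ b, ι.Represents b (fun y => v
      (S.T^[if m < S.φ y then min (S.φ y) k - m else if S.φ y ≤ 1 then 0 else 1] y)) ∧ ‖b‖ ≤ D := by
    intro m hm hmk
    refine hD (fun n => if m < n then min n k - m else if n ≤ 1 then 0 else 1)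
      (fun n hn => ?_) (Or.inr fun n hn => ?_)
    · split_ifs <;> omega
    · split_ifs <;> omega
  choose! b hb hbD using hex
  have hV0 : ∀ (g : S.Y → ℂ) (c : ℝ), Measurable g → (∀ y, ‖g y‖ ≤ c) →
      ∫ y, ι.toL1 b₀ y * g y ∂S.μ = ∫ y, (v y : ℂ) * g y ∂S.μ := by
    intro g c _ _
    refine integral_congr_ae ?_
    filter_upwards [hb₀] with y hy
    rw [hy]
    rfl
  have hVm : ∀ m, 1 ≤ m → m < k → ∀ (g : S.Y → ℂ) (c : ℝ), Measurable g → (∀ y, ‖g y‖ ≤ c) →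
      ∫ y, ι.toL1 (opSum R {i | m < i} (b m)) y * g y ∂S.μ = ∫ y in {y | m < min (S.φ y) k},
        (v (S.T^[min (S.φ y) k - m] y) : ℂ) * g (S.F y) ∂S.μ := by
    intro m hm hmk g c hg hc
    rw [hR.integral_opSum_mul hs _ _ hg hc]
    have hset : {y | S.φ y ∈ {i | m < i}} = {y | m < min (S.φ y) k} := by
      ext y
      simp only [mem_ofPred_eq]
      omega
    rw [hset]
    refine setIntegral_congr_ae (S.measurableSet_lt_min_φ k m) ?_
    filter_upwards [hb m hm hmk] with y hy hyk
    rw [hy, if_pos (by omega)]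
  set V : ℕ → B := fun m =>
    if m = 0 then b₀ else if m < k then opSum R {i | m < i} (b m) else 0 with hVdef
  have hV' : ∀ m, 1 ≤ m → ∀ (g : S.Y → ℂ) (c : ℝ), Measurable g → (∀ y, ‖g y‖ ≤ c) →
      ∫ y, ι.toL1 (V m) y * g y ∂S.μ = ∫ y in {y | m < min (S.φ y) k},
        (v (S.T^[min (S.φ y) k - m] y) : ℂ) * g (S.F y) ∂S.μ := by
    intro m hm g c hg hc
    by_cases hmk : m < k
    · simp only [hVdef, if_neg (by omega : m ≠ 0), if_pos hmk]
      exact hVm m hm hmk g c hg hc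
    · simp only [hVdef, if_neg (by omega : m ≠ 0), if_neg hmk]
      have hset : {y : S.Y | m < min (S.φ y) k} = ∅ := by
        ext y
        simp only [mem_ofPred_eq, mem_empty_iff_false, iff_false]
        omega
      rw [hset, Measure.restrict_empty, integral_zero_measure,
        ← ι.pairing_apply hg hc, map_zero]
  refine ⟨V, hV0, hV', fun m hm => ?_, fun m => ?_, ?_⟩
  · simp only [hVdef]
    rw [if_neg (by omega), if_neg (by omega)]
  · simp only [hVdef]
    split_ifs with h1 h2
    · nlinarith
    · have hm : 1 ≤ m := by omega
      calc ‖opSum R {i | m < i} (b m)‖ ≤ (∑' n, ‖R n‖) * D :=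
            (ContinuousLinearMap.le_opNorm _ _).trans
              (mul_le_mul (norm_opSum_le hs _) (hbD m hm h2) (norm_nonneg _) hRs)
        _ ≤ _ := by nlinarith
    · rw [norm_zero]
      positivity
  · have hvm : ∀ l, Measurable fun y : S.Y => (v (S.T^[l] y) : ℂ) := fun l =>
      Complex.measurable_ofReal.comp (S.measurable_comp_iterate hv l)
    have hint : ∀ l, Integrable (fun y : S.Y => (v (S.T^[l] y) : ℂ)) S.μ := fun l =>
      Integrable.of_bound (hvm l).aestronglyMeasurable a
        (ae_of_all _ fun y => by simpa using ha _)
    have hint' : ∀ m, Integrable (fun y : S.Y => (v (S.T^[min (S.φ y) k - m] y) : ℂ)) S.μ := by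
      intro m
      refine Integrable.of_bound (Measurable.aestronglyMeasurable ?_) a
        (ae_of_all _ fun y => by simpa using ha _)
      exact (measurable_from_prod_countable_left (f := fun p : S.Y × ℕ => (v (S.T^[p.2] p.1) : ℂ))
        hvm).comp (measurable_id.prodMk
          ((Measurable.of_discrete (f := fun n : ℕ => min n k - m)).comp S.measurable_φ))
    rw [S.sum_setIntegral_lt_eq k hint]
    have hmean : ∀ m ∈ Finset.Ico 1 k, ι.mean (V m) = ∫ y in {y | m < min (S.φ y) k},
        (v (S.T^[min (S.φ y) k - m] y) : ℂ) ∂S.μ := fun m hm => by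
      have := hV' m (Finset.mem_Ico.1 hm).1 (fun _ => 1) 1 measurable_const (by simp)
      simpa [ι.mean_apply] using this
    have hmean0 : ι.mean (V 0) = ∫ y : S.Y, (v y : ℂ) ∂S.μ := by
      have := hV0 (fun _ => 1) 1 measurable_const (by simp)
      simpa [ι.mean_apply, hVdef] using this
    have huniv : {y : S.Y | 0 < min (S.φ y) k} = univ := by
      ext y
      have := S.one_le_φ y
      simp only [mem_ofPred_eq, mem_univ, iff_true]
      omega
    set f : ℕ → S.Y → ℂ := fun m y =>
      if m = 0 then (v y : ℂ) else (v (S.T^[min (S.φ y) k - m] y) : ℂ) with hf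
    have hfi : ∀ m, Integrable (f m) S.μ := fun m => by
      by_cases hm : m = 0
      · simpa [hf, hm] using hint 0
      · simpa [hf, hm] using hint' m
    have h1 : ∑ m ∈ Finset.range k, ι.mean (V m) =
        ∑ m ∈ Finset.range k, ∫ y in {y | m < min (S.φ y) k}, f m y ∂S.μ := by
      rw [Finset.range_eq_Ico, Finset.sum_eq_sum_Ico_succ_bot hk, zero_add,
        Finset.sum_eq_sum_Ico_succ_bot hk, hmean0, huniv, Measure.restrict_univ,
        Finset.sum_congr rfl hmean]
      congr 1
      refine Finset.sum_congr rfl fun m hm => ?_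
      simp only [hf, if_neg (by have := (Finset.mem_Ico.1 hm).1; omega : m ≠ 0)]
    rw [h1, S.sum_setIntegral_lt_eq k hfi]
    congr 1
    ext y
    obtain ⟨p, hp⟩ : ∃ p, min (S.φ y) k = p + 1 :=
      ⟨min (S.φ y) k - 1, by have := S.one_le_φ y; omega⟩
    simp only [hf, hp]
    -- In each column, level `l ≥ 1` and arrival time `m = min φ k - l` are exchanged by reflection.
    rw [Finset.sum_range_succ', Finset.sum_range_succ',
      ← Finset.sum_range_reflect (fun l => (v (S.T^[l + 1] y) : ℂ)) p]
    congr 1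
    refine Finset.sum_congr rfl fun m hm => ?_
    have := Finset.mem_range.1 hm
    rw [if_neg (by omega), show p + 1 - (m + 1) = p - 1 - m + 1 by omega]

/-- Decay of correlations on the truncated towers, with explicit dependence on the height `k`. -/
theorem exists_truncated_correlation_le (hR : S.IsRenewalSequence ι R) (hgood : IsGood R)
    {ε : ℝ} (hε : 0 < ε)
    (htail : ∃ C : ℝ, ∀ n : ℕ, 1 ≤ n → normTail R n ≤ C / (n : ℝ) ^ (1 + ε)) :
    ∃ c : ℝ, 0 < c ∧ ∃ C : ℝ, 0 ≤ C ∧ ∃ K : ℕ, 1 ≤ K ∧ ∀ k, K ≤ k → ∀ n, k ≤ n →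
      ∀ (v : X → ℝ) (a D : ℝ), Measurable v → (∀ x, |v x| ≤ a) → HasDerivedBound ι v D →
      (∑ l ∈ Finset.range k, ∫ y in {y | l < min (S.φ y) k}, v (S.T^[l] y) ∂S.μ = 0) →
      ∀ (w : ℕ → S.Y → ℝ) (W : ℝ), (∀ b, Measurable (w b)) → (∀ b y, |w b y| ≤ W) →
      |∑ l ∈ Finset.range k, ∫ y in {y | l < min (S.φ y) k},
        v (S.T^[l] y) * (S.towerShift k)^[n] w l y ∂S.μ| ≤
        C * (W * D) * (k : ℝ) ^ 4 * (radius c k ^ (n - k))⁻¹ := by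
  obtain ⟨C₀, hC₀⟩ := htail
  have hs := hgood.summable_norm
  -- `c < ε` is needed for the moment bound and `c ≤ 1` for the control of the radii.
  set c : ℝ := min ε 1 / 2 with hc
  have hmin : 0 < min ε 1 := lt_min hε one_pos
  have hc0 : 0 < c := by positivity
  have hc1 : c ≤ 1 := by linarith [min_le_right ε 1]
  have hcε : c < ε := by linarith [min_le_left ε 1]
  have hsc := summable_rpow_mul_of_tail_le (fun n => norm_nonneg (R n)) hs hc0 hcε hC₀
  have hs' : Summable fun n : ℕ => (n : ℝ) * ‖R n‖ := by
    refine hsc.of_nonneg_of_le (fun n => by positivity) fun n => ?_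
    gcongr
    rcases Nat.eq_zero_or_pos n with rfl | hn
    · simp [Real.zero_rpow (by linarith : 1 + c ≠ 0)]
    · exact Real.self_le_rpow_of_one_le (by exact_mod_cast hn) (by linarith)
  obtain ⟨e, he⟩ := ι.const_mem 1
  have hle : ι.mean e = 1 := by
    rw [ι.mean_apply, integral_congr_ae he]
    simp
  have hl := hR.mean_renewalSeries_one hs
  obtain ⟨M, hM, hMz⟩ := exists_norm_inverse_regularized_le hs hs'
    (hR.renewalSeries_one_const hs he) hl hle hgood.simple_isolated hgood.aperiodic
    (hR.mean_renewalQuotient_ne_zero hs hs' he)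
  obtain ⟨K, hK1, hK⟩ := exists_norm_inverse_regularized_truncSeq_le hc0 hc1 hs hsc hM hMz
  set A : ℝ := ‖(1 - ι.mean.smulRight e : B →L[ℂ] B)‖ + ‖(ι.mean.smulRight e : B →L[ℂ] B)‖ with hA
  have hA0 : 0 ≤ A := by positivity
  have hRs : 0 ≤ ∑' n, ‖R n‖ := tsum_nonneg fun _ => norm_nonneg _
  -- Heights `k ≥ 2` make the radius strictly larger than `1`, so that the circle avoids the point
  -- `1`.
  refine ⟨c, hc0, 2 * M * A * (1 + ∑' n, ‖R n‖), by positivity, max K 2, by omega,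
    fun k hk n hkn v a D hv ha hD hmean w W hw hW => ?_⟩
  have hk2 : 2 ≤ k := (le_max_right _ _).trans hk
  have hk1 : 1 ≤ k := by omega
  have hr : 1 < radius c k :=
    Real.one_lt_rpow (by exact_mod_cast hk2) (by positivity)
  obtain ⟨V, hV0, hV, hVk, hVD, hVmean⟩ := exists_truncated_source hR hs hk1 hv ha hD
  have hVsum : ∑ m ∈ Finset.range k, ι.mean (V m) = 0 := by
    rw [hVmean]
    simp only [integral_complex_ofReal]
    rw [← Complex.ofReal_sum, hmean, Complex.ofReal_zero]
  obtain ⟨x, hx, hxn⟩ := exists_renewal_solution hs hl hle hr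
    (hK k ((le_max_left _ _).trans hk)) hVsum hVk hVD
  obtain ⟨b₀, -, hb₀D⟩ := hD (fun _ => 0) (fun n hn => by omega) (Or.inl fun _ => rfl)
  have hD0 : 0 ≤ D := (norm_nonneg _).trans hb₀D
  have hY : Nonempty S.Y := by
    by_contra hY
    rw [not_nonempty_iff] at hY
    have : S.μ univ = 0 := by rw [Measure.eq_zero_of_isEmpty S.μ]; rfl
    simp at this
  have hW0 : 0 ≤ W := (abs_nonneg _).trans (hW 0 hY.some)
  have hvi : ∀ l, Integrable (fun y : S.Y => (v (S.T^[l] y) : ℂ)) S.μ := fun l =>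
    Integrable.of_bound (Complex.measurable_ofReal.comp
      (S.measurable_comp_iterate hv l)).aestronglyMeasurable a
      (ae_of_all _ fun y => by simpa using ha _)
  set E : ℝ := 2 * M * (A * (k ^ 2 * radius c k ^ k * ((1 + ∑' n, ‖R n‖) * D))) with hE
  have hE0 : 0 ≤ E := by positivity
  have hmain := hR.norm_tower_correlation_le hs hk1 hvi hV0 hV hx hkn
    (w := fun b y => (w b y : ℂ)) (fun b => Complex.measurable_ofReal.comp (hw b)) hW0
    (fun b y => by simpa using hW b y) (D := E * (radius c k ^ (n - k))⁻¹) fun b hb => by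
      refine (hxn (n - b)).trans ?_
      gcongr
      exact hr.le
  have hcast : ∑ l ∈ Finset.range k, ∫ y in {y | l < min (S.φ y) k}, (v (S.T^[l] y) : ℂ) *
      (S.towerShift k)^[n] (fun b y => (w b y : ℂ)) l y ∂S.μ =
      ((∑ l ∈ Finset.range k, ∫ y in {y | l < min (S.φ y) k},
        v (S.T^[l] y) * (S.towerShift k)^[n] w l y ∂S.μ : ℝ) : ℂ) := by
    rw [iterate_towerShift_ofReal, Complex.ofReal_sum]
    refine Finset.sum_congr rfl fun l _ => ?_
    rw [← integral_complex_ofReal]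
    simp only [Complex.ofReal_mul]
  rw [hcast, Complex.norm_real, Real.norm_eq_abs] at hmain
  refine hmain.trans ?_
  -- The fourth power of `k` arises here: `k ^ 2` from the source polynomial, one factor from `r ^ k
  -- = k ^ c ≤ k`, and one from summing over `k` levels.
  have hrk : radius c k ^ k ≤ k := by
    rw [radius_pow_self c hk1]
    exact (Real.rpow_le_rpow_of_exponent_le (by exact_mod_cast hk1) hc1).trans_eq (Real.rpow_one _)
  have hEle : E ≤ 2 * M * (A * (k ^ 2 * k * ((1 + ∑' n, ‖R n‖) * D))) := by
    rw [hE]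
    gcongr
  calc (k : ℝ) * (W * (E * (radius c k ^ (n - k))⁻¹))
      ≤ k * (W * (2 * M * (A * (k ^ 2 * k * ((1 + ∑' n, ‖R n‖) * D))) *
          (radius c k ^ (n - k))⁻¹)) := by gcongr
    _ = _ := by ring

end InducingScheme

/-! ### Comparison of the tower with its truncation. -/

namespace InducingScheme

variable {X : Type*} [MeasurableSpace X] (S : InducingScheme X)

theorem measurable_sum_range {N : S.Y → ℕ} (hN : Measurable N) {f : ℕ → S.Y → ℝ}
    (hf : ∀ l, Measurable (f l)) : Measurable fun y => ∑ l ∈ Finset.range (N y), f l y :=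
  (measurable_from_prod_countable_left
    (f := fun p : S.Y × ℕ => ∑ l ∈ Finset.range p.2, f l p.1)
    fun n => Finset.measurable_sum (Finset.range n) fun l _ => hf l).comp (measurable_id.prodMk hN)

theorem abs_sum_range_le {N : ℕ} {f : ℕ → ℝ} {c : ℝ} (hc : ∀ l, |f l| ≤ c) :
    |∑ l ∈ Finset.range N, f l| ≤ N * c :=
  (Finset.abs_sum_le_sum_abs _ _).trans
    ((Finset.sum_le_card_nsmul _ _ c fun l _ => hc l).trans_eq (by simp))

theorem integrable_sum_range {N : S.Y → ℕ} (hN : Measurable N) (hNφ : ∀ y, N y ≤ S.φ y)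
    {f : ℕ → S.Y → ℝ} (hf : ∀ l, Measurable (f l)) {c : ℝ} (hc : ∀ l y, |f l y| ≤ c) :
    Integrable (fun y => ∑ l ∈ Finset.range (N y), f l y) S.μ := by
  refine (S.integrable_φ.mul_const c).mono' (S.measurable_sum_range hN hf).aestronglyMeasurable
    (ae_of_all _ fun y => (abs_sum_range_le fun l => hc l y).trans ?_)
  have hc0 : 0 ≤ c := (abs_nonneg _).trans (hc 0 y)
  gcongr
  exact hNφ y

theorem measurable_min_φ (k : ℕ) : Measurable fun y => min (S.φ y) k :=
  S.measurable_φ.min measurable_const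

theorem integrable_cast_min_φ (k : ℕ) : Integrable (fun y => ((min (S.φ y) k : ℕ) : ℝ)) S.μ := by
  refine S.integrable_φ.mono' (measurable_from_nat.comp (S.measurable_min_φ k)).aestronglyMeasurable
    (ae_of_all _ fun y => ?_)
  rw [Real.norm_of_nonneg (by positivity)]
  exact_mod_cast min_le_left _ _

/-- The measure of the levels above `k` in the tower. -/
def towerTail (k : ℕ) : ℝ := ∫ y, ((S.φ y : ℝ) - (min (S.φ y) k : ℕ)) ∂S.μ

theorem sum_towerShift {k : ℕ} (hk : 1 ≤ k) (g : ℕ → S.Y → ℝ) (y : S.Y) :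
    ∑ b ∈ Finset.range (min (S.φ y) k), S.towerShift k g b y =
      ∑ b ∈ Finset.range (min (S.φ y) k), g b y - g 0 y + g 0 (S.F y) := by
  obtain ⟨p, hp⟩ : ∃ p, min (S.φ y) k = p + 1 :=
    ⟨min (S.φ y) k - 1, by have := S.one_le_φ y; omega⟩
  rw [hp, Finset.sum_range_succ, Finset.sum_range_succ', add_sub_cancel_right]
  congr 1
  · refine Finset.sum_congr rfl fun b hb => ?_
    have := Finset.mem_range.1 hb
    rw [towerShift, if_pos (by omega)]
  · rw [towerShift, if_neg (by omega)]

/-- Over each column the shift replaces `g 0 y` by `g 0 (F y)`, which has the same integral. Thus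
the truncated tower map preserves the restricted measure. -/
theorem integral_sum_towerShift {k : ℕ} (hk : 1 ≤ k) {g : ℕ → S.Y → ℝ}
    (hg : ∀ l, Measurable (g l)) {c : ℝ} (hc : ∀ l y, |g l y| ≤ c) :
    ∫ y, ∑ b ∈ Finset.range (min (S.φ y) k), S.towerShift k g b y ∂S.μ =
      ∫ y, ∑ b ∈ Finset.range (min (S.φ y) k), g b y ∂S.μ := by
  have h0 : Integrable (g 0) S.μ :=
    Integrable.of_bound (hg 0).aestronglyMeasurable c (ae_of_all _ (hc 0))
  have hF : Integrable (fun y => g 0 (S.F y)) S.μ :=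
    S.measurePreserving_F.integrable_comp_of_integrable h0
  have hs := S.integrable_sum_range (S.measurable_min_φ k) (fun y => min_le_left _ _) hg hc
  have hF' : ∫ y, g 0 (S.F y) ∂S.μ = ∫ y, g 0 y ∂S.μ := by
    have h1 := integral_map (μ := S.μ) S.measurePreserving_F.measurable.aemeasurable
      (f := g 0) (hg 0).aestronglyMeasurable
    rw [S.measurePreserving_F.map_eq] at h1
    exact h1.symm
  simp only [S.sum_towerShift hk]
  have hs' : Integrable (fun y => ∑ b ∈ Finset.range (min (S.φ y) k), g b y - g 0 y) S.μ :=
    hs.sub h0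
  rw [integral_add hs' hF, integral_sub hs h0, hF']
  ring

theorem integral_sum_iterate_towerShift {k : ℕ} (hk : 1 ≤ k) {g : ℕ → S.Y → ℝ}
    (hg : ∀ l, Measurable (g l)) {c : ℝ} (hc : ∀ l y, |g l y| ≤ c) (n : ℕ) :
    ∫ y, ∑ b ∈ Finset.range (min (S.φ y) k), (S.towerShift k)^[n] g b y ∂S.μ =
      ∫ y, ∑ b ∈ Finset.range (min (S.φ y) k), g b y ∂S.μ := by
  induction n generalizing g with
  | zero => rfl
  | succ n ih =>
    rw [Function.iterate_succ]
    exact (ih (S.measurable_towerShift k hg) (S.towerShift_mem k (p := fun x => |x| ≤ c) hc)).trans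
      (S.integral_sum_towerShift hk hg hc)

/-- The indicator of the top level of the truncated tower over `{φ > k}`, where the truncated
dynamics departs from the original one. -/
def topIndicator (k : ℕ) : ℕ → S.Y → ℝ := fun b y => if b + 1 = k ∧ k < S.φ y then 1 else 0

theorem topIndicator_mem (k b : ℕ) (y : S.Y) :
    0 ≤ S.topIndicator k b y ∧ |S.topIndicator k b y| ≤ 1 := by
  unfold topIndicator
  split_ifs <;> simp

theorem measurable_topIndicator (k b : ℕ) : Measurable (S.topIndicator k b) :=
  Measurable.ite (S.measurableSet_φ {n | b + 1 = k ∧ k < n}) measurable_const measurable_const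

theorem integral_sum_topIndicator {k : ℕ} (hk : 1 ≤ k) :
    ∫ y, ∑ b ∈ Finset.range (min (S.φ y) k), S.topIndicator k b y ∂S.μ =
      S.μ.real {y | k < S.φ y} := by
  have hm : MeasurableSet {y | k < S.φ y} := S.measurableSet_φ {n | k < n}
  rw [← integral_indicator_one hm]
  congr 1
  ext y
  by_cases hy : k < S.φ y
  · rw [indicator_of_mem (by exact hy), Pi.one_apply, Finset.sum_eq_single (k - 1)]
    · rw [topIndicator, if_pos ⟨by omega, hy⟩]
    · intro b _ hb
      rw [topIndicator, if_neg (by omega)]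
    · intro h
      exact absurd (Finset.mem_range.2 (by omega)) h
  · rw [indicator_of_notMem (by exact hy)]
    refine Finset.sum_eq_zero fun b _ => ?_
    rw [topIndicator, if_neg (by tauto)]

/-- The truncated dynamics follows the true orbit until it first leaves the top level over `{φ >
k}`. After that only the trivial bound `2 W` is used, and the sum of the indicators is then at least
`1`. -/
theorem abs_iterate_towerShift_sub_le {k : ℕ} (hk : 1 ≤ k) {w : X → ℝ} {W : ℝ}
    (hW : ∀ x, |w x| ≤ W) (n : ℕ) (b : ℕ) (y : S.Y) (hb : b < min (S.φ y) k) :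
    |(S.towerShift k)^[n] (fun l y => w (S.T^[l] y)) b y - w (S.T^[b + n] y)| ≤
      2 * W * ∑ i ∈ Finset.range n, (S.towerShift k)^[i] (S.topIndicator k) b y := by
  have hW0 : 0 ≤ W := (abs_nonneg _).trans (hW y)
  have hpos : ∀ i b y, 0 ≤ (S.towerShift k)^[i] (S.topIndicator k) b y :=
    S.iterate_towerShift_mem k (p := fun x => 0 ≤ x) fun b y => (S.topIndicator_mem k b y).1
  induction n generalizing b y with
  | zero => simp
  | succ n ih =>
    rw [Finset.sum_range_succ', Function.iterate_zero, id]
    simp only [Function.iterate_succ_apply']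
    have htop := (S.topIndicator_mem k b y).1
    by_cases hb' : b + 1 < min (S.φ y) k
    · simp only [towerShift, if_pos hb']
      have h := ih (b + 1) y hb'
      rw [show b + (n + 1) = b + 1 + n by ring, mul_add]
      have : 0 ≤ 2 * W * S.topIndicator k b y := by positivity
      linarith
    -- At the top of an untruncated column, `b + 1 = φ y` and both dynamics move to `F y`; over `{φ
    -- > k}`, the top is at `b + 1 = k` and the indicator is `1`.
    · by_cases hφ : S.φ y ≤ k
      · simp only [towerShift, if_neg hb']
        have h := ih 0 (S.F y) (by have := S.one_le_φ (S.F y); omega)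
        have hT : S.T^[b + (n + 1)] y = S.T^[0 + n] (S.F y) := by
          rw [zero_add, show b + (n + 1) = n + S.φ y by omega, Function.iterate_add_apply]
          rfl
        rw [hT, mul_add]
        have : 0 ≤ 2 * W * S.topIndicator k b y := by positivity
        linarith
      · have h1 : S.topIndicator k b y = 1 := if_pos ⟨by omega, by omega⟩
        have h2 : |S.towerShift k ((S.towerShift k)^[n] fun l y => w (S.T^[l] y)) b y| ≤ W :=
          S.towerShift_mem k (p := fun x => |x| ≤ W)
            (S.iterate_towerShift_mem k (p := fun x => |x| ≤ W) (fun l y => hW _) n) b y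
        have h3 : 0 ≤ ∑ i ∈ Finset.range n,
            S.towerShift k ((S.towerShift k)^[i] (S.topIndicator k)) b y :=
          Finset.sum_nonneg fun i _ => S.towerShift_mem k (p := fun x => 0 ≤ x) (hpos i) b y
        rw [h1]
        refine (abs_sub _ _).trans ?_
        have h4 := hW (S.T^[b + (n + 1)] y)
        nlinarith

/-- The observable `f` integrated over the tower, with respect to `μ × counting`. -/
def towerIntegral (f : X → ℝ) : ℝ := ∫ y, ∑ l ∈ Finset.range (S.φ y), f (S.T^[l] y) ∂S.μ

/-- The observable `f` integrated over the tower truncated at height `k`. -/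
def truncIntegral (k : ℕ) (f : X → ℝ) : ℝ :=
  ∫ y, ∑ l ∈ Finset.range (min (S.φ y) k), f (S.T^[l] y) ∂S.μ

/-- The correlation integral on the tower truncated at height `k`. -/
def truncCorr (k n : ℕ) (v w : X → ℝ) : ℝ :=
  ∫ y, ∑ l ∈ Finset.range (min (S.φ y) k),
    v (S.T^[l] y) * (S.towerShift k)^[n] (fun l y => w (S.T^[l] y)) l y ∂S.μ

theorem integrable_towerSum {v : X → ℝ} (hv : Measurable v) {a : ℝ} (ha : ∀ x, |v x| ≤ a) :
    Integrable (fun y : S.Y => ∑ l ∈ Finset.range (S.φ y), v (S.T^[l] y)) S.μ :=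
  S.integrable_sum_range S.measurable_φ (fun _ => le_rfl) (S.measurable_comp_iterate hv)
    fun _ _ => ha _

theorem integrable_truncSum {v : X → ℝ} (hv : Measurable v) {a : ℝ} (ha : ∀ x, |v x| ≤ a)
    (k : ℕ) :
    Integrable (fun y : S.Y => ∑ l ∈ Finset.range (min (S.φ y) k), v (S.T^[l] y)) S.μ :=
  S.integrable_sum_range (S.measurable_min_φ k) (fun _ => min_le_left _ _)
    (S.measurable_comp_iterate hv) fun _ _ => ha _

theorem one_le_integral_φ : 1 ≤ ∫ y, (S.φ y : ℝ) ∂S.μ := by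
  have h := integral_mono (μ := S.μ) (integrable_const (1 : ℝ)) S.integrable_φ fun y =>
    Nat.one_le_cast.2 (S.one_le_φ y)
  simpa using h

theorem one_le_integral_min_φ {k : ℕ} (hk : 1 ≤ k) :
    1 ≤ ∫ y, ((min (S.φ y) k : ℕ) : ℝ) ∂S.μ := by
  have h := integral_mono (μ := S.μ) (integrable_const (1 : ℝ)) (S.integrable_cast_min_φ k)
    fun y => Nat.one_le_cast.2 (le_min (S.one_le_φ y) hk)
  simpa using h

theorem towerTail_eq (k : ℕ) :
    S.towerTail k = ∫ y, (S.φ y : ℝ) ∂S.μ - ∫ y, ((min (S.φ y) k : ℕ) : ℝ) ∂S.μ :=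
  integral_sub S.integrable_φ (S.integrable_cast_min_φ k)

theorem integrable_sub_min_φ (k : ℕ) :
    Integrable (fun y => (S.φ y : ℝ) - (min (S.φ y) k : ℕ)) S.μ :=
  S.integrable_φ.sub (S.integrable_cast_min_φ k)

theorem towerTail_nonneg (k : ℕ) : 0 ≤ S.towerTail k :=
  integral_nonneg fun y => by
    have : ((min (S.φ y) k : ℕ) : ℝ) ≤ S.φ y := by exact_mod_cast min_le_left _ _
    simp only [Pi.zero_apply]
    linarith

theorem abs_towerIntegral_le {v : X → ℝ} {a : ℝ} (ha : ∀ x, |v x| ≤ a) :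
    |S.towerIntegral v| ≤ a * ∫ y, (S.φ y : ℝ) ∂S.μ := by
  rw [← integral_const_mul, ← Real.norm_eq_abs]
  refine norm_integral_le_of_norm_le (S.integrable_φ.const_mul a) (ae_of_all _ fun y => ?_)
  rw [mul_comm]
  exact abs_sum_range_le fun l => ha _

theorem abs_truncIntegral_le {v : X → ℝ} {a : ℝ} (ha : ∀ x, |v x| ≤ a) (k : ℕ) :
    |S.truncIntegral k v| ≤ a * ∫ y, ((min (S.φ y) k : ℕ) : ℝ) ∂S.μ := by
  rw [← integral_const_mul, ← Real.norm_eq_abs]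
  refine norm_integral_le_of_norm_le ((S.integrable_cast_min_φ k).const_mul a)
    (ae_of_all _ fun y => ?_)
  rw [mul_comm]
  exact abs_sum_range_le fun l => ha _

theorem abs_sum_range_sub_le {m n : ℕ} (hmn : m ≤ n) {f g : ℕ → ℝ} {a : ℝ} (hf : ∀ l, |f l| ≤ a)
    {h : ℕ → ℝ} (hfg : ∀ l < m, |g l - f l| ≤ h l) :
    |∑ l ∈ Finset.range n, f l - ∑ l ∈ Finset.range m, g l| ≤
      a * ((n : ℝ) - m) + ∑ l ∈ Finset.range m, h l := by
  obtain ⟨p, rfl⟩ := Nat.exists_eq_add_of_le hmn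
  rw [Finset.sum_range_add]
  have h1 : |∑ l ∈ Finset.range p, f (m + l)| ≤ p * a := abs_sum_range_le fun l => hf _
  have h2 : |∑ l ∈ Finset.range m, g l - ∑ l ∈ Finset.range m, f l|
      ≤ ∑ l ∈ Finset.range m, h l := by
    rw [← Finset.sum_sub_distrib]
    exact (Finset.abs_sum_le_sum_abs _ _).trans
      (Finset.sum_le_sum fun l hl => hfg l (Finset.mem_range.1 hl))
  rw [abs_le] at h1 h2 ⊢
  push_cast
  constructor <;> linarith

theorem abs_towerIntegral_sub_truncIntegral_le {v : X → ℝ} (hv : Measurable v) {a : ℝ}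
    (ha : ∀ x, |v x| ≤ a) (k : ℕ) :
    |S.towerIntegral v - S.truncIntegral k v| ≤ a * S.towerTail k := by
  rw [towerIntegral, truncIntegral,
    ← integral_sub (S.integrable_towerSum hv ha) (S.integrable_truncSum hv ha k), towerTail,
    ← integral_const_mul, ← Real.norm_eq_abs]
  refine norm_integral_le_of_norm_le ((S.integrable_sub_min_φ k).const_mul a)
    (ae_of_all _ fun y => ?_)
  have h := abs_sum_range_sub_le (min_le_left (S.φ y) k) (f := fun l => v (S.T^[l] y))
    (g := fun l => v (S.T^[l] y)) (h := fun _ => 0) (fun l => ha _) (fun l _ => by simp)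
  simpa using h

/-- The correlation integrals on the tower and on the truncated tower differ by at most the
measure of the part of phase space which the truncation affects. -/
theorem abs_towerIntegral_sub_truncCorr_le {v w : X → ℝ} (hv : Measurable v) (hw : Measurable w)
    {a W : ℝ} (ha : ∀ x, |v x| ≤ a) (hW : ∀ x, |w x| ≤ W) {k : ℕ} (hk : 1 ≤ k) (n : ℕ) :
    |S.towerIntegral (fun x => v x * w (S.T^[n] x)) - S.truncCorr k n v w| ≤
      a * W * S.towerTail k + 2 * a * W * (n * S.μ.real {y | k < S.φ y}) := by
  have hX : Nonempty X := by
    by_contra hX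
    rw [not_nonempty_iff] at hX
    have h1 : S.μ univ = 0 := by rw [Measure.eq_zero_of_isEmpty S.μ]; rfl
    simp at h1
  have ha0 : 0 ≤ a := (abs_nonneg _).trans (ha hX.some)
  have hW0 : 0 ≤ W := (abs_nonneg _).trans (hW hX.some)
  have hmul : ∀ x x', |v x * w x'| ≤ a * W := fun x x' => by
    rw [abs_mul]
    exact mul_le_mul (ha x) (hW x') (abs_nonneg _) ha0
  have hwm : ∀ b, Measurable ((S.towerShift k)^[n] (fun l y => w (S.T^[l] y)) b) :=
    S.measurable_iterate_towerShift k (S.measurable_comp_iterate hw) n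
  have hwb : ∀ b y, |(S.towerShift k)^[n] (fun l y => w (S.T^[l] y)) b y| ≤ W :=
    S.iterate_towerShift_mem k (p := fun x => |x| ≤ W) (fun _ _ => hW _) n
  have hi1 := S.integrable_towerSum (v := fun x => v x * w (S.T^[n] x))
    (hv.mul (hw.comp (S.measurable_T.iterate n))) fun x => hmul _ _
  have hi2 := S.integrable_sum_range (S.measurable_min_φ k) (fun _ => min_le_left _ _)
    (f := fun l y => v (S.T^[l] y) * (S.towerShift k)^[n] (fun l y => w (S.T^[l] y)) l y)
    (fun l => (S.measurable_comp_iterate hv l).mul (hwm l)) (c := a * W) fun l y => by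
      rw [abs_mul]
      exact mul_le_mul (ha _) (hwb l y) (abs_nonneg _) ha0
  have htm : ∀ i b, Measurable ((S.towerShift k)^[i] (S.topIndicator k) b) := fun i =>
    S.measurable_iterate_towerShift k (S.measurable_topIndicator k) i
  have htb : ∀ i b y, |(S.towerShift k)^[i] (S.topIndicator k) b y| ≤ 1 := fun i =>
    S.iterate_towerShift_mem k (p := fun x => |x| ≤ 1) (fun b y => (S.topIndicator_mem k b y).2) i
  have hi3 : ∀ i, Integrable (fun y => ∑ l ∈ Finset.range (min (S.φ y) k),
      (S.towerShift k)^[i] (S.topIndicator k) l y) S.μ := fun i =>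
    S.integrable_sum_range (S.measurable_min_φ k) (fun _ => min_le_left _ _) (htm i) (htb i)
  have hi4 : Integrable (fun y => ∑ i ∈ Finset.range n, ∑ l ∈ Finset.range (min (S.φ y) k),
      (S.towerShift k)^[i] (S.topIndicator k) l y) S.μ :=
    integrable_finsetSum _ fun i _ => hi3 i
  -- By invariance under the truncated tower map, each of the `n` times contributes `μ(φ > k)`.
  have hbad : ∫ y, ∑ i ∈ Finset.range n, ∑ l ∈ Finset.range (min (S.φ y) k),
      (S.towerShift k)^[i] (S.topIndicator k) l y ∂S.μ = n * S.μ.real {y | k < S.φ y} := by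
    rw [integral_finsetSum _ fun i _ => hi3 i]
    simp only [S.integral_sum_iterate_towerShift hk (S.measurable_topIndicator k)
      (fun b y => (S.topIndicator_mem k b y).2), S.integral_sum_topIndicator hk]
    simp
  rw [← hbad, towerIntegral, truncCorr, ← integral_sub hi1 hi2, towerTail, ← integral_const_mul,
    ← integral_const_mul, ← integral_add ((S.integrable_sub_min_φ k).const_mul _)
      (hi4.const_mul _), ← Real.norm_eq_abs]
  refine norm_integral_le_of_norm_le
    (((S.integrable_sub_min_φ k).const_mul _).add (hi4.const_mul _)) (ae_of_all _ fun y => ?_)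
  have h := abs_sum_range_sub_le (min_le_left (S.φ y) k)
    (f := fun l => v (S.T^[l] y) * w (S.T^[n] (S.T^[l] y)))
    (g := fun l => v (S.T^[l] y) * (S.towerShift k)^[n] (fun l y => w (S.T^[l] y)) l y)
    (h := fun l => a * (2 * W * ∑ i ∈ Finset.range n,
      (S.towerShift k)^[i] (S.topIndicator k) l y)) (fun l => hmul _ _) fun l hl => by
    rw [← mul_sub, abs_mul, ← Function.iterate_add_apply, add_comm n l]
    exact mul_le_mul (ha _) (S.abs_iterate_towerShift_sub_le hk hW n l y hl) (abs_nonneg _) ha0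
  rw [Real.norm_eq_abs]
  refine h.trans_eq ?_
  rw [Finset.sum_comm (s := Finset.range n)]
  simp only [← Finset.mul_sum]
  ring

theorem truncCorr_sub_const {v w : X → ℝ} (hv : Measurable v) (hw : Measurable w)
    {a W : ℝ} (ha : ∀ x, |v x| ≤ a) (hW : ∀ x, |w x| ≤ W) {k : ℕ} (hk : 1 ≤ k) (n : ℕ) (α : ℝ) :
    S.truncCorr k n (fun x => v x - α) w = S.truncCorr k n v w - α * S.truncIntegral k w := by
  have hwm : ∀ b, Measurable ((S.towerShift k)^[n] (fun l y => w (S.T^[l] y)) b) :=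
    S.measurable_iterate_towerShift k (S.measurable_comp_iterate hw) n
  have hwb : ∀ b y, |(S.towerShift k)^[n] (fun l y => w (S.T^[l] y)) b y| ≤ W :=
    S.iterate_towerShift_mem k (p := fun x => |x| ≤ W) (fun _ _ => hW _) n
  have hi1 := S.integrable_sum_range (S.measurable_min_φ k) (fun _ => min_le_left _ _) hwm hwb
  have hi2 := S.integrable_sum_range (S.measurable_min_φ k) (fun _ => min_le_left _ _)
    (f := fun l y => v (S.T^[l] y) * (S.towerShift k)^[n] (fun l y => w (S.T^[l] y)) l y)
    (fun l => (S.measurable_comp_iterate hv l).mul (hwm l)) (c := a * W) fun l y => by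
      rw [abs_mul]
      exact mul_le_mul (ha _) (hwb l y) (abs_nonneg _) ((abs_nonneg _).trans (ha y))
  rw [truncIntegral, ← S.integral_sum_iterate_towerShift hk (S.measurable_comp_iterate hw)
    (fun _ _ => hW _) n, truncCorr, truncCorr, ← integral_const_mul,
    ← integral_sub hi2 (hi1.const_mul α)]
  simp only [sub_mul, Finset.sum_sub_distrib, Finset.mul_sum]

theorem truncIntegral_sub_const {v : X → ℝ} (hv : Measurable v) {a : ℝ} (ha : ∀ x, |v x| ≤ a)
    (k : ℕ) (α : ℝ) : S.truncIntegral k (fun x => v x - α) =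
      S.truncIntegral k v - α * ∫ y, ((min (S.φ y) k : ℕ) : ℝ) ∂S.μ := by
  rw [truncIntegral, truncIntegral, ← integral_const_mul,
    ← integral_sub (S.integrable_truncSum hv ha k) ((S.integrable_cast_min_φ k).const_mul α)]
  simp only [Finset.sum_sub_distrib, Finset.sum_const, Finset.card_range, nsmul_eq_mul,
    mul_comm α]

end InducingScheme

/-! ### Correlations on `X`, and passage to bounded measurable representatives. -/

namespace InducingScheme

variable {X : Type*} [MeasurableSpace X] (S : InducingScheme X)

/-- `α` is the mean of `v` over the truncated tower, so the last term is the correlation of a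
centred observable. Comparing correlation integrals costs one `a W` times the tail, and comparing
the products of means costs three more. -/
theorem abs_towerIntegral_corr_le {v w : X → ℝ} (hv : Measurable v) (hw : Measurable w)
    {a W : ℝ} (ha : ∀ x, |v x| ≤ a) (hW : ∀ x, |w x| ≤ W) (ha0 : 0 ≤ a)
    {k : ℕ} (hk : 1 ≤ k) (n : ℕ) {α : ℝ}
    (hα : α = S.truncIntegral k v / ∫ y, ((min (S.φ y) k : ℕ) : ℝ) ∂S.μ) :
    |S.towerIntegral (fun x => v x * w (S.T^[n] x)) -
        S.towerIntegral v * S.towerIntegral w / ∫ y, (S.φ y : ℝ) ∂S.μ| ≤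
      4 * a * W * S.towerTail k + 2 * a * W * (n * S.μ.real {y | k < S.φ y}) +
        |S.truncCorr k n (fun x => v x - α) w| := by
  have h1 := S.abs_towerIntegral_sub_truncCorr_le hv hw ha hW hk n
  rw [S.truncCorr_sub_const hv hw ha hW hk]
  have h2 := S.abs_towerIntegral_sub_truncIntegral_le hv ha k
  have h3 := S.abs_towerIntegral_sub_truncIntegral_le hw hW k
  have h4 := S.abs_towerIntegral_le hW
  have h5 := S.abs_truncIntegral_le ha k
  have hp := S.one_le_integral_φ
  have hq := S.one_le_integral_min_φ hk
  have hτ := S.towerTail_eq k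
  have hτ0 := S.towerTail_nonneg k
  set p := ∫ y, (S.φ y : ℝ) ∂S.μ
  set q := ∫ y, ((min (S.φ y) k : ℕ) : ℝ) ∂S.μ
  set τ := S.towerTail k
  set I := S.towerIntegral v
  set I' := S.truncIntegral k v
  set J := S.towerIntegral w
  set J' := S.truncIntegral k w
  have hp0 : 0 < p := by linarith
  have hq0 : 0 < q := by linarith
  have hαa : |α| ≤ a := by
    rw [hα, abs_div, abs_of_pos hq0, div_le_iff₀ hq0]
    exact h5
  have hJp : |J / p| ≤ W := by
    rw [abs_div, abs_of_pos hp0, div_le_iff₀ hp0]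
    exact h4
  have hI' : I' = α * q := by rw [hα, div_mul_cancel₀ _ hq0.ne']
  have key : |α * J' - I * J / p| ≤ 3 * a * W * τ := by
    have e1 : α * J' - I * J / p = -(α * (J - J')) + α * τ * (J / p) - (I - I') * (J / p) := by
      have : q = p - τ := by linarith
      rw [hI', this]
      field_simp
      ring
    rw [e1]
    refine (abs_sub _ _).trans ?_
    refine (add_le_add_left (abs_add_le _ _) _).trans ?_
    rw [abs_neg, abs_mul, abs_mul, abs_mul, abs_mul (I - I'), abs_of_nonneg hτ0]
    have b1 : |α| * |J - J'| ≤ a * (W * τ) := by gcongr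
    have b2 : |α| * τ * |J / p| ≤ a * τ * W := by gcongr
    have b3 : |I - I'| * |J / p| ≤ a * τ * W := by gcongr
    linarith
  have h6 : ∀ x y z t : ℝ, x - t = (x - y) + (y - z) + (z - t) := fun x y z t => by ring
  rw [h6 _ (S.truncCorr k n v w) (α * J')]
  refine (abs_add_three _ _ _).trans ?_
  linarith

theorem measurable_towerProj : Measurable fun p : S.Y × ℕ => S.T^[p.2] p.1 :=
  measurable_from_prod_countable_left (f := fun p : S.Y × ℕ => S.T^[p.2] (p.1 : X)) fun n =>
    (S.measurable_T.iterate n).comp measurable_subtype_coe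

theorem measurableSet_tower : MeasurableSet {p : S.Y × ℕ | p.2 < S.φ p.1} :=
  measurableSet_lt measurable_snd (S.measurable_φ.comp measurable_fst)

theorem lintegral_φ : ∫⁻ y, (S.φ y : ℝ≥0∞) ∂S.μ = ENNReal.ofReal (∫ y, (S.φ y : ℝ) ∂S.μ) := by
  rw [ofReal_integral_eq_lintegral_ofReal S.integrable_φ (ae_of_all _ fun y => by positivity)]
  simp

theorem prod_count_tower :
    (S.μ.prod Measure.count) {p : S.Y × ℕ | p.2 < S.φ p.1} = ∫⁻ y, (S.φ y : ℝ≥0∞) ∂S.μ := by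
  rw [Measure.prod_apply S.measurableSet_tower]
  refine lintegral_congr fun y => ?_
  have : Prod.mk y ⁻¹' {p : S.Y × ℕ | p.2 < S.φ p.1} = ↑(Finset.range (S.φ y)) := by
    ext l
    simp
  rw [this, Measure.count_apply_finset, Finset.card_range]

theorem integral_μX {f : X → ℝ} (hf : Measurable f) {c : ℝ} (hc : ∀ x, |f x| ≤ c) :
    ∫ x, f x ∂S.μX = S.towerIntegral f / ∫ y, (S.φ y : ℝ) ∂S.μ := by
  have hp := S.one_le_integral_φ
  have hfin : IsFiniteMeasure
      ((S.μ.prod Measure.count).restrict {p : S.Y × ℕ | p.2 < S.φ p.1}) := by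
    rw [isFiniteMeasure_restrict, prod_count_tower, lintegral_φ]
    exact ENNReal.ofReal_ne_top
  have hint : IntegrableOn (fun p : S.Y × ℕ => f (S.T^[p.2] p.1))
      {p : S.Y × ℕ | p.2 < S.φ p.1} (S.μ.prod Measure.count) :=
    Integrable.of_bound (hf.comp S.measurable_towerProj).aestronglyMeasurable c
      (ae_of_all _ fun _ => hc _)
  rw [μX, integral_map S.measurable_towerProj.aemeasurable hf.aestronglyMeasurable, towerMeasure,
    integral_smul_measure, lintegral_φ, ENNReal.toReal_inv, ENNReal.toReal_ofReal (by linarith),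
    smul_eq_mul, inv_mul_eq_div]
  congr 1
  rw [← integral_indicator S.measurableSet_tower,
    integral_prod _ ((integrable_indicator_iff S.measurableSet_tower).2 hint), towerIntegral]
  congr 1
  ext y
  have h1 : ∀ l, {p : S.Y × ℕ | p.2 < S.φ p.1}.indicator
      (fun p : S.Y × ℕ => f (S.T^[p.2] p.1)) (y, l) =
      (↑(Finset.range (S.φ y)) : Set ℕ).indicator (fun l => f (S.T^[l] y)) l := fun l => by
    by_cases hl : l < S.φ y <;> simp [hl]
  simp only [h1]
  rw [integral_indicator (Finset.measurableSet _), setIntegral_finset]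
  · refine Finset.sum_congr rfl fun l _ => ?_
    rw [measureReal_def, Measure.count_singleton]
    simp
  · have : IsFiniteMeasure (Measure.count.restrict (↑(Finset.range (S.φ y)) : Set ℕ)) := by
      rw [isFiniteMeasure_restrict, Measure.count_apply_finset]
      exact ENNReal.natCast_ne_top _
    exact Integrable.of_bound Measurable.of_discrete.aestronglyMeasurable c
      (ae_of_all _ fun _ => hc _)

theorem μX_eq_zero_iff {N : Set X} (hN : MeasurableSet N) :
    S.μX N = 0 ↔ ∀ᵐ (y : S.Y) ∂S.μ, ∀ l, l < S.φ y → S.T^[l] (y : X) ∉ N := by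
  have hpre := S.measurable_towerProj hN
  have htop : (∫⁻ y, (S.φ y : ℝ≥0∞) ∂S.μ)⁻¹ ≠ 0 := by
    rw [lintegral_φ]
    simp
  rw [μX, Measure.map_apply S.measurable_towerProj hN, towerMeasure, Measure.smul_apply,
    smul_eq_mul, mul_eq_zero, or_iff_right htop, Measure.restrict_apply hpre,
    Measure.measure_prod_null (hpre.inter S.measurableSet_tower)]
  refine Filter.eventually_congr (ae_of_all _ fun y => ?_)
  rw [Pi.zero_apply, Measure.count_eq_zero_iff, Set.eq_empty_iff_forall_notMem]
  refine forall_congr' fun l => ?_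
  simp only [mem_preimage, mem_inter_iff, mem_ofPred_eq]
  tauto

/-- A `μX`-null set is avoided during almost every first excursion. As `F` preserves `μ`, it is also
avoided during the excursions started at all `F^i y`, and these cover the whole orbit. -/
theorem ae_forall_iterate_notMem {N : Set X} (hN : MeasurableSet N) (h0 : S.μX N = 0) :
    ∀ᵐ (y : S.Y) ∂S.μ, ∀ l, S.T^[l] (y : X) ∉ N := by
  rw [S.μX_eq_zero_iff hN] at h0
  have h1 : ∀ i : ℕ, ∀ᵐ (y : S.Y) ∂S.μ, ∀ l, l < S.φ (S.F^[i] y) → S.T^[l] (S.F^[i] y : X) ∉ N := fun i =>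
    (S.measurePreserving_F.iterate i).quasiMeasurePreserving.ae h0
  filter_upwards [ae_all_iff.2 h1] with y hy l
  induction l using Nat.strong_induction_on generalizing y with
  | _ l ih =>
    by_cases hl : l < S.φ y
    · exact hy 0 l hl
    · have h2 := ih (l - S.φ y) (by have := S.one_le_φ y; omega) (S.F y) fun i => by
        have := hy (i + 1)
        simpa only [Function.iterate_succ_apply] using this
      have h3 : S.T^[l] (y : X) = S.T^[l - S.φ y] (S.F y : X) := by
        conv_lhs => rw [show l = l - S.φ y + S.φ y by omega, Function.iterate_add_apply]
        rfl
      rwa [h3]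

theorem quasiMeasurePreserving_iterate (n : ℕ) :
    Measure.QuasiMeasurePreserving S.T^[n] S.μX S.μX := by
  refine ⟨S.measurable_T.iterate n, Measure.AbsolutelyContinuous.mk fun N hN h0 => ?_⟩
  rw [Measure.map_apply (S.measurable_T.iterate n) hN,
    S.μX_eq_zero_iff (S.measurable_T.iterate n hN)]
  filter_upwards [S.ae_forall_iterate_notMem hN h0] with y hy l _
  rw [mem_preimage, ← Function.iterate_add_apply]
  exact hy _

theorem ae_iterate_of_ae {p : X → Prop} (h : ∀ᵐ x ∂S.μX, p x) :
    ∀ᵐ (y : S.Y) ∂S.μ, ∀ l, p (S.T^[l] (y : X)) := by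
  obtain ⟨N, hsub, hN, h0⟩ := exists_measurable_superset_of_null (ae_iff.1 h)
  filter_upwards [S.ae_forall_iterate_notMem hN h0] with y hy l
  by_contra hcon
  exact hy l (hsub hcon)

/-- Clipping a measurable representative at the essential supremum turns almost everywhere bounds
into the pointwise ones used on the towers. -/
theorem exists_bounded_representative {v : X → ℝ} (hv : MemLp v ⊤ S.μX) :
    ∃ v' : X → ℝ, Measurable v' ∧ (∀ x, |v' x| ≤ S.supNorm v) ∧ v =ᵐ[S.μX] v' := by
  have h0 : 0 ≤ S.supNorm v := ENNReal.toReal_nonneg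
  obtain ⟨g, hg, hvg⟩ := hv.1
  refine ⟨fun x => max (-S.supNorm v) (min (S.supNorm v) (g x)),
    measurable_const.max (measurable_const.min hg.measurable), fun x => ?_, ?_⟩
  · rw [abs_le]
    exact ⟨le_max_left _ _, max_le (by linarith) (min_le_left _ _)⟩
  · have hle : ∀ᵐ x ∂S.μX, |v x| ≤ S.supNorm v := by
      have h1 := ae_le_eLpNormEssSup (f := v) (μ := S.μX)
      filter_upwards [h1] with x hx
      rw [← eLpNorm_exponent_top] at hx
      have := ENNReal.toReal_mono hv.2.ne hx
      rwa [toReal_enorm, Real.norm_eq_abs] at this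
    filter_upwards [hvg, hle] with x h1 h2
    rw [← h1]
    rw [abs_le] at h2
    rw [min_eq_right h2.2, max_eq_right h2.1]

theorem corr_congr {v v' w w' : X → ℝ} (hv : v =ᵐ[S.μX] v') (hw : w =ᵐ[S.μX] w') (n : ℕ) :
    S.corr v w n = S.corr v' w' n := by
  rw [corr, corr, integral_congr_ae hv, integral_congr_ae hw]
  congr 1
  refine integral_congr_ae ?_
  filter_upwards [hv, (S.quasiMeasurePreserving_iterate n).ae_eq_comp hw] with x h1 h2
  simp only [Function.comp] at h2
  rw [h1, h2]

theorem corr_eq {v w : X → ℝ} (hv : Measurable v) (hw : Measurable w)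
    {a W : ℝ} (ha : ∀ x, |v x| ≤ a) (hW : ∀ x, |w x| ≤ W) (ha0 : 0 ≤ a) (n : ℕ) :
    S.corr v w n = (S.towerIntegral (fun x => v x * w (S.T^[n] x)) -
      S.towerIntegral v * S.towerIntegral w / ∫ y, (S.φ y : ℝ) ∂S.μ) /
        ∫ y, (S.φ y : ℝ) ∂S.μ := by
  have hp : ∫ y, (S.φ y : ℝ) ∂S.μ ≠ 0 := by linarith [S.one_le_integral_φ]
  rw [corr, S.integral_μX hv ha, S.integral_μX hw hW,
    S.integral_μX (f := fun x => v x * w (S.T^[n] x)) (c := a * W)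
      (hv.mul (hw.comp (S.measurable_T.iterate n))) fun x => by
        rw [abs_mul]
        exact mul_le_mul (ha _) (hW _) (abs_nonneg _) ha0]
  field_simp

theorem abs_corr_le_two_mul {v w : X → ℝ} (hv : Measurable v) (hw : Measurable w)
    {a W : ℝ} (ha : ∀ x, |v x| ≤ a) (hW : ∀ x, |w x| ≤ W) (ha0 : 0 ≤ a) (n : ℕ) :
    |S.corr v w n| ≤ 2 * (a * W) := by
  have hp := S.one_le_integral_φ
  have hp0 : 0 < ∫ y, (S.φ y : ℝ) ∂S.μ := by linarith
  have h1 := S.abs_towerIntegral_le (v := fun x => v x * w (S.T^[n] x)) (a := a * W) fun x => by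
    rw [abs_mul]
    exact mul_le_mul (ha _) (hW _) (abs_nonneg _) ha0
  have h2 := S.abs_towerIntegral_le ha
  have h3 := S.abs_towerIntegral_le hW
  rw [S.corr_eq hv hw ha hW ha0, abs_div, abs_of_pos hp0, div_le_iff₀ hp0]
  refine (abs_sub _ _).trans ?_
  rw [abs_div, abs_mul, abs_of_pos hp0]
  have h4 : |S.towerIntegral v| * |S.towerIntegral w| / ∫ y, (S.φ y : ℝ) ∂S.μ ≤
      a * W * ∫ y, (S.φ y : ℝ) ∂S.μ := by
    rw [div_le_iff₀ hp0]
    calc _ ≤ (a * ∫ y, (S.φ y : ℝ) ∂S.μ) * (W * ∫ y, (S.φ y : ℝ) ∂S.μ) := by gcongr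
      _ = _ := by ring
  linarith

theorem abs_corr_le {v w : X → ℝ} (hv : Measurable v) (hw : Measurable w)
    {a W : ℝ} (ha : ∀ x, |v x| ≤ a) (hW : ∀ x, |w x| ≤ W) (ha0 : 0 ≤ a)
    {k : ℕ} (hk : 1 ≤ k) (n : ℕ) {α : ℝ}
    (hα : α = S.truncIntegral k v / ∫ y, ((min (S.φ y) k : ℕ) : ℝ) ∂S.μ) :
    |S.corr v w n| ≤
      4 * a * W * S.towerTail k + 2 * a * W * (n * S.μ.real {y | k < S.φ y}) +
        |S.truncCorr k n (fun x => v x - α) w| := by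
  have hp := S.one_le_integral_φ
  rw [S.corr_eq hv hw ha hW ha0, abs_div, abs_of_pos (by linarith : 0 < ∫ y, (S.φ y : ℝ) ∂S.μ)]
  exact (div_le_self (abs_nonneg _) hp).trans
    (S.abs_towerIntegral_corr_le hv hw ha hW ha0 hk n hα)

variable {S}
variable {B : Type*} [NormedAddCommGroup B] [NormedSpace ℂ B] {ι : FunctionSpace S.μ B}

/-- Changing `v` on a `μX`-null set changes every `v ∘ T^l` on `Y` only on a `μ`-null set, so the
same elements of `B` represent the derived observables. -/
theorem HasDerivedBound.congr {v v' : X → ℝ} {D : ℝ} (h : HasDerivedBound ι v D)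
    (hvv : v =ᵐ[S.μX] v') : HasDerivedBound ι v' D := by
  intro j hj hj'
  obtain ⟨b, hb, hbD⟩ := h j hj hj'
  refine ⟨b, ?_, hbD⟩
  unfold FunctionSpace.Represents at hb ⊢
  filter_upwards [hb, S.ae_iterate_of_ae hvv] with y h1 h2
  rw [h1, h2]

theorem represents_unique {b b' : B} {g : S.Y → ℝ} (h : ι.Represents b g)
    (h' : ι.Represents b' g) : b = b' :=
  ι.injective (Lp.ext (h.trans h'.symm))

theorem Exchangeable.hasDerivedBound {v : X → ℝ} (h : S.Exchangeable ι v) :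
    HasDerivedBound ι v (S.exchNorm ι v) := by
  intro j hj hj'
  obtain ⟨M, hM⟩ := h
  have hg : (fun y : S.Y => v (S.T^[j (S.φ y)] y)) ∈ S.derivedSet v := by
    rcases hj' with h0 | h1
    · exact Or.inl fun y => by simp [h0]
    · refine Or.inr ⟨fun y hy => ?_, fun n hn => ⟨j n, h1 n hn, ?_, fun y hy => by simp only [hy]⟩⟩
      · have := hj 1 le_rfl
        simp only [hy, show j 1 = 0 by omega, Function.iterate_zero, id]
      · have := hj n (by omega)
        omega
  obtain ⟨b, hb, -⟩ := hM _ hg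
  refine ⟨b, hb, le_csSup ⟨M, ?_⟩ ⟨_, hg, b, hb, rfl⟩⟩
  rintro t ⟨g, hg', b', hb', rfl⟩
  obtain ⟨b'', hb'', hbM⟩ := hM g hg'
  rwa [represents_unique hb' hb'']

end InducingScheme

/-! ### Consequences of the doubling condition on `u`. -/

section Sequences

variable {u : ℕ → ℝ} {C : ℝ}

/-- Halving `n`, rounded up, `i` times; each halving costs one factor `C`. -/
theorem le_pow_mul_of_le_mul_two_pow (hC : 0 ≤ C)
    (hu : ∀ n j : ℕ, 1 ≤ n → (n : ℝ) / 2 ≤ j → u j ≤ C * u n) (i : ℕ) {n j : ℕ} (hn : 1 ≤ n)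
    (hnj : n ≤ j * 2 ^ i) : u j ≤ C ^ (i + 1) * u n := by
  induction i generalizing n with
  | zero =>
    rw [zero_add, pow_one]
    refine hu n j hn ?_
    have : (n : ℝ) ≤ j := by exact_mod_cast (by simpa using hnj : n ≤ j)
    linarith [(n.cast_nonneg : (0 : ℝ) ≤ n)]
  | succ i ih =>
    have h1 : n ≤ 2 * (j * 2 ^ i) := by
      rw [pow_succ] at hnj
      linarith
    have h2 := ih (n := (n + 1) / 2) (by omega) (by omega)
    have h3 : u ((n + 1) / 2) ≤ C * u n := by
      refine hu n _ hn ?_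
      have : n ≤ 2 * ((n + 1) / 2) := by omega
      have : (n : ℝ) ≤ 2 * ((n + 1) / 2 : ℕ) := by exact_mod_cast this
      linarith
    calc u j ≤ C ^ (i + 1) * u ((n + 1) / 2) := h2
      _ ≤ C ^ (i + 1) * (C * u n) := by gcongr
      _ = _ := by ring

theorem one_le_const_of_pos (hupos : ∀ n, 1 ≤ n → 0 < u n)
    (hu : ∀ n j : ℕ, 1 ≤ n → (n : ℝ) / 2 ≤ j → u j ≤ C * u n) : 1 ≤ C := by
  have h := hu 1 1 le_rfl (by norm_num)
  have h1 := hupos 1 le_rfl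
  by_contra hcon
  nlinarith

/-- The sequence `u` decreases at most polynomially. -/
theorem exists_le_pow_mul (hupos : ∀ n, 1 ≤ n → 0 < u n)
    (hu : ∀ n j : ℕ, 1 ≤ n → (n : ℝ) / 2 ≤ j → u j ≤ C * u n) :
    ∃ p : ℕ, ∀ n : ℕ, 1 ≤ n → u 1 ≤ (4 * n) ^ p * u n := by
  have hC := one_le_const_of_pos hupos hu
  -- With `C < 2 ^ p`, the power `C ^ (log₂ n + 2)` lost in going from `1` to `n` is at most `(4 n)
  -- ^ p`.
  obtain ⟨p, hp⟩ := pow_unbounded_of_one_lt C (one_lt_two : (1 : ℝ) < 2)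
  refine ⟨p, fun n hn => ?_⟩
  have h1 := le_pow_mul_of_le_mul_two_pow (by linarith) hu (Nat.log 2 n + 1) (j := 1) hn
    (by rw [one_mul]; exact (Nat.lt_pow_succ_log_self one_lt_two n).le)
  have h2 : C ^ (Nat.log 2 n + 1 + 1) ≤ (4 * (n : ℝ)) ^ p := by
    calc C ^ (Nat.log 2 n + 1 + 1) ≤ (2 ^ p) ^ (Nat.log 2 n + 1 + 1) := by gcongr
      _ = (4 * ((2 ^ Nat.log 2 n : ℕ) : ℝ)) ^ p := by
          push_cast
          rw [← pow_mul, mul_comm p, pow_mul]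
          congr 1
          ring
      _ ≤ (4 * (n : ℝ)) ^ p := by
          gcongr
          exact Nat.pow_log_le_self 2 (by omega)
  have := hupos n hn
  exact h1.trans (by gcongr)

theorem summable_add_left (hs : Summable u) (k : ℕ) : Summable fun j => u (k + j) := by
  simp only [add_comm k]
  exact (summable_nat_add_iff k).2 hs

/-- Each of the `n` terms `u (n + 1), …, u (2 n)` is at least `u n / C`. -/
theorem mul_le_tail (hupos : ∀ n, 1 ≤ n → 0 < u n)
    (hu : ∀ n j : ℕ, 1 ≤ n → (n : ℝ) / 2 ≤ j → u j ≤ C * u n) (hs : Summable u) (n : ℕ) :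
    n * u n ≤ C * ∑' j, u (n + 1 + j) := by
  have hC := one_le_const_of_pos hupos hu
  calc n * u n = ∑ _j ∈ Finset.range n, u n := by simp
    _ ≤ ∑ j ∈ Finset.range n, C * u (n + 1 + j) := by
        refine Finset.sum_le_sum fun j hj => hu _ _ (by omega) ?_
        have : n + 1 + j ≤ 2 * n := by
          have := Finset.mem_range.1 hj
          omega
        have : ((n + 1 + j : ℕ) : ℝ) ≤ 2 * n := by exact_mod_cast this
        linarith
    _ = C * ∑ j ∈ Finset.range n, u (n + 1 + j) := by rw [Finset.mul_sum]
    _ ≤ _ := by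
        gcongr
        exact (summable_add_left hs (n + 1)).sum_le_tsum _ fun j _ => (hupos _ (by omega)).le

/-- The terms between `k` and `n` are at most `C ^ (Q + 1) u n` and there are at most `n` of them,
so their sum is absorbed by `mul_le_tail`. -/
theorem tail_le_mul_tail (hupos : ∀ n, 1 ≤ n → 0 < u n)
    (hu : ∀ n j : ℕ, 1 ≤ n → (n : ℝ) / 2 ≤ j → u j ≤ C * u n) (hs : Summable u) {Q k n : ℕ}
    (hk : 1 ≤ k) (hkn : k ≤ n) (hnk : n ≤ k * 2 ^ Q) :
    ∑' j, u (k + j) ≤ (C ^ (Q + 2) + 1) * ∑' j, u (n + 1 + j) := by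
  have hC := one_le_const_of_pos hupos hu
  have hC0 : 0 ≤ C := by linarith
  have hun := hupos n (by omega)
  rw [← (summable_add_left hs k).sum_add_tsum_nat_add (n + 1 - k), add_mul, one_mul]
  refine add_le_add ?_ (le_of_eq (tsum_congr fun j => congrArg u (by omega)))
  calc ∑ j ∈ Finset.range (n + 1 - k), u (k + j)
      ≤ ∑ _j ∈ Finset.range (n + 1 - k), C ^ (Q + 1) * u n :=
        Finset.sum_le_sum fun j _ => le_pow_mul_of_le_mul_two_pow hC0 hu Q (by omega)
          (hnk.trans (Nat.mul_le_mul_right _ (by omega)))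
    _ = ((n + 1 - k : ℕ) : ℝ) * (C ^ (Q + 1) * u n) := by simp
    _ ≤ n * (C ^ (Q + 1) * u n) := by
        gcongr
        omega
    _ = C ^ (Q + 1) * (n * u n) := by ring
    _ ≤ C ^ (Q + 1) * (C * ∑' j, u (n + 1 + j)) :=
        mul_le_mul_of_nonneg_left (mul_le_tail hupos hu hs n) (by positivity)
    _ = _ := by ring

theorem one_div_pow_le_tail (hupos : ∀ n, 1 ≤ n → 0 < u n) (hs : Summable u) {p : ℕ}
    (hp : ∀ n : ℕ, 1 ≤ n → u 1 ≤ (4 * n) ^ p * u n) {n : ℕ} (hn : 1 ≤ n) :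
    1 ≤ (8 * n) ^ p / u 1 * ∑' j, u (n + 1 + j) := by
  have h1 := hupos 1 le_rfl
  have hn' : (1 : ℝ) ≤ n := by exact_mod_cast hn
  have h2 : u (n + 1) ≤ ∑' j, u (n + 1 + j) :=
    (summable_add_left hs (n + 1)).le_tsum 0 fun j _ => (hupos _ (by omega)).le
  have h3 : (4 * ((n + 1 : ℕ) : ℝ)) ^ p ≤ (8 * n) ^ p := by
    refine pow_le_pow_left₀ (by positivity) ?_ p
    push_cast
    linarith
  rw [div_mul_eq_mul_div, le_div_iff₀ h1, one_mul]
  calc u 1 ≤ (4 * ((n + 1 : ℕ) : ℝ)) ^ p * u (n + 1) := hp (n + 1) (by omega)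
    _ ≤ _ := by
      have := hupos (n + 1) (by omega)
      gcongr

end Sequences

/-! ### Choice of the truncation height. -/

namespace InducingScheme

variable {X : Type*} [MeasurableSpace X] (S : InducingScheme X)

/-- Layer-cake formula for the overshoot `φ - min φ k`. -/
theorem ofReal_towerTail (k : ℕ) :
    ENNReal.ofReal (S.towerTail k) = ∑' j, S.μ {y | k + j < S.φ y} := by
  have hpt : ∀ y, ENNReal.ofReal ((S.φ y : ℝ) - (min (S.φ y) k : ℕ)) =
      ∑' j, {y | k + j < S.φ y}.indicator (fun _ => (1 : ℝ≥0∞)) y := by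
    intro y
    rw [tsum_eq_sum (s := Finset.range (S.φ y - k)) fun j hj => indicator_of_notMem (by
        simp only [Finset.mem_range] at hj
        simp only [mem_ofPred_eq]
        omega) _, ← Nat.cast_sub (min_le_left _ _), ENNReal.ofReal_natCast,
      Finset.sum_congr rfl fun j hj => indicator_of_mem (by
        simp only [Finset.mem_range] at hj
        simp only [mem_ofPred_eq]
        omega) _]
    simp only [Finset.sum_const, Finset.card_range, nsmul_eq_mul, mul_one]
    congr 1
    omega
  have hm : ∀ j, MeasurableSet {y | k + j < S.φ y} := fun j => S.measurableSet_φ {n | k + j < n}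
  rw [towerTail, ofReal_integral_eq_lintegral_ofReal (S.integrable_sub_min_φ k)]
  · simp only [hpt]
    rw [lintegral_tsum fun j => (measurable_const.indicator (hm j)).aemeasurable]
    exact tsum_congr fun j => lintegral_indicator_one (hm j)
  · refine ae_of_all _ fun y => ?_
    have : ((min (S.φ y) k : ℕ) : ℝ) ≤ S.φ y := by exact_mod_cast min_le_left _ _
    simp only [Pi.zero_apply]
    linarith

theorem towerTail_le {u : ℕ → ℝ} (hupos : ∀ n, 1 ≤ n → 0 < u n) (hs : Summable u) {C : ℝ}
    (hC : 0 ≤ C) (hφ : ∀ n : ℕ, 1 ≤ n → S.μ.real {y | n < S.φ y} ≤ C * u n) {k : ℕ} (hk : 1 ≤ k) :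
    S.towerTail k ≤ C * ∑' j, u (k + j) := by
  have h0 : ∀ j, 0 ≤ C * u (k + j) := fun j => mul_nonneg hC (hupos _ (by omega)).le
  rw [← tsum_mul_left, ← ENNReal.ofReal_le_ofReal_iff (tsum_nonneg h0), ofReal_towerTail,
    ENNReal.ofReal_tsum_of_nonneg h0 ((summable_add_left hs k).mul_left C)]
  refine ENNReal.tsum_le_tsum fun j => ?_
  rw [← ofReal_measureReal]
  exact ENNReal.ofReal_le_ofReal (hφ _ (by omega))

variable {S}
variable {B : Type*} [NormedAddCommGroup B] [NormedSpace ℂ B] [CompleteSpace B]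
  {ι : FunctionSpace S.μ B} {R : ℕ → B →L[ℂ] B}

/-- Centring is harmless: constants lie in `B`, so subtracting `α` with `|α| ≤ a` increases the
derived bound by at most `a ‖e‖`. -/
theorem exists_truncCorr_le (hR : S.IsRenewalSequence ι R) (hgood : IsGood R)
    {ε : ℝ} (hε : 0 < ε)
    (htail : ∃ C : ℝ, ∀ n : ℕ, 1 ≤ n → normTail R n ≤ C / (n : ℝ) ^ (1 + ε)) :
    ∃ c : ℝ, 0 < c ∧ ∃ C : ℝ, 0 ≤ C ∧ ∃ K : ℕ, 1 ≤ K ∧ ∀ k, K ≤ k → ∀ n, k ≤ n →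
      ∀ (v w : X → ℝ) (a W D : ℝ), Measurable v → Measurable w → (∀ x, |v x| ≤ a) →
      (∀ x, |w x| ≤ W) → 0 ≤ a → 0 ≤ W → HasDerivedBound ι v D → ∀ α : ℝ,
      α = S.truncIntegral k v / ∫ y, ((min (S.φ y) k : ℕ) : ℝ) ∂S.μ →
      |S.truncCorr k n (fun x => v x - α) w| ≤
        C * ((a + D) * W) * (k : ℝ) ^ 4 * (radius c k ^ (n - k))⁻¹ := by
  obtain ⟨c, hc, C, hC, K, hK, h⟩ := exists_truncated_correlation_le hR hgood hε htail
  obtain ⟨e, he⟩ := ι.const_mem 1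
  refine ⟨c, hc, C * (1 + ‖e‖), by positivity, K, hK,
    fun k hk n hkn v w a W D hv hw ha hW ha0 hW0 hD α hα => ?_⟩
  have hk1 : 1 ≤ k := hK.trans hk
  have hq0 : 0 < ∫ y, ((min (S.φ y) k : ℕ) : ℝ) ∂S.μ := by linarith [S.one_le_integral_min_φ hk1]
  have hαa : |α| ≤ a := by
    rw [hα, abs_div, abs_of_pos hq0, div_le_iff₀ hq0]
    exact S.abs_truncIntegral_le ha k
  have hv' : Measurable fun x => v x - α := hv.sub_const α
  have ha' : ∀ x, |v x - α| ≤ a + a := fun x => (abs_sub _ _).trans (add_le_add (ha x) hαa)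
  have hwm : ∀ b, Measurable ((S.towerShift k)^[n] (fun l y => w (S.T^[l] y)) b) :=
    S.measurable_iterate_towerShift k (S.measurable_comp_iterate hw) n
  have hwb : ∀ b y, |(S.towerShift k)^[n] (fun l y => w (S.T^[l] y)) b y| ≤ W :=
    S.iterate_towerShift_mem k (p := fun x => |x| ≤ W) (fun _ _ => hW _) n
  have hmean : ∑ l ∈ Finset.range k, ∫ y in {y | l < min (S.φ y) k},
      (v (S.T^[l] y) - α) ∂S.μ = 0 := by
    rw [S.sum_setIntegral_lt_eq k (f := fun l y => v (S.T^[l] y) - α) fun l =>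
      Integrable.of_bound (S.measurable_comp_iterate hv' l).aestronglyMeasurable (a + a)
        (ae_of_all _ fun y => ha' _)]
    change S.truncIntegral k (fun x => v x - α) = 0
    rw [S.truncIntegral_sub_const hv ha, hα, div_mul_cancel₀ _ hq0.ne', sub_self]
  have hmain := h k hk n hkn (fun x => v x - α) (a + a) (D + |α| * ‖e‖) hv' ha'
    (hD.sub_const he α) hmean (fun l y => w (S.T^[l] y)) W (S.measurable_comp_iterate hw)
    fun _ _ => hW _
  rw [S.sum_setIntegral_lt_eq k (f := fun l y => (v (S.T^[l] y) - α) *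
    (S.towerShift k)^[n] (fun l y => w (S.T^[l] y)) l y) fun l =>
      Integrable.of_bound
        ((S.measurable_comp_iterate hv' l).mul (hwm l)).aestronglyMeasurable ((a + a) * W)
        (ae_of_all _ fun y => by
          rw [norm_mul]
          exact mul_le_mul (ha' _) (hwb l y) (norm_nonneg _) (by linarith))] at hmain
  obtain ⟨b, -, hb⟩ := hD (fun _ => 0) (fun n hn => by omega) (Or.inl fun _ => rfl)
  have hD0 : 0 ≤ D := (norm_nonneg _).trans hb
  have hr : 0 ≤ radius c k := zero_le_one.trans (one_le_radius hc.le hk1)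
  refine hmain.trans ?_
  have h1 : W * (D + |α| * ‖e‖) ≤ (1 + ‖e‖) * ((a + D) * W) := by
    have h2 : |α| * ‖e‖ ≤ a * ‖e‖ := by gcongr
    have h3 : 0 ≤ D * ‖e‖ := by positivity
    nlinarith [mul_le_mul_of_nonneg_left h2 hW0, mul_nonneg hW0 h3, mul_nonneg hW0 ha0]
  calc C * (W * (D + |α| * ‖e‖)) * (k : ℝ) ^ 4 * (radius c k ^ (n - k))⁻¹
      ≤ C * ((1 + ‖e‖) * ((a + D) * W)) * (k : ℝ) ^ 4 * (radius c k ^ (n - k))⁻¹ := by gcongr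
    _ = _ := by ring

/-- Since `r ^ k = k ^ c` and `n - k ≥ k (2 ^ Q - 1)`, the decay factor beats `k ^ (4 + p)`. -/
theorem pow_mul_inv_radius_pow_le {c : ℝ} (hc : 0 < c) {p Q k n : ℕ} (hk : 1 ≤ k)
    (hQ : 4 + p ≤ c * (2 ^ Q - 1)) (hn : k * 2 ^ Q ≤ n) :
    (k : ℝ) ^ 4 * (radius c k ^ (n - k))⁻¹ ≤ ((k : ℝ) ^ p)⁻¹ := by
  have hk' : (1 : ℝ) ≤ k := by exact_mod_cast hk
  have hk0 : (0 : ℝ) < k := by linarith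
  have h1 : (k : ℝ) ^ (4 + p) ≤ radius c k ^ (n - k) := by
    calc (k : ℝ) ^ (4 + p) = (k : ℝ) ^ ((4 + p : ℕ) : ℝ) := (Real.rpow_natCast _ _).symm
      _ ≤ (k : ℝ) ^ (c * ((2 ^ Q - 1 : ℕ) : ℝ)) := by
          refine Real.rpow_le_rpow_of_exponent_le hk' ?_
          rw [Nat.cast_sub Nat.one_le_two_pow]
          push_cast
          exact hQ
      _ = radius c k ^ (k * (2 ^ Q - 1)) := by
          rw [pow_mul, radius_pow_self c hk, Real.rpow_mul hk0.le, Real.rpow_natCast]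
      _ ≤ radius c k ^ (n - k) := by
          refine pow_le_pow_right₀ (one_le_radius hc.le hk) ?_
          rw [Nat.mul_sub, mul_one]
          omega
  rw [← div_eq_mul_inv, div_le_iff₀ (lt_of_lt_of_le (by positivity) h1), inv_mul_eq_div,
    le_div_iff₀ (by positivity), ← pow_add]
  exact h1

theorem exists_abs_corr_le (hR : S.IsRenewalSequence ι R) (hgood : IsGood R)
    {ε : ℝ} (hε : 0 < ε)
    (htail : ∃ C : ℝ, ∀ n : ℕ, 1 ≤ n → normTail R n ≤ C / (n : ℝ) ^ (1 + ε))
    {u : ℕ → ℝ} (hupos : ∀ n, 1 ≤ n → 0 < u n)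
    (hu : ∃ C : ℝ, ∀ n j : ℕ, 1 ≤ n → (n : ℝ) / 2 ≤ j → u j ≤ C * u n)
    (hφ : ∃ C : ℝ, ∀ n : ℕ, 1 ≤ n → S.μ.real {y | n < S.φ y} ≤ C * u n) (hs : Summable u) :
    ∃ C : ℝ, 0 < C ∧ ∀ (v w : X → ℝ) (a W D : ℝ), Measurable v → Measurable w →
      (∀ x, |v x| ≤ a) → (∀ x, |w x| ≤ W) → 0 ≤ a → 0 ≤ W → HasDerivedBound ι v D →
      ∀ n : ℕ, 1 ≤ n → |S.corr v w n| ≤ C * ((a + D) * W) * ∑' j, u (n + 1 + j) := by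
  obtain ⟨C₀, hu⟩ := hu
  obtain ⟨C₁, hφ⟩ := hφ
  have hC₀ := one_le_const_of_pos hupos hu
  have hC₀' : 0 ≤ C₀ := by linarith
  have hu1 := hupos 1 le_rfl
  have hC₁ : 0 ≤ C₁ := by
    have := measureReal_nonneg.trans (hφ 1 le_rfl)
    by_contra hcon
    nlinarith
  obtain ⟨p, hp⟩ := exists_le_pow_mul hupos hu
  obtain ⟨c, hc, A, hA, K, hK, h⟩ := exists_truncCorr_le hR hgood hε htail
  -- `p` bounds the polynomial rate at which `u` can decrease and `4` pays for the factor `k ^ 4`;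
  -- `Q` depends on neither `n` nor the observables.
  obtain ⟨Q, hQ⟩ : ∃ Q : ℕ, (4 + p : ℝ) ≤ c * (2 ^ Q - 1) := by
    obtain ⟨Q, hQ⟩ := pow_unbounded_of_one_lt ((4 + p) / c + 1) (one_lt_two : (1 : ℝ) < 2)
    refine ⟨Q, ?_⟩
    rw [← div_le_iff₀' hc]
    linarith
  set E₁ : ℝ := 4 * (C₁ * (C₀ ^ (Q + 3) + 1)) with hE₁
  set E₂ : ℝ := 2 * (C₁ * C₀ ^ (Q + 3)) with hE₂
  set E₃ : ℝ := A * ((8 * 2 ^ (Q + 1)) ^ p / u 1) with hE₃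
  set E₄ : ℝ := 2 * ((8 * (K * 2 ^ Q : ℕ)) ^ p / u 1) with hE₄
  have p1 : 0 ≤ E₁ := by positivity
  have p2 : 0 ≤ E₂ := by positivity
  have p3 : 0 ≤ E₃ := by positivity
  have p4 : 0 ≤ E₄ := by positivity
  refine ⟨E₁ + E₂ + E₃ + E₄ + 1, by positivity,
    fun v w a W D hv hw ha hW ha0 hW0 hD n hn => ?_⟩
  obtain ⟨b, -, hb⟩ := hD (fun _ => 0) (fun n hn => by omega) (Or.inl fun _ => rfl)
  have hD0 : 0 ≤ D := (norm_nonneg _).trans hb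
  set s := ∑' j, u (n + 1 + j) with hsdef
  have hs0 : 0 ≤ s := tsum_nonneg fun j => (hupos _ (by omega)).le
  have hlow := one_div_pow_le_tail hupos hs hp hn
  rw [← hsdef] at hlow
  have haW : a * W ≤ (a + D) * W := by
    gcongr
    linarith
  have hF : 0 ≤ (a + D) * W := by positivity
  have hFs : 0 ≤ (a + D) * W * s := by positivity
  -- For these finitely many `n` the trivial bound suffices, because the tail of `u` is bounded
  -- below there.
  by_cases hnK : n < K * 2 ^ Q
  · have h1 := S.abs_corr_le_two_mul hv hw ha hW ha0 n
    have h2 : 1 ≤ (8 * (K * 2 ^ Q : ℕ)) ^ p / u 1 * s := by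
      refine hlow.trans ?_
      gcongr
    calc |S.corr v w n| ≤ 2 * ((a + D) * W) * 1 := by linarith
      _ ≤ 2 * ((a + D) * W) * ((8 * (K * 2 ^ Q : ℕ)) ^ p / u 1 * s) := by gcongr
      _ = E₄ * ((a + D) * W * s) := by
          rw [hE₄]
          ring
      _ ≤ (E₁ + E₂ + E₃ + E₄ + 1) * ((a + D) * W * s) :=
          mul_le_mul_of_nonneg_right (by linarith) hFs
      _ = _ := by ring
  · rw [not_lt] at hnK
    -- This height is proportional to `n`, so `u k` and the tail from `k` are comparable to their
    -- values at `n`, while `n / k ≥ 2 ^ Q` makes the truncated correlation small.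
    set k := n / 2 ^ Q with hkdef
    have hKk : K ≤ k := (Nat.le_div_iff_mul_le (by positivity)).2 hnK
    have hk1 : 1 ≤ k := hK.trans hKk
    have hkn' : k * 2 ^ Q ≤ n := Nat.div_mul_le_self n _
    have hkn : k ≤ n := Nat.div_le_self n _
    have hnk : n ≤ k * 2 ^ (Q + 1) := by
      have h1 : n < 2 ^ Q * (k + 1) := Nat.lt_mul_div_succ n (by positivity)
      have h2 : 2 ^ Q * (k + 1) ≤ k * 2 ^ (Q + 1) := by
        rw [pow_succ]
        nlinarith [Nat.mul_le_mul_left (2 ^ Q) hk1]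
      omega
    have hk0 : (0 : ℝ) < k := by exact_mod_cast hk1
    have b0 := S.abs_corr_le hv hw ha hW ha0 hk1 n rfl
    have b1 : S.towerTail k ≤ C₁ * ((C₀ ^ (Q + 3) + 1) * s) :=
      (S.towerTail_le hupos hs hC₁ hφ hk1).trans
        (mul_le_mul_of_nonneg_left (tail_le_mul_tail hupos hu hs hk1 hkn hnk) hC₁)
    have b2 : n * S.μ.real {y | k < S.φ y} ≤ C₁ * C₀ ^ (Q + 3) * s := by
      calc n * S.μ.real {y | k < S.φ y} ≤ n * (C₁ * (C₀ ^ (Q + 2) * u n)) := by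
            gcongr
            exact (hφ k hk1).trans (mul_le_mul_of_nonneg_left
              (le_pow_mul_of_le_mul_two_pow hC₀' hu (Q + 1) hn hnk) hC₁)
        _ = C₁ * C₀ ^ (Q + 2) * (n * u n) := by ring
        _ ≤ C₁ * C₀ ^ (Q + 2) * (C₀ * s) :=
            mul_le_mul_of_nonneg_left (mul_le_tail hupos hu hs n) (by positivity)
        _ = _ := by ring
    have b3 := h k hKk n hkn v w a W D hv hw ha hW ha0 hW0 hD _ rfl
    have b4 : (k : ℝ) ^ 4 * (radius c k ^ (n - k))⁻¹ ≤ (8 * 2 ^ (Q + 1)) ^ p / u 1 * s := by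
      refine (pow_mul_inv_radius_pow_le hc hk1 hQ hkn').trans ?_
      rw [inv_le_iff_one_le_mul₀ (by positivity)]
      refine hlow.trans ?_
      have hnk' : (n : ℝ) ≤ k * 2 ^ (Q + 1) := by exact_mod_cast hnk
      calc (8 * (n : ℝ)) ^ p / u 1 * s ≤ (8 * (k * 2 ^ (Q + 1))) ^ p / u 1 * s := by gcongr
        _ = _ := by
          rw [show 8 * ((k : ℝ) * 2 ^ (Q + 1)) = 8 * 2 ^ (Q + 1) * k by ring, mul_pow]
          ring
    have c1 : 4 * a * W * S.towerTail k ≤ E₁ * ((a + D) * W * s) := by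
      calc 4 * a * W * S.towerTail k = 4 * (a * W) * S.towerTail k := by ring
        _ ≤ 4 * ((a + D) * W) * (C₁ * ((C₀ ^ (Q + 3) + 1) * s)) := by
            have := S.towerTail_nonneg k
            gcongr
        _ = _ := by
            rw [hE₁]
            ring
    have c2 : 2 * a * W * (n * S.μ.real {y | k < S.φ y}) ≤ E₂ * ((a + D) * W * s) := by
      calc 2 * a * W * (n * S.μ.real {y | k < S.φ y})
          = 2 * (a * W) * (n * S.μ.real {y | k < S.φ y}) := by ring
        _ ≤ 2 * ((a + D) * W) * (C₁ * C₀ ^ (Q + 3) * s) := by gcongr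
        _ = _ := by
            rw [hE₂]
            ring
    have c3 : A * ((a + D) * W) * (k : ℝ) ^ 4 * (radius c k ^ (n - k))⁻¹ ≤
        E₃ * ((a + D) * W * s) := by
      calc A * ((a + D) * W) * (k : ℝ) ^ 4 * (radius c k ^ (n - k))⁻¹
          = A * ((a + D) * W) * ((k : ℝ) ^ 4 * (radius c k ^ (n - k))⁻¹) := by ring
        _ ≤ A * ((a + D) * W) * ((8 * 2 ^ (Q + 1)) ^ p / u 1 * s) := by gcongr
        _ = _ := by
            rw [hE₃]
            ring
    calc |S.corr v w n| ≤ (E₁ + E₂ + E₃) * ((a + D) * W * s) := by linarith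
      _ ≤ (E₁ + E₂ + E₃ + E₄ + 1) * ((a + D) * W * s) :=
          mul_le_mul_of_nonneg_right (by linarith) hFs
      _ = _ := by ring

end InducingScheme

end Decay

end

/-! ### Conclusion. -/

theorem mainTheorem8 {X : Type*} [MeasurableSpace X] (S : Decay.InducingScheme X)
    {B : Type*} [NormedAddCommGroup B] [NormedSpace ℂ B] [CompleteSpace B]
    (ι : Decay.FunctionSpace S.μ B) (R : ℕ → B →L[ℂ] B)
    (hR : S.IsRenewalSequence ι R) (hgood : Decay.IsGood R)
    (ε : ℝ) (hε : 0 < ε)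
    (htail : ∃ C : ℝ, ∀ n : ℕ, 1 ≤ n → Decay.normTail R n ≤ C / (n : ℝ) ^ (1 + ε))
    (u : ℕ → ℝ) (hupos : ∀ n, 1 ≤ n → 0 < u n)
    (hu : ∃ C : ℝ, ∀ n j : ℕ, 1 ≤ n → (n : ℝ) / 2 ≤ j → u j ≤ C * u n)
    (hφ : ∃ C : ℝ, ∀ n : ℕ, 1 ≤ n → S.μ.real {y | n < S.φ y} ≤ C * u n) :
    ∃ C : ℝ, 0 < C ∧ ∀ v w : X → ℝ,
      MeasureTheory.MemLp v ⊤ S.μX → S.Exchangeable ι v → MeasureTheory.MemLp w ⊤ S.μX →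
      ∀ n : ℕ, 1 ≤ n →
        ENNReal.ofReal |S.corr v w n| ≤
          ENNReal.ofReal (C * (S.supNorm v + S.exchNorm ι v) * S.supNorm w) *
            ∑' j : ℕ, ENNReal.ofReal (u (n + 1 + j)) := by
  by_cases hs : Summable u
  · obtain ⟨C, hC, h⟩ :=
      Decay.InducingScheme.exists_abs_corr_le hR hgood hε htail hupos hu hφ hs
    refine ⟨C, hC, fun v w hv hex hw n hn => ?_⟩
    obtain ⟨v', hv'm, hv'b, hvv'⟩ := S.exists_bounded_representative hv
    obtain ⟨w', hw'm, hw'b, hww'⟩ := S.exists_bounded_representative hw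
    have hmain := h v' w' _ _ _ hv'm hw'm hv'b hw'b ENNReal.toReal_nonneg ENNReal.toReal_nonneg
      (hex.hasDerivedBound.congr hvv') n hn
    have hu0 : ∀ j, 0 ≤ u (n + 1 + j) := fun j => (hupos _ (by omega)).le
    rw [S.corr_congr hvv' hww', ← ENNReal.ofReal_tsum_of_nonneg hu0 (Decay.summable_add_left hs _),
      ← ENNReal.ofReal_mul' (tsum_nonneg hu0), mul_assoc C]
    exact ENNReal.ofReal_le_ofReal hmain
  · refine ⟨1, one_pos, fun v w hv hex hw n hn => ?_⟩
    obtain ⟨v', hv'm, hv'b, hvv'⟩ := S.exists_bounded_representative hv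
    obtain ⟨w', hw'm, hw'b, hww'⟩ := S.exists_bounded_representative hw
    have hbound := S.abs_corr_le_two_mul hv'm hw'm hv'b hw'b ENNReal.toReal_nonneg n
    obtain ⟨b, -, hb⟩ := hex.hasDerivedBound (fun _ => 0) (fun n hn => by omega)
      (Or.inl fun _ => rfl)
    have hD0 : 0 ≤ S.exchNorm ι v := (norm_nonneg _).trans hb
    have htop : ∑' j : ℕ, ENNReal.ofReal (u (n + 1 + j)) = ⊤ := by
      by_contra hne
      have h1 := ENNReal.summable_toReal hne
      have h2 : ∀ j, (ENNReal.ofReal (u (n + 1 + j))).toReal = u (j + (n + 1)) := fun j => by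
        rw [ENNReal.toReal_ofReal (hupos _ (by omega)).le, add_comm]
      simp only [h2] at h1
      exact hs ((summable_nat_add_iff (n + 1)).1 h1)
    have ha0 : 0 ≤ S.supNorm v := ENNReal.toReal_nonneg
    have hW0 : 0 ≤ S.supNorm w := ENNReal.toReal_nonneg
    rw [S.corr_congr hvv' hww', htop, one_mul]
    -- The tail of `u` is infinite here, so only a vanishing prefactor needs an argument: then one
    -- of the sup norm of `w` and the sup norm of `v` is zero, and the trivial bound gives zero
    -- correlation, matching `0 * ⊤ = 0`.
    rcases (mul_nonneg (add_nonneg ha0 hD0) hW0).eq_or_lt with h0 | h0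
    · have h1 : S.supNorm v * S.supNorm w = 0 := by
        nlinarith [mul_nonneg ha0 hW0, mul_nonneg hD0 hW0]
      rw [h1, mul_zero] at hbound
      rw [ENNReal.ofReal_of_nonpos hbound]
      exact zero_le
    · rw [ENNReal.mul_top (ENNReal.ofReal_pos.2 h0).ne']
      exact le_top
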